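/- Let $N\ge 1$, $s\in(0,1)$, let $\gamma$ be the standard Gaussian measure on $\mathbb{R}^N$, and write $\mathbb{R}^{N+1}_+=\{(x,z): x\in\mathbb{R}^N,\ z>0\}$. For a measurable set $F\subset\mathbb{R}^N$ with $0<\gamma(F)<1$ the Gaussian Fraenkel asymmetry is $$\mathcal{A}_\gamma(F):=\min\left\{\frac{\gamma(F\triangle H)}{\gamma(F)} : H=\{x : x\cdot\omega<r\},\ |\omega|=1,\ r\in\mathbb{R},\ \gamma(H)=\gamma(F)\right\}.$$ The $s$-fractional Gaussian perimeter of a measurable set $E\subset\mathbb{R}^N$ is $$P_s^\gamma(E):=\frac12\inf\left\{\iint_{\mathbb{R}^{N+1}_+}\left(|\nabla_x v|^2+|\partial_z v|^2\right)z^{1-s}\,d\gamma(x)\,dz:\ v\in H^1_{\rm loc}(\mathbb{R}^{N+1}_+),\ v(\cdot,0)=\chi_E\right\},$$ where $v(\cdot,0)=\chi_E$ is meant in the sense of traces in $L^2(\gamma)$. Put $$K_s:=\frac{s\,|\Gamma(-s/2)|}{2^{s}\,\Gamma(s/2)},\qquad \beta_s:=\frac{1}{2^sK_s}\,\frac{\Gamma(1-s/2)}{\Gamma(1+s/2)}.$$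 Let $E\subset\mathbb{R}^N$ be a measurable set with $0<\gamma(E)<1$ and $P_s^\gamma(E)<\infty$. Let $U_E$ be the finite-energy weak solution (in its representative that is continuous in $\mathbb{R}^{N+1}_+$) of the extension problem $$\Delta_x U-x\cdot\nabla_x U+\frac{1-s}{z}\,\partial_z U+\partial_z^2U=0\ \text{ in }\mathbb{R}^{N+1}_+,\qquad U(\cdot,0)=\chi_E,$$ where the energy is the weighted integral in the definition of $P_s^\gamma$, and let $E_{t,z}:=\{x\in\mathbb{R}^N: U_E(x,z)>t\}$. Then for all $t\in[1/4,3/4]$ and all $0<z\le z_0$, where $$z_0:=\left(\frac{\mathcal{A}_\gamma(E)\,\gamma(E)}{72\,\beta_s\,P_s^\gamma(E)}\right)^{1/s},$$ we have $$|\gamma(E_{t,z})-\gamma(E)|\le\frac29\,\gamma(E)\,\mathcal{A}_\gamma(E)\qquad\text{and}\qquad \mathcal{A}_\gamma(E_{t,z})\ge\frac{5}{13}\,\mathcal{A}_\gamma(E).$$ -/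

import Mathlib

open MeasureTheory ProbabilityTheory Set Filter Topology
open scoped ENNReal

noncomputable section

namespace FracGauss

/-- `ℝ^N` with its Euclidean structure. -/
abbrev Space (N : ℕ) : Type := EuclideanSpace ℝ (Fin N)

/-- The standard Gaussian measure on `ℝ^N`. -/
abbrev gauss (N : ℕ) : Measure (Space N) := stdGaussian (Space N)

/-- The open halfspace `{x | x · ω < r}`. -/
def halfspace {N : ℕ} (ω : Space N) (r : ℝ) : Set (Space N) := {x | inner ℝ x ω < r}

/-- The Gaussian Fraenkel asymmetry: the least value of `γ(E ∆ H) / γ(E)` among the halfspaces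
`H = {x · ω < r}`, `|ω| = 1`, that have the same Gaussian measure as `E`. -/
def asymmetry {N : ℕ} (E : Set (Space N)) : ℝ :=
  sInf {a : ℝ | ∃ (ω : Space N) (r : ℝ), ‖ω‖ = 1 ∧ gauss N (halfspace ω r) = gauss N E ∧
    a = (gauss N).real (symmDiff E (halfspace ω r)) / (gauss N).real E}

/-- The open upper halfspace `{(x, z) | z > 0}` of `ℝ^N × ℝ`. -/
def upper (N : ℕ) : Set (Space N × ℝ) := {p | 0 < p.2}

/-- Smooth real functions with compact support in the open upper halfspace. -/
structure IsTest {N : ℕ} (η : Space N × ℝ → ℝ) : Prop where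
  smooth : ContDiff ℝ (⊤ : ℕ∞) η
  compact : HasCompactSupport η
  support : tsupport η ⊆ upper N

/-- `v` belongs to `H^1_loc` of the open upper halfspace, and `(gx, gz)` is its weak gradient
(`gx` in the directions of `ℝ^N`, `gz` in the vertical direction). -/
structure IsWeakGradient {N : ℕ} (v : Space N × ℝ → ℝ) (gx : Space N × ℝ → Space N)
    (gz : Space N × ℝ → ℝ) : Prop where
  memLp : ∀ K ⊆ upper N, IsCompact K → MemLp v 2 (volume.restrict K)
  memLp_x : ∀ K ⊆ upper N, IsCompact K → MemLp gx 2 (volume.restrict K)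
  memLp_z : ∀ K ⊆ upper N, IsCompact K → MemLp gz 2 (volume.restrict K)
  weak_x : ∀ η, IsTest η → ∀ e : Space N,
    ∫ p in upper N, v p * fderiv ℝ η p (e, 0) = - ∫ p in upper N, inner ℝ (gx p) e * η p
  weak_z : ∀ η, IsTest η →
    ∫ p in upper N, v p * fderiv ℝ η p (0, 1) = - ∫ p in upper N, gz p * η p

/-- `v(·, 0) = u` in the sense of traces: the averages of `‖v(·, z) - u‖²` (norm of `L²(γ)`) over
`0 < z < δ` tend to `0` as `δ → 0`. -/
def HasTrace {N : ℕ} (v : Space N × ℝ → ℝ) (u : Space N → ℝ) : Prop :=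
  Tendsto (fun δ : ℝ =>
      (∫⁻ p in univ ×ˢ Ioo 0 δ, ‖v p - u p.1‖ₑ ^ 2 ∂((gauss N).prod volume)) / ENNReal.ofReal δ)
    (𝓝[>] 0) (𝓝 0)

/-- The weighted energy `∬ (|∇ₓv|² + |∂_z v|²) z^(1-2σ) dγ(x) dz` as a function of the gradient. -/
def energy {N : ℕ} (σ : ℝ) (gx : Space N × ℝ → Space N) (gz : Space N × ℝ → ℝ) : ℝ≥0∞ :=
  ∫⁻ p in upper N, ENNReal.ofReal ((‖gx p‖ ^ 2 + gz p ^ 2) * p.2 ^ (1 - 2 * σ))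
    ∂((gauss N).prod volume)

/-- The squared seminorm `[u]²` of `H^σ_γ`: the infimum of the energy over all `v` in `H^1_loc` of
the upper halfspace with `v(·, 0) = u`. -/
def seminormSq {N : ℕ} (σ : ℝ) (u : Space N → ℝ) : ℝ≥0∞ :=
  ⨅ (v : Space N × ℝ → ℝ) (gx : Space N × ℝ → Space N) (gz : Space N × ℝ → ℝ)
    (_ : IsWeakGradient v gx gz) (_ : HasTrace v u), energy σ gx gz

/-- The `s`-fractional Gaussian perimeter `P_s^γ(E) = ½ [χ_E]²`, seminorm of `H^(s/2)_γ`. -/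
def fracPerimeter {N : ℕ} (s : ℝ) (E : Set (Space N)) : ℝ≥0∞ :=
  seminormSq (s / 2) (E.indicator 1) / 2

/-- `U` is the (finite energy, weak) solution of the extension problem
`Δ_γ U + (1-2σ)/z ∂_z U + ∂_z² U = 0` in the upper halfspace, `U(·, 0) = u`.
The equation is in its divergence form
`∬ (∇ₓU · ∇ₓη + ∂_z U ∂_z η) z^(1-2σ) dγ(x) dz = 0` for all test functions `η`.
These conditions determine `U` almost everywhere; `U` is the representative that is continuous in
the open upper halfspace, so that all slices `U(·, z)`, `z > 0`, are determined. -/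
structure IsExtension {N : ℕ} (σ : ℝ) (u : Space N → ℝ) (U : Space N × ℝ → ℝ) : Prop where
  continuousOn : ContinuousOn U (upper N)
  trace : HasTrace U u
  weak_solution : ∃ (gx : Space N × ℝ → Space N) (gz : Space N × ℝ → ℝ),
    IsWeakGradient U gx gz ∧ energy σ gx gz < ∞ ∧
    ∀ η, IsTest η →
      ∫ p in upper N, (fderiv ℝ η p (gx p, 0) + gz p * fderiv ℝ η p (0, 1)) * p.2 ^ (1 - 2 * σ)
        ∂((gauss N).prod volume) = 0

/-- The superlevel set `E_{t,z} = {x | U(x, z) > t}`. -/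
def superlevel {N : ℕ} (U : Space N × ℝ → ℝ) (t z : ℝ) : Set (Space N) := {x | t < U (x, z)}

/-- The constant `K_{2σ} = 2σ |Γ(-σ)| / (4^σ Γ(σ))`, as a function of `σ`. -/
def constK (σ : ℝ) : ℝ := 2 * σ * |Real.Gamma (-σ)| / (4 ^ σ * Real.Gamma σ)

/-- The constant `β_s`, where `β_{2σ} = 1 / (4^σ K_{2σ}) * Γ(1-σ) / Γ(1+σ)`, here with
`σ = s / 2`. -/
def constBeta (s : ℝ) : ℝ :=
  1 / (4 ^ (s / 2) * constK (s / 2)) * (Real.Gamma (1 - s / 2) / Real.Gamma (1 + s / 2))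

/-- The threshold `z₀ = (𝒜(E) γ(E) / (72 β_s P_s(E)))^(1/s)`. -/
def zZero {N : ℕ} (s : ℝ) (E : Set (Space N)) : ℝ :=
  (asymmetry E * (gauss N).real E / (72 * constBeta s * (fracPerimeter s E).toReal)) ^ (1 / s)

end FracGauss

end

/-! ### Mollification in `L²` -/

noncomputable section
namespace FracGauss

open scoped Convolution

section General

/-! Write `u` for the indicator of `E`, `X` for the weak gradient of `U`, and `D` for the weighted
Dirichlet energy of `X`. The heart of the matter is that the symmetric difference of `E` and the
superlevel set at height `z` has Gaussian measure at most `20/3 * D * z^s/s`, for every `t` in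
`[1/4, 3/4]` (`IsSolution.symmDiff_superlevel_le`). Since `U` minimizes the energy, `D` is at most
twice the perimeter (`IsSolution.dirichlet_le_seminormSq`), and the Gamma factors collapse to `β_s =
1/s` (`constBeta_eq`). The choice of `z₀` then makes `D * z^s/s` at most `𝒜(E) γ(E) / 36`, so the
symmetric difference is at most `5/27 * 𝒜(E) γ(E)`. The two conclusions follow because volume and
asymmetry are stable under small symmetric differences (`le_asymmetry_of_symmDiff_le`).

The bound on the symmetric difference combines two estimates on a horizontal slice. The first, `∫
(U(·,z) - u)² dγ ≤ D z^s/s`, is the fundamental theorem of calculus on vertical lines together with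
a weighted Cauchy–Schwarz inequality. The second is finer: for convex `G` with derivative `f`, one
has `∫ (G(u) - G(U(·,z))) dγ ≤ (f(1) - f(0)) D z^s/s`. Indeed the increment of `∫ G(U) dγ` up to
height `z` is the integral of `f(U) ∂_z U`. It is computed by testing the equation with `m(w) f(U)`,
where `m(w) = (z^s - w^s)₊/s`, corrected by an affine function of `U` that cancels the trace. Such a
correction exists because `u` takes only the values `0` and `1`. The term with `f'(U) |∇U|²` has a
favourable sign and is dropped (`IsSolution.neg_le_integral_flux`). Taking for `G` the function `|r
- t|` tilted so that it agrees at `0` and `1`, a combination of the two integrands dominates the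
indicator of the symmetric difference pointwise (`one_le_levelDefect`).

The analytic foundation is that the weak equation, stated for smooth compactly supported functions,
may be tested with any finite-energy function of zero trace (`HasWeakDeriv.integral_apply_eq_zero`).
A function of this kind is the primitive of its vertical derivative from the boundary
(`ae_eq_vertPrim`). By a Hardy inequality, its quotient by `z` is therefore square integrable for
the weight, which is what cutoffs with gradient of order `1/z` require. Chain and product rules for
weak derivatives come from mollification. The same testing principle yields the minimality of the
energy and the maximum principle `0 ≤ U ≤ 1`. -/

theorem eLpNorm_two_sq {α F : Type*} [MeasurableSpace α] [NormedAddCommGroup F] (f : α → F)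
    (μ : Measure α) : eLpNorm f 2 μ ^ 2 = ∫⁻ x, ‖f x‖ₑ ^ 2 ∂μ := by
  have := eLpNorm_nnreal_pow_eq_lintegral (f := f) (p := 2) (μ := μ) (by norm_num)
  simpa using this

theorem memLp_two_iff_lintegral {α F : Type*} [MeasurableSpace α] [NormedAddCommGroup F] {f : α → F}
    {μ : Measure α} : MemLp f 2 μ ↔ AEStronglyMeasurable f μ ∧ ∫⁻ x, ‖f x‖ₑ ^ 2 ∂μ < ∞ := by
  rw [MemLp, ← eLpNorm_two_sq]
  simp

/-- The Cauchy-Schwarz inequality for a weighted lower integral. -/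
theorem sq_lintegral_mul_le {α : Type*} [MeasurableSpace α] {μ : Measure α} {f g : α → ℝ≥0∞}
    (hf : AEMeasurable f μ) (hg : AEMeasurable g μ) :
    (∫⁻ x, f x * g x ∂μ) ^ 2 ≤ (∫⁻ x, f x ^ 2 ∂μ) * ∫⁻ x, g x ^ 2 ∂μ := by
  have h := ENNReal.lintegral_mul_le_Lp_mul_Lq μ Real.HolderConjugate.two_two hf hg
  calc (∫⁻ x, f x * g x ∂μ) ^ 2
      ≤ ((∫⁻ a, f a ^ (2:ℝ) ∂μ) ^ (1 / (2:ℝ)) * (∫⁻ a, g a ^ (2:ℝ) ∂μ) ^ (1 / (2:ℝ))) ^ 2 :=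
        pow_le_pow_left' h 2
    _ = _ := by
        rw [mul_pow]
        congr 1 <;>
        · rw [← ENNReal.rpow_natCast, ← ENNReal.rpow_mul]
          norm_num

/-- Cauchy–Schwarz for the splitting of `f * g` into `f^(1/2)` and `f^(1/2) * g`. No finiteness is
needed, since square roots in `ℝ≥0∞` behave well at infinity. When `f` has total mass one, this is
Jensen's inequality for the square. -/
theorem sq_lintegral_weight_mul_le {α : Type*} [MeasurableSpace α] {μ : Measure α}
    {f g : α → ℝ≥0∞} (hf : AEMeasurable f μ) (hg : AEMeasurable g μ) :
    (∫⁻ x, f x * g x ∂μ) ^ 2 ≤ (∫⁻ x, f x ∂μ) * ∫⁻ x, f x * g x ^ 2 ∂μ := by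
  have hr : ∀ a : ℝ≥0∞, a ^ (1 / 2 : ℝ) * a ^ (1 / 2 : ℝ) = a := fun a => by
    rw [← ENNReal.rpow_add_of_nonneg _ _ (by norm_num) (by norm_num)]; norm_num
  have h := sq_lintegral_mul_le (f := fun x => f x ^ (1 / 2 : ℝ))
    (g := fun x => f x ^ (1 / 2 : ℝ) * g x) (hf.pow_const _) ((hf.pow_const _).mul hg)
  simp only [← mul_assoc, mul_pow] at h
  simpa only [hr, sq] using h

variable {E F : Type*} [NormedAddCommGroup E] [MeasurableSpace E] [BorelSpace E]
  [NormedAddCommGroup F]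

/-- Composition of an `L²` class with a measure preserving continuous map is continuous in the map,
for the compact-open topology. The translations form a continuous family of such maps, by currying
the subtraction. -/
theorem tendsto_lintegral_translate_sub [NormedSpace ℝ E] [FiniteDimensional ℝ E] {μ : Measure E}
    [μ.IsAddHaarMeasure] {g : E → F} (hg : MemLp g 2 μ) :
    Tendsto (fun y => ∫⁻ x, ‖g (x - y) - g x‖ₑ ^ 2 ∂μ) (𝓝 0) (𝓝 0) := by
  have : Fact ((1 : ℝ≥0∞) ≤ 2) := ⟨by norm_num⟩
  have hm : ∀ y : E, MeasurePreserving (fun x : E => x - y) μ μ := fun y =>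
    measurePreserving_sub_right μ y
  let τ : E → C(E, E) := fun y => ⟨fun x => x - y, by fun_prop⟩
  have hτ : Continuous τ :=
    (ContinuousMap.mk (fun a : E × E => a.2 - a.1) (by fun_prop)).curry.continuous
  have h := Filter.Tendsto.compMeasurePreservingLp (p := 2) (f := fun _ : E => hg.toLp g)
    (g := τ) (g₀ := τ 0) (l := 𝓝 0) tendsto_const_nhds (hτ.tendsto 0) hm (hm 0) (by norm_num)
  rw [tendsto_iff_edist_tendsto_0] at h
  have h2 : Tendsto (fun y => eLpNorm (fun x => g (x - y) - g x) 2 μ) (𝓝 0) (𝓝 0) := by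
    refine h.congr fun y => ?_
    rw [Lp.toLp_compMeasurePreserving, Lp.toLp_compMeasurePreserving, Lp.edist_toLp_toLp]
    refine eLpNorm_congr_ae (Eventually.of_forall fun x => ?_)
    simp [τ]
  have h3 := (ENNReal.continuous_pow 2).tendsto 0 |>.comp h2
  simpa [Function.comp_def, eLpNorm_two_sq] using h3

variable [NormedSpace ℝ E] [NormedSpace ℝ F] [FiniteDimensional ℝ E] {μ : Measure E} [μ.IsAddHaarMeasure]

theorem lintegral_normed_bump (φ : ContDiffBump (0 : E)) :
    ∫⁻ y, ENNReal.ofReal (φ.normed μ y) ∂μ = 1 := by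
  rw [← ofReal_integral_eq_lintegral_ofReal φ.integrable_normed
    (Eventually.of_forall φ.nonneg_normed), φ.integral_normed, ENNReal.ofReal_one]

/-- The normalized bump is a probability density, so the mollification error is an average of
translation differences. Jensen's inequality moves the square inside the average, and Tonelli
exchanges the integrals. -/
theorem lintegral_normed_convolution_sub_le [CompleteSpace F] (φ : ContDiffBump (0 : E)) {g : E → F}
    (hg : LocallyIntegrable g μ) :
    ∫⁻ x, ‖(φ.normed μ ⋆[ContinuousLinearMap.lsmul ℝ ℝ, μ] g) x - g x‖ₑ ^ 2 ∂μ ≤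
      ∫⁻ y, ENNReal.ofReal (φ.normed μ y) * ∫⁻ x, ‖g (x - y) - g x‖ₑ ^ 2 ∂μ ∂μ := by
  have hgm := hg.aestronglyMeasurable
  have hc : Continuous (φ.normed μ) := φ.continuous_normed
  have hsub : AEStronglyMeasurable (fun p : E × E => g (p.1 - p.2) - g p.1) (μ.prod μ) :=
    (hgm.comp_quasiMeasurePreserving
      (quasiMeasurePreserving_sub_of_right_invariant μ μ)).sub hgm.comp_fst
  have hpt : ∀ᵐ x ∂μ, ‖(φ.normed μ ⋆[ContinuousLinearMap.lsmul ℝ ℝ, μ] g) x - g x‖ₑ ^ 2 ≤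
      ∫⁻ y, ENNReal.ofReal (φ.normed μ y) * ‖g (x - y) - g x‖ₑ ^ 2 ∂μ := by
    filter_upwards [hsub.prodMk_left] with x hx
    have hex : Integrable (fun t => φ.normed μ t • g (x - t)) μ :=
      φ.hasCompactSupport_normed.convolutionExists_left (ContinuousLinearMap.lsmul ℝ ℝ) hc hg x
    have heq : (φ.normed μ ⋆[ContinuousLinearMap.lsmul ℝ ℝ, μ] g) x - g x =
        ∫ t, φ.normed μ t • (g (x - t) - g x) ∂μ := by
      simp only [smul_sub]
      rw [integral_sub hex (φ.integrable_normed.smul_const _), integral_smul_const,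
        φ.integral_normed, one_smul]
      rfl
    have hb : ‖(φ.normed μ ⋆[ContinuousLinearMap.lsmul ℝ ℝ, μ] g) x - g x‖ₑ ≤
        ∫⁻ t, ENNReal.ofReal (φ.normed μ t) * ‖g (x - t) - g x‖ₑ ∂μ := by
      rw [heq]
      refine (enorm_integral_le_lintegral_enorm _).trans (le_of_eq ?_)
      refine lintegral_congr fun t => ?_
      rw [enorm_smul, Real.enorm_eq_ofReal (φ.nonneg_normed t)]
    refine (pow_le_pow_left' hb 2).trans ((sq_lintegral_weight_mul_le
      hc.measurable.ennreal_ofReal.aemeasurable hx.enorm).trans_eq ?_)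
    rw [lintegral_normed_bump, one_mul]
  refine (lintegral_mono_ae hpt).trans_eq ?_
  rw [lintegral_lintegral_swap]
  · refine lintegral_congr fun y => ?_
    rw [lintegral_const_mul' _ _ ENNReal.ofReal_ne_top]
  · exact (hc.measurable.comp measurable_snd).ennreal_ofReal.aemeasurable.mul
      (hsub.enorm.pow_const 2)

/-- The average in the previous bound sees only translations of length below `rOut`, for which the
translation error is already small. -/
theorem tendsto_lintegral_normed_convolution_sub [CompleteSpace F] {ι : Type*} {l : Filter ι}
    {φ : ι → ContDiffBump (0 : E)} (hφ : Tendsto (fun i => (φ i).rOut) l (𝓝 0)) {g : E → F}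
    (hg : MemLp g 2 μ) :
    Tendsto (fun i => ∫⁻ x, ‖((φ i).normed μ ⋆[ContinuousLinearMap.lsmul ℝ ℝ, μ] g) x - g x‖ₑ ^ 2 ∂μ)
      l (𝓝 0) := by
  have hloc : LocallyIntegrable g μ := hg.locallyIntegrable (by norm_num)
  rw [ENNReal.tendsto_nhds_zero]
  intro ε hε
  have h := ENNReal.tendsto_nhds_zero.1 (tendsto_lintegral_translate_sub hg) ε hε
  obtain ⟨δ, hδ, hball⟩ := Metric.eventually_nhds_iff_ball.1 h
  filter_upwards [hφ.eventually (gt_mem_nhds hδ)] with i hi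
  refine (lintegral_normed_convolution_sub_le (φ i) hloc).trans ?_
  calc ∫⁻ y, ENNReal.ofReal ((φ i).normed μ y) * ∫⁻ x, ‖g (x - y) - g x‖ₑ ^ 2 ∂μ ∂μ
      ≤ ∫⁻ y, ENNReal.ofReal ((φ i).normed μ y) * ε ∂μ := by
        refine lintegral_mono fun y => ?_
        by_cases hy : y ∈ Metric.ball (0 : E) (φ i).rOut
        · gcongr
          exact hball y (Metric.ball_subset_ball hi.le hy)
        · rw [← (φ i).support_normed_eq (μ := μ), Function.notMem_support] at hy
          simp [hy]
    _ = ε := by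
        rw [lintegral_mul_const _ ((φ i).continuous_normed).measurable.ennreal_ofReal,
          lintegral_normed_bump, one_mul]

end General
end FracGauss
end

noncomputable section
namespace FracGauss

open scoped Convolution

/-! ### The chain rule for weak derivatives -/

section General

/-- Strong `L²` convergence times bounded almost everywhere convergence passes to the limit in
bilinear integrals. -/
theorem tendsto_integral_mul_bilin {α F₁ F₂ : Type*} [MeasurableSpace α] {ν : Measure α}
    [NormedAddCommGroup F₁] [NormedSpace ℝ F₁] [NormedAddCommGroup F₂] [NormedSpace ℝ F₂]
    (L : F₁ →L[ℝ] F₂ →L[ℝ] ℝ) {h : ℕ → α → F₁} {h₀ : α → F₁} {ψ : α → F₂} {k : ℕ → α → ℝ}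
    {k₀ : α → ℝ} {C : ℝ} (hh : ∀ n, AEStronglyMeasurable (h n) ν) (hh₀ : AEStronglyMeasurable h₀ ν)
    (hlim : Tendsto (fun n => ∫⁻ x, ‖h n x - h₀ x‖ₑ ^ 2 ∂ν) atTop (𝓝 0))
    (hψ : MemLp ψ 2 ν) (hint : Integrable (fun x => L (h₀ x) (ψ x)) ν)
    (hk : ∀ n, AEStronglyMeasurable (k n) ν) (hkC : ∀ n x, |k n x| ≤ C)
    (hklim : ∀ᵐ x ∂ν, Tendsto (fun n => k n x) atTop (𝓝 (k₀ x))) :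
    Tendsto (fun n => ∫ x, k n x * L (h n x) (ψ x) ∂ν) atTop
      (𝓝 (∫ x, k₀ x * L (h₀ x) (ψ x) ∂ν)) := by
  have hψ2 := (memLp_two_iff_lintegral.1 hψ).2
  have hLm : ∀ n, AEStronglyMeasurable (fun x => L (h n x - h₀ x) (ψ x)) ν := fun n =>
    L.aestronglyMeasurable_comp₂ ((hh n).sub hh₀) hψ.1
  have hDm : ∀ n, AEStronglyMeasurable (fun x => k n x * L (h n x - h₀ x) (ψ x)) ν := fun n =>
    (hk n).mul (hLm n)
  -- The varying factor `k n` is kept only through its bound, and Cauchy–Schwarz makes the part with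
  -- `h n - h₀` vanish in the limit. What remains involves the fixed function `h₀`, where dominated
  -- convergence applies.
  have hbound : ∀ n, ∫⁻ x, ‖k n x * L (h n x - h₀ x) (ψ x)‖ₑ ∂ν ≤
      ENNReal.ofReal (C * ‖L‖) * ((∫⁻ x, ‖h n x - h₀ x‖ₑ ^ 2 ∂ν) ^ (1 / 2 : ℝ) *
        (∫⁻ x, ‖ψ x‖ₑ ^ 2 ∂ν) ^ (1 / 2 : ℝ)) := by
    intro n
    have hcs := ENNReal.lintegral_mul_le_Lp_mul_Lq ν Real.HolderConjugate.two_two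
      ((hh n).sub hh₀).enorm hψ.1.enorm
    simp only [ENNReal.rpow_two] at hcs
    refine le_trans ?_ (mul_le_mul_right hcs _)
    rw [← lintegral_const_mul'' _ (((hh n).sub hh₀).enorm.mul hψ.1.enorm)]
    refine lintegral_mono fun x => ?_
    have : ‖k n x * L (h n x - h₀ x) (ψ x)‖ ≤ C * ‖L‖ * (‖h n x - h₀ x‖ * ‖ψ x‖) := by
      rw [norm_mul, mul_assoc C]
      have h1 := L.le_opNorm₂ (h n x - h₀ x) (ψ x)
      have h2 := hkC n x
      have h0 : 0 ≤ C := (abs_nonneg _).trans h2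
      rw [Real.norm_eq_abs]
      calc |k n x| * ‖L (h n x - h₀ x) (ψ x)‖ ≤ C * (‖L‖ * ‖h n x - h₀ x‖ * ‖ψ x‖) := by gcongr
        _ = _ := by ring
    rw [← ofReal_norm]
    refine (ENNReal.ofReal_le_ofReal this).trans_eq ?_
    have h0 : 0 ≤ C := (abs_nonneg _).trans (hkC n x)
    rw [ENNReal.ofReal_mul (by positivity), ENNReal.ofReal_mul (norm_nonneg _),
      ofReal_norm, ofReal_norm]
    rfl
  have hlim' : Tendsto (fun n => ENNReal.ofReal (C * ‖L‖) *
      ((∫⁻ x, ‖h n x - h₀ x‖ₑ ^ 2 ∂ν) ^ (1 / 2 : ℝ) *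
        (∫⁻ x, ‖ψ x‖ₑ ^ 2 ∂ν) ^ (1 / 2 : ℝ))) atTop (𝓝 0) := by
    have h1 : Tendsto (fun n => (∫⁻ x, ‖h n x - h₀ x‖ₑ ^ 2 ∂ν) ^ (1 / 2 : ℝ)) atTop (𝓝 0) := by
      have := (ENNReal.continuous_rpow_const (y := (1 / 2 : ℝ))).tendsto 0 |>.comp hlim
      simpa [Function.comp_def] using this
    have h2 := ENNReal.Tendsto.mul_const h1 (b := (∫⁻ x, ‖ψ x‖ₑ ^ 2 ∂ν) ^ (1 / 2 : ℝ))
      (Or.inr (ENNReal.rpow_ne_top_of_nonneg (by norm_num) hψ2.ne))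
    have h3 := ENNReal.Tendsto.const_mul (a := ENNReal.ofReal (C * ‖L‖)) h2
      (Or.inr ENNReal.ofReal_ne_top)
    simpa using h3
  have hlint : Tendsto (fun n => ∫⁻ x, ‖k n x * L (h n x - h₀ x) (ψ x)‖ₑ ∂ν) atTop (𝓝 0) :=
    tendsto_of_tendsto_of_tendsto_of_le_of_le tendsto_const_nhds hlim' (fun _ => zero_le) hbound
  have hA : Tendsto (fun n => ∫ x, k n x * L (h n x - h₀ x) (ψ x) ∂ν) atTop (𝓝 0) := by
    rw [tendsto_zero_iff_norm_tendsto_zero]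
    have : Tendsto (fun n => ‖∫ x, k n x * L (h n x - h₀ x) (ψ x) ∂ν‖ₑ) atTop (𝓝 0) :=
      tendsto_of_tendsto_of_tendsto_of_le_of_le tendsto_const_nhds hlint (fun _ => zero_le)
        (fun n => enorm_integral_le_lintegral_enorm _)
    have h2 := (ENNReal.tendsto_toReal ENNReal.zero_ne_top).comp this
    simpa [Function.comp_def] using h2
  have hB : Tendsto (fun n => ∫ x, k n x * L (h₀ x) (ψ x) ∂ν) atTop
      (𝓝 (∫ x, k₀ x * L (h₀ x) (ψ x) ∂ν)) := by
    refine tendsto_integral_of_dominated_convergence (fun x => C * ‖L (h₀ x) (ψ x)‖)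
      (fun n => (hk n).mul hint.1) (hint.norm.const_mul C) (fun n => ?_) ?_
    · refine Eventually.of_forall fun x => ?_
      rw [norm_mul, Real.norm_eq_abs]
      gcongr
      exact hkC n x
    · filter_upwards [hklim] with x hx using hx.mul_const _
  have hev : ∀ᶠ n in atTop, (∫ x, k n x * L (h n x - h₀ x) (ψ x) ∂ν) +
      ∫ x, k n x * L (h₀ x) (ψ x) ∂ν = ∫ x, k n x * L (h n x) (ψ x) ∂ν := by
    have hfin : ∀ᶠ n in atTop, ∫⁻ x, ‖k n x * L (h n x - h₀ x) (ψ x)‖ₑ ∂ν < ∞ :=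
      hlint.eventually (gt_mem_nhds ENNReal.zero_lt_top)
    filter_upwards [hfin] with n hn
    rw [← integral_add ⟨hDm n, hn⟩ (hint.bdd_mul (c := C) (hk n) (Eventually.of_forall (hkC n)))]
    refine integral_congr_ae (Eventually.of_forall fun x => ?_)
    simp only [map_sub, sub_apply]
    ring
  simpa using (hA.add hB).congr' hev

/-- A sequence of bump functions whose supports shrink to the origin. -/
def shrinkingBump (E : Type*) [NormedAddCommGroup E] (n : ℕ) : ContDiffBump (0 : E) where
  rIn := 1 / ((n : ℝ) + 2)
  rOut := 1 / ((n : ℝ) + 1)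
  rIn_pos := by positivity
  rIn_lt_rOut := by
    apply one_div_lt_one_div_of_lt <;> [positivity; linarith]

theorem tendsto_shrinkingBump_rOut {E : Type*} [NormedAddCommGroup E] :
    Tendsto (fun n => (shrinkingBump E n).rOut) atTop (𝓝 0) :=
  tendsto_one_div_add_atTop_nhds_zero_nat

/-- A bounded ratio of radii is what Lebesgue differentiation needs for mollifications to converge
almost everywhere. -/
theorem shrinkingBump_rOut_le {E : Type*} [NormedAddCommGroup E] (n : ℕ) :
    (shrinkingBump E n).rOut ≤ 2 * (shrinkingBump E n).rIn := by
  simp only [shrinkingBump]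
  rw [mul_one_div, div_le_div_iff₀ (by positivity) (by positivity)]
  have : (0 : ℝ) ≤ n := n.cast_nonneg
  linarith

variable {E : Type*} [NormedAddCommGroup E] [MeasurableSpace E] [BorelSpace E]
  [NormedSpace ℝ E] [FiniteDimensional ℝ E] {μ : Measure E} [μ.IsAddHaarMeasure]

/-- The derivative falls on the mollifier. Inserting the reflected and translated mollifier as a
test function in `hw` then transfers it to `G`: mollification commutes with weak differentiation. -/
theorem hasFDerivAt_normed_convolution (φ : ContDiffBump (0 : E)) {V : E → ℝ} {G : E → E →L[ℝ] ℝ}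
    (hV : LocallyIntegrable V μ) (hG : LocallyIntegrable G μ)
    (hw : ∀ η : E → ℝ, ContDiff ℝ (⊤ : ℕ∞) η → HasCompactSupport η → ∀ e : E,
      ∫ p, V p * fderiv ℝ η p e ∂μ = - ∫ p, G p e * η p ∂μ) (p : E) :
    HasFDerivAt (φ.normed μ ⋆[ContinuousLinearMap.lsmul ℝ ℝ, μ] V)
      ((φ.normed μ ⋆[ContinuousLinearMap.lsmul ℝ ℝ, μ] G) p) p := by
  have hφ : ContDiff ℝ (⊤ : ℕ∞) (φ.normed μ) := φ.contDiff_normed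
  have hφ1 : ContDiff ℝ 1 (φ.normed μ) := φ.contDiff_normed
  have hcs := φ.hasCompactSupport_normed (μ := μ)
  have h := hcs.hasFDerivAt_convolution_left (ContinuousLinearMap.lsmul ℝ ℝ) hφ1 hV p
  refine h.congr_fderiv (ContinuousLinearMap.ext fun e => Eq.symm ?_)
  have hcs' : HasCompactSupport (fderiv ℝ (φ.normed μ)) := hcs.fderiv ℝ
  have hcont' : Continuous (fderiv ℝ (φ.normed μ)) := hφ1.continuous_fderiv (by norm_num)
  have hex : Integrable (fun t => φ.normed μ t • G (p - t)) μ :=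
    hcs.convolutionExists_left (ContinuousLinearMap.lsmul ℝ ℝ) hφ.continuous hG p
  have hex' := hcs'.convolutionExists_left
    ((ContinuousLinearMap.lsmul ℝ ℝ : ℝ →L[ℝ] ℝ →L[ℝ] ℝ).precompL E) hcont' hV p
  set η : E → ℝ := fun t => φ.normed μ (p - t) with hη
  have hη1 : ContDiff ℝ (⊤ : ℕ∞) η := hφ.comp (contDiff_const.sub contDiff_id)
  have hη2 : HasCompactSupport η :=
    hcs.comp_homeomorph (Homeomorph.subLeft p)
  have hηd : ∀ t, fderiv ℝ η t e = - fderiv ℝ (φ.normed μ) (p - t) e := by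
    intro t
    have h1 : HasFDerivAt (φ.normed μ) (fderiv ℝ (φ.normed μ) (p - t)) (p - t) :=
      ((hφ1.differentiable (by norm_num)) _).hasFDerivAt
    have h2 : HasFDerivAt (fun t : E => p - t) (-ContinuousLinearMap.id ℝ E) t := by
      simpa using (hasFDerivAt_id t).const_sub p
    have h3 := (h1.comp t h2).fderiv
    simp only [Function.comp_def] at h3
    rw [hη, h3]
    simp
  have key := hw η hη1 hη2 e
  calc ((φ.normed μ ⋆[ContinuousLinearMap.lsmul ℝ ℝ, μ] G) p) e
      = ∫ t, φ.normed μ t * G (p - t) e ∂μ := by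
        rw [convolution_def, ContinuousLinearMap.integral_apply (by exact hex)]
        simp
    _ = ∫ t, G t e * η t ∂μ := by
        rw [← integral_sub_left_eq_self _ μ p]
        simp [hη, mul_comm]
    _ = - ∫ t, V t * fderiv ℝ η t e ∂μ := by rw [key, neg_neg]
    _ = ∫ t, fderiv ℝ (φ.normed μ) (p - t) e * V t ∂μ := by
        rw [← integral_neg]
        refine integral_congr_ae (Eventually.of_forall fun t => ?_)
        simp only [hηd]
        ring
    _ = ∫ t, fderiv ℝ (φ.normed μ) t e * V (p - t) ∂μ := by
        rw [← integral_sub_left_eq_self _ μ p]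
        simp
    _ = _ := by
        rw [convolution_def, ContinuousLinearMap.integral_apply (by exact hex')]
        simp [ContinuousLinearMap.precompL_apply]

/-- The chain rule for weak derivatives of square integrable functions. -/
theorem integral_comp_mul_fderiv_eq {V : E → ℝ} {G : E → E →L[ℝ] ℝ}
    (hV : MemLp V 2 μ) (hG : MemLp G 2 μ)
    (hw : ∀ η : E → ℝ, ContDiff ℝ (⊤ : ℕ∞) η → HasCompactSupport η → ∀ e : E,
      ∫ p, V p * fderiv ℝ η p e ∂μ = - ∫ p, G p e * η p ∂μ)
    {f f' : ℝ → ℝ} {C : ℝ} (hf : ∀ r, HasDerivAt f (f' r) r) (hf' : Continuous f')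
    (hC : ∀ r, |f' r| ≤ C) {η : E → ℝ} (hη : ContDiff ℝ (⊤ : ℕ∞) η) (hηc : HasCompactSupport η)
    (e : E) :
    ∫ p, f (V p) * fderiv ℝ η p e ∂μ = - ∫ p, f' (V p) * G p e * η p ∂μ := by
  have hVl : LocallyIntegrable V μ := hV.locallyIntegrable (by norm_num)
  have hGl : LocallyIntegrable G μ := hG.locallyIntegrable (by norm_num)
  have hfc : Continuous f := continuous_iff_continuousAt.2 fun r => (hf r).continuousAt
  have hlip : ∀ a b, |f a - f b| ≤ C * |a - b| := fun a b => by
    simpa using Convex.norm_image_sub_le_of_norm_hasDerivWithin_le (s := univ)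
      (fun r _ => (hf r).hasDerivWithinAt) (fun r _ => hC r) convex_univ (mem_univ b) (mem_univ a)
  have hC0 : 0 ≤ C := (abs_nonneg _).trans (hC 0)
  let φ := shrinkingBump E
  let W : ℕ → E → ℝ := fun n => (φ n).normed μ ⋆[ContinuousLinearMap.lsmul ℝ ℝ, μ] V
  let D : ℕ → E → E →L[ℝ] ℝ := fun n => (φ n).normed μ ⋆[ContinuousLinearMap.lsmul ℝ ℝ, μ] G
  have hWD : ∀ n p, HasFDerivAt (W n) (D n p) p := fun n p =>
    hasFDerivAt_normed_convolution (φ n) hVl hGl hw p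
  have hWc : ∀ n, Continuous (W n) := fun n =>
    continuous_iff_continuousAt.2 fun p => (hWD n p).continuousAt
  have hDc : ∀ n, Continuous (D n) := fun n =>
    (φ n).hasCompactSupport_normed.continuous_convolution_left _ (φ n).continuous_normed hGl
  have hW2 := tendsto_lintegral_normed_convolution_sub (μ := μ)
    (tendsto_shrinkingBump_rOut (E := E)) hV
  have hD2 := tendsto_lintegral_normed_convolution_sub (μ := μ)
    (tendsto_shrinkingBump_rOut (E := E)) hG
  have hWae := ContDiffBump.ae_convolution_tendsto_right_of_locallyIntegrable (μ := μ)
    (tendsto_shrinkingBump_rOut (E := E)) (Eventually.of_forall shrinkingBump_rOut_le) hVl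
  have hη' : Continuous (fun p => fderiv ℝ η p e) :=
    (hη.continuous_fderiv (by norm_num)).clm_apply continuous_const
  have hηc' : HasCompactSupport (fun p => fderiv ℝ η p e) :=
    (hηc.fderiv ℝ).comp_left (g := fun ℓ : E →L[ℝ] ℝ => ℓ e) (by simp)
  have hη'2 : MemLp (fun p => fderiv ℝ η p e) 2 μ := hη'.memLp_of_hasCompactSupport hηc'
  have hη2 : MemLp (fun p => η p • e) 2 μ :=
    (hη.continuous.smul continuous_const).memLp_of_hasCompactSupport hηc.smul_right
  -- For the smooth approximations this is the classical chain rule and integration by parts. In the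
  -- limit, `f ∘ W n` converges in `L²` because `f` is Lipschitz. On the other side, `D n` converges
  -- in `L²` while `f' ∘ W n` is only bounded and convergent almost everywhere, hence the form of
  -- `tendsto_integral_mul_bilin`.
  have hstep : ∀ n, ∫ p, f (W n p) * fderiv ℝ η p e ∂μ =
      - ∫ p, f' (W n p) * D n p e * η p ∂μ := by
    intro n
    have hd : ∀ p, HasFDerivAt (fun p => f (W n p)) (f' (W n p) • D n p) p := fun p =>
      (hf _).comp_hasFDerivAt p (hWD n p)
    have hfd : ∀ p, fderiv ℝ (fun p => f (W n p)) p e = f' (W n p) * D n p e := fun p => by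
      rw [(hd p).fderiv]; simp
    have := integral_mul_fderiv_eq_neg_fderiv_mul_of_integrable (μ := μ) (v := e)
      (f := fun p => f (W n p)) (g := η) ?_ ?_ ?_ (fun p _ => (hd p).differentiableAt)
      (fun p _ => hη.differentiable (by norm_num) p)
    · simpa only [hfd] using this
    · simp only [hfd]
      refine Continuous.integrable_of_hasCompactSupport ?_ hηc.mul_left
      exact ((hf'.comp (hWc n)).mul ((hDc n).clm_apply continuous_const)).mul hη.continuous
    · exact ((hfc.comp (hWc n)).mul hη').integrable_of_hasCompactSupport hηc'.mul_left
    · exact ((hfc.comp (hWc n)).mul hη.continuous).integrable_of_hasCompactSupport hηc.mul_left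
  have hfVint : Integrable (fun p => f (V p) * fderiv ℝ η p e) μ := by
    have h0 : Integrable (fun p => f 0 * fderiv ℝ η p e) μ :=
      (hη'.integrable_of_hasCompactSupport hηc').const_mul _
    have h1 : Integrable (fun p => C * |V p * fderiv ℝ η p e|) μ :=
      (hV.integrable_mul hη'2).abs.const_mul C
    refine (h1.add h0.norm).mono'
      ((hfc.comp_aestronglyMeasurable hV.1).mul hη'.aestronglyMeasurable)
      (Eventually.of_forall fun p => ?_)
    simp only [Pi.add_apply, norm_mul, abs_mul, Real.norm_eq_abs, ← mul_assoc, ← add_mul]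
    gcongr
    have := hlip (V p) 0
    rw [sub_zero] at this
    linarith [abs_sub_abs_le_abs_sub (f (V p)) (f 0)]
  have hL : Tendsto (fun n => ∫ p, f (W n p) * fderiv ℝ η p e ∂μ) atTop
      (𝓝 (∫ p, f (V p) * fderiv ℝ η p e ∂μ)) := by
    have := tendsto_integral_mul_bilin (ν := μ) (ContinuousLinearMap.mul ℝ ℝ)
      (h := fun n p => f (W n p)) (h₀ := fun p => f (V p)) (ψ := fun p => fderiv ℝ η p e)
      (k := fun _ _ => 1) (k₀ := fun _ => 1) (C := 1)
      (fun n => (hfc.comp (hWc n)).aestronglyMeasurable) (hfc.comp_aestronglyMeasurable hV.1)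
      ?_ hη'2 hfVint (fun _ => aestronglyMeasurable_const) (by simp)
      (Eventually.of_forall fun _ => tendsto_const_nhds)
    · simpa using this
    · have hz := ENNReal.Tendsto.const_mul (a := ENNReal.ofReal C ^ 2) hW2
        (Or.inr (by simp))
      rw [mul_zero] at hz
      refine tendsto_of_tendsto_of_tendsto_of_le_of_le tendsto_const_nhds hz
        (fun _ => zero_le) fun n => ?_
      dsimp only
      rw [← lintegral_const_mul' _ _ (by simp)]
      refine lintegral_mono fun p => ?_
      rw [← mul_pow]
      gcongr
      rw [← ofReal_norm, ← ofReal_norm, ← ENNReal.ofReal_mul hC0]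
      exact ENNReal.ofReal_le_ofReal (hlip _ _)
  have hR : Tendsto (fun n => ∫ p, f' (W n p) * D n p e * η p ∂μ) atTop
      (𝓝 (∫ p, f' (V p) * G p e * η p ∂μ)) := by
    have := tendsto_integral_mul_bilin (ν := μ) (ContinuousLinearMap.id ℝ (E →L[ℝ] ℝ))
      (h := D) (h₀ := G) (ψ := fun p => η p • e)
      (k := fun n p => f' (W n p)) (k₀ := fun p => f' (V p)) (C := C)
      (fun n => (hDc n).aestronglyMeasurable) hG.1
      hD2 hη2 ?_ (fun n => (hf'.comp (hWc n)).aestronglyMeasurable) (fun n p => hC _)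
      (by filter_upwards [hWae] with p hp using (hf'.tendsto _).comp hp)
    · refine (this.congr fun n => ?_).trans_eq ?_
      · refine integral_congr_ae (Eventually.of_forall fun p => ?_)
        simp; ring
      · congr 1
        refine integral_congr_ae (Eventually.of_forall fun p => ?_)
        simp; ring
    · have h1 : MemLp (fun p => G p e) 2 μ :=
        (ContinuousLinearMap.apply ℝ ℝ e).comp_memLp' hG
      have h2 : MemLp η 2 μ := hη.continuous.memLp_of_hasCompactSupport hηc
      refine (h1.integrable_mul h2).congr
        (Eventually.of_forall fun p => ?_)
      simp [mul_comm]
  exact tendsto_nhds_unique (hL.congr fun n => hstep n) hR.neg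

end General
end FracGauss
end

noncomputable section
namespace FracGauss

/-! ### Gaussian density and the weighted measure -/

section Gaussian

/-- The density of the standard Gaussian measure. -/
def gaussDensity {N : ℕ} (x : Space N) : ℝ :=
  (2 * Real.pi) ^ (-((N : ℝ) / 2)) * Real.exp (-(1 / 2) * ‖x‖ ^ 2)

theorem gaussDensity_pos {N : ℕ} (x : Space N) : 0 < gaussDensity x := by
  unfold gaussDensity; positivity

@[fun_prop]
theorem continuous_gaussDensity {N : ℕ} : Continuous (gaussDensity (N := N)) := by
  unfold gaussDensity; fun_prop

theorem integral_gaussDensity_cexp {N : ℕ} (t : Space N) :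
    ∫ x, gaussDensity x • Complex.exp (inner ℝ x t * Complex.I) = Complex.exp (-‖t‖ ^ 2 / 2) := by
  have h := GaussianFourier.integral_cexp_neg_mul_sq_norm_add (b := (1 / 2 : ℂ)) (by norm_num)
    Complex.I t
  have hpi : (0 : ℝ) < 2 * Real.pi := by positivity
  have h1 : ∀ x : Space N, gaussDensity x • Complex.exp (inner ℝ x t * Complex.I) =
      (((2 * Real.pi) ^ (-((N : ℝ) / 2)) : ℝ) : ℂ) *
        Complex.exp (-(1 / 2 : ℂ) * ‖x‖ ^ 2 + Complex.I * inner ℝ t x) := by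
    intro x
    rw [gaussDensity, Complex.real_smul, Complex.ofReal_mul, mul_assoc, Complex.ofReal_exp,
      ← Complex.exp_add, real_inner_comm]
    push_cast
    ring_nf
  simp_rw [h1]
  rw [integral_const_mul, h, ← mul_assoc]
  have h2 : (Real.pi / (1 / 2 : ℂ)) ^ ((Module.finrank ℝ (Space N) : ℂ) / 2) =
      (((2 * Real.pi) ^ ((N : ℝ) / 2) : ℝ) : ℂ) := by
    rw [Complex.ofReal_cpow hpi.le]
    simp only [finrank_euclideanSpace, Fintype.card_fin]
    push_cast
    congr 1
    ring
  rw [h2, ← Complex.ofReal_mul, ← Real.rpow_add hpi]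
  simp only [neg_add_cancel, Real.rpow_zero, Complex.ofReal_one, one_mul]
  congr 1
  rw [Complex.I_sq]
  ring

/-- If integrability failed, the Bochner integral would take its default value `0`, whereas the
Fourier transform formula at frequency `0` gives `1`. -/
theorem integrable_gaussDensity {N : ℕ} : Integrable (gaussDensity (N := N)) := by
  by_contra hcon
  have h := integral_gaussDensity_cexp (0 : Space N)
  simp only [inner_zero_right, Complex.ofReal_zero, zero_mul, Complex.exp_zero, norm_zero] at h
  have h2 : ∫ x : Space N, gaussDensity x • (1 : ℂ) = 0 := by
    refine integral_undef fun hi => hcon ?_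
    have := hi.re
    simpa using this
  rw [h2] at h
  simp at h

/-- Both finite measures have the same characteristic function. -/
theorem gauss_eq_withDensity (N : ℕ) :
    gauss N = volume.withDensity (fun x => ENNReal.ofReal (gaussDensity x)) := by
  have hf : IsFiniteMeasure
      ((volume : Measure (Space N)).withDensity fun x => ENNReal.ofReal (gaussDensity x)) :=
    isFiniteMeasure_withDensity_ofReal integrable_gaussDensity.2
  refine Measure.ext_of_charFun ?_
  ext t
  rw [charFun_stdGaussian, charFun_apply,
    integral_withDensity_eq_integral_toReal_smul
      (by exact continuous_gaussDensity.measurable.ennreal_ofReal) (by simp)]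
  simp_rw [ENNReal.toReal_ofReal (gaussDensity_pos _).le]
  rw [integral_gaussDensity_cexp]

theorem gauss_prod_eq_withDensity (N : ℕ) :
    (gauss N).prod (volume : Measure ℝ) =
      volume.withDensity (fun p : Space N × ℝ => ENNReal.ofReal (gaussDensity p.1)) := by
  rw [gauss_eq_withDensity,
    prod_withDensity_left (by exact continuous_gaussDensity.measurable.ennreal_ofReal),
    Measure.volume_eq_prod]

theorem gauss_absolutelyContinuous (N : ℕ) : gauss N ≪ volume := by
  rw [gauss_eq_withDensity]; exact withDensity_absolutelyContinuous _ _

theorem absolutelyContinuous_gauss (N : ℕ) : (volume : Measure (Space N)) ≪ gauss N := by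
  rw [gauss_eq_withDensity]
  refine withDensity_absolutelyContinuous' ?_ ?_
  · exact continuous_gaussDensity.measurable.ennreal_ofReal.aemeasurable
  · exact Eventually.of_forall fun x => by simpa using gaussDensity_pos x

theorem measurableSet_upper (N : ℕ) : MeasurableSet (upper N) :=
  measurableSet_lt measurable_const measurable_snd

theorem isOpen_upper (N : ℕ) : IsOpen (upper N) := isOpen_lt continuous_const continuous_snd

/-- The density of the weighted measure `z^(1-s) dγ(x) dz`. -/
def wDensity {N : ℕ} (s : ℝ) (p : Space N × ℝ) : ℝ := gaussDensity p.1 * p.2 ^ (1 - s)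

theorem measurable_wDensity {N : ℕ} (s : ℝ) : Measurable (wDensity (N := N) s) :=
  (continuous_gaussDensity.measurable.comp measurable_fst).mul (measurable_snd.pow_const _)

theorem wDensity_pos {N : ℕ} {s : ℝ} {p : Space N × ℝ} (hp : p ∈ upper N) : 0 < wDensity s p :=
  mul_pos (gaussDensity_pos _) (Real.rpow_pos_of_pos hp _)

theorem continuousOn_wDensity {N : ℕ} (s : ℝ) : ContinuousOn (wDensity (N := N) s) (upper N) :=
  (continuous_gaussDensity.comp continuous_fst).continuousOn.mul
    (continuous_snd.continuousOn.rpow_const fun _ hp => Or.inl (ne_of_gt hp))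

/-- The measure `z^(1-s) dγ(x) dz` on the upper halfspace. -/
def wMeasure (N : ℕ) (s : ℝ) : Measure (Space N × ℝ) :=
  (volume.restrict (upper N)).withDensity (fun p => ENNReal.ofReal (wDensity s p))

theorem wMeasure_absolutelyContinuous (N : ℕ) (s : ℝ) :
    wMeasure N s ≪ volume.restrict (upper N) := withDensity_absolutelyContinuous _ _

theorem absolutelyContinuous_wMeasure (N : ℕ) (s : ℝ) :
    volume.restrict (upper N) ≪ wMeasure N s := by
  refine withDensity_absolutelyContinuous' (measurable_wDensity s).ennreal_ofReal.aemeasurable ?_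
  filter_upwards [ae_restrict_mem (measurableSet_upper N)] with p hp
  simpa using wDensity_pos hp

theorem lintegral_gauss_prod {N : ℕ} (S : Set (Space N × ℝ)) (hS : MeasurableSet S)
    (f : Space N × ℝ → ℝ≥0∞) :
    ∫⁻ p in S, f p ∂((gauss N).prod volume) =
      ∫⁻ p in S, ENNReal.ofReal (gaussDensity p.1) * f p := by
  rw [gauss_prod_eq_withDensity, restrict_withDensity hS,
    lintegral_withDensity_eq_lintegral_mul_non_measurable _
      (by exact (continuous_gaussDensity.measurable.comp measurable_fst).ennreal_ofReal)
      (Eventually.of_forall fun _ => ENNReal.ofReal_lt_top)]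
  rfl

theorem lintegral_wMeasure {N : ℕ} (s : ℝ) (f : Space N × ℝ → ℝ≥0∞) :
    ∫⁻ p, f p ∂(wMeasure N s) = ∫⁻ p in upper N, ENNReal.ofReal (wDensity s p) * f p := by
  rw [wMeasure, lintegral_withDensity_eq_lintegral_mul_non_measurable _
      (measurable_wDensity s).ennreal_ofReal
      (Eventually.of_forall fun _ => ENNReal.ofReal_lt_top)]
  rfl

theorem lintegral_wMeasure_eq {N : ℕ} (s : ℝ) (f : Space N × ℝ → ℝ≥0∞) :
    ∫⁻ p, f p ∂(wMeasure N s) =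
      ∫⁻ p in upper N, ENNReal.ofReal (p.2 ^ (1 - s)) * f p ∂((gauss N).prod volume) := by
  rw [lintegral_wMeasure, lintegral_gauss_prod _ (measurableSet_upper N)]
  refine lintegral_congr fun p => ?_
  rw [wDensity, ENNReal.ofReal_mul (gaussDensity_pos _).le, mul_assoc]

theorem integral_wMeasure {N : ℕ} (s : ℝ) (f : Space N × ℝ → ℝ) :
    ∫ p, f p ∂(wMeasure N s) = ∫ p in upper N, wDensity s p * f p := by
  rw [wMeasure, integral_withDensity_eq_integral_toReal_smul
      (measurable_wDensity s).ennreal_ofReal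
      (Eventually.of_forall fun _ => ENNReal.ofReal_lt_top)]
  refine setIntegral_congr_fun (measurableSet_upper N) fun p hp => ?_
  simp only [ENNReal.toReal_ofReal (wDensity_pos hp).le, smul_eq_mul]

theorem integral_gauss_prod {N : ℕ} (S : Set (Space N × ℝ)) (hS : MeasurableSet S)
    (f : Space N × ℝ → ℝ) :
    ∫ p in S, f p ∂((gauss N).prod volume) = ∫ p in S, gaussDensity p.1 * f p := by
  rw [gauss_prod_eq_withDensity, restrict_withDensity hS,
    integral_withDensity_eq_integral_toReal_smul
      (by exact (continuous_gaussDensity.measurable.comp measurable_fst).ennreal_ofReal)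
      (Eventually.of_forall fun _ => ENNReal.ofReal_lt_top)]
  simp_rw [ENNReal.toReal_ofReal (gaussDensity_pos _).le, smul_eq_mul]

theorem integral_wMeasure_eq {N : ℕ} (s : ℝ) (f : Space N × ℝ → ℝ) :
    ∫ p, f p ∂(wMeasure N s) =
      ∫ p in upper N, f p * p.2 ^ (1 - s) ∂((gauss N).prod volume) := by
  rw [integral_wMeasure, integral_gauss_prod _ (measurableSet_upper N)]
  refine integral_congr_ae (Eventually.of_forall fun p => ?_)
  simp only [wDensity]
  ring

/-- The weight is continuous and positive on the open halfspace, hence bounded below on compact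
subsets. It degenerates only at the boundary and at infinity. -/
theorem memLp_restrict_of_memLp_wMeasure {N : ℕ} {s : ℝ} {F : Type*} [NormedAddCommGroup F]
    {f : Space N × ℝ → F} (hf : MemLp f 2 (wMeasure N s)) {K : Set (Space N × ℝ)}
    (hK : IsCompact K) (hKu : K ⊆ upper N) : MemLp f 2 (volume.restrict K) := by
  obtain ⟨c, hc, hcK⟩ : ∃ c : ℝ, 0 < c ∧ ∀ p ∈ K, c ≤ wDensity s p := by
    rcases K.eq_empty_or_nonempty with rfl | hne
    · exact ⟨1, one_pos, by simp⟩
    · obtain ⟨q, hq, hmin⟩ := hK.exists_isMinOn hne ((continuousOn_wDensity s).mono hKu)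
      exact ⟨_, wDensity_pos (hKu hq), fun p hp => hmin hp⟩
  refine hf.of_measure_le_smul (c := (ENNReal.ofReal c)⁻¹)
    (by simpa using hc) ?_
  refine Measure.le_iff.2 fun S hS => ?_
  rw [Measure.smul_apply, smul_eq_mul, wMeasure, withDensity_apply _ hS,
    Measure.restrict_restrict hS, Measure.restrict_apply hS, ← ENNReal.div_eq_inv_mul,
    ENNReal.le_div_iff_mul_le (by simp [hc]) (by simp), mul_comm]
  calc ENNReal.ofReal c * volume (S ∩ K)
      = ∫⁻ _ in S ∩ K, ENNReal.ofReal c := by rw [setLIntegral_const]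
    _ ≤ ∫⁻ p in S ∩ K, ENNReal.ofReal (wDensity s p) := by
        refine setLIntegral_mono' (hS.inter hK.isClosed.measurableSet) fun p hp => ?_
        exact ENNReal.ofReal_le_ofReal (hcK p hp.2)
    _ ≤ _ := lintegral_mono_set (inter_subset_inter_right _ hKu)

end Gaussian
end FracGauss
end

noncomputable section
namespace FracGauss

/-! ### Cutoffs exhausting the halfspace -/

section Cutoff

theorem exists_abs_deriv_smoothTransition_le :
    ∃ C : ℝ, 0 ≤ C ∧ ∀ x, |deriv Real.smoothTransition x| ≤ C := by
  have hc : Continuous (deriv Real.smoothTransition) :=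
    (Real.smoothTransition.contDiff (n := 1)).continuous_deriv (by norm_num)
  have hs : HasCompactSupport (deriv Real.smoothTransition) := by
    refine HasCompactSupport.of_support_subset_isCompact (isCompact_Icc (a := (0 : ℝ)) (b := 1)) ?_
    intro x hx
    by_contra hcon
    rw [mem_Icc, not_and_or, not_le, not_le] at hcon
    apply hx
    rcases hcon with h | h
    · have : Real.smoothTransition =ᶠ[𝓝 x] fun _ => 0 := by
        filter_upwards [gt_mem_nhds h] with y hy
        exact Real.smoothTransition.zero_of_nonpos hy.le
      rw [this.deriv_eq, deriv_const]
    · have : Real.smoothTransition =ᶠ[𝓝 x] fun _ => 1 := by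
        filter_upwards [lt_mem_nhds h] with y hy
        exact Real.smoothTransition.one_of_one_le hy.le
      rw [this.deriv_eq, deriv_const]
  obtain ⟨C, hC⟩ := hs.exists_bound_of_continuous hc
  exact ⟨C, (norm_nonneg _).trans (hC 0), hC⟩

theorem deriv_smoothTransition_of_one_lt {x : ℝ} (h : 1 < x) :
    deriv Real.smoothTransition x = 0 := by
  have : Real.smoothTransition =ᶠ[𝓝 x] fun _ => 1 := by
    filter_upwards [lt_mem_nhds h] with y hy
    exact Real.smoothTransition.one_of_one_le hy.le
  rw [this.deriv_eq, deriv_const]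

/-- A bump function of the whole space, used to cut off at infinity. -/
def unitBump (E : Type*) [NormedAddCommGroup E] : ContDiffBump (0 : E) := ⟨1, 2, one_pos, by norm_num⟩

/-- Smooth cutoff functions that exhaust the open upper halfspace. -/
def cutoff (N n : ℕ) (p : Space N × ℝ) : ℝ :=
  unitBump (Space N × ℝ) ((1 / ((n : ℝ) + 1)) • p) *
    Real.smoothTransition (((n : ℝ) + 1) * p.2 - 1)

variable {N : ℕ}

theorem contDiff_cutoff (n : ℕ) : ContDiff ℝ (⊤ : ℕ∞) (cutoff N n) := by
  unfold cutoff
  refine ContDiff.mul ?_ ?_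
  · exact (unitBump (Space N × ℝ)).contDiff.comp (contDiff_id.const_smul (1 / ((n : ℝ) + 1)))
  · exact Real.smoothTransition.contDiff.comp ((contDiff_const.mul contDiff_snd).sub contDiff_const)

theorem cutoff_nonneg (n : ℕ) (p : Space N × ℝ) : 0 ≤ cutoff N n p :=
  mul_nonneg (ContDiffBump.nonneg _) (Real.smoothTransition.nonneg _)

theorem cutoff_le_one (n : ℕ) (p : Space N × ℝ) : cutoff N n p ≤ 1 :=
  mul_le_one₀ (ContDiffBump.le_one _) (Real.smoothTransition.nonneg _)
    (Real.smoothTransition.le_one _)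

theorem tsupport_cutoff_subset (n : ℕ) :
    tsupport (cutoff N n) ⊆ Metric.closedBall 0 (2 * (n + 1)) ∩ {p | 1 / ((n : ℝ) + 1) ≤ p.2} := by
  have hn : (0 : ℝ) < n + 1 := by positivity
  refine closure_minimal ?_ (Metric.isClosed_closedBall.inter
    (isClosed_le continuous_const continuous_snd))
  intro p hp
  have h1 : unitBump (Space N × ℝ) ((1 / ((n : ℝ) + 1)) • p) ≠ 0 := left_ne_zero_of_mul hp
  have h2 : Real.smoothTransition (((n : ℝ) + 1) * p.2 - 1) ≠ 0 := right_ne_zero_of_mul hp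
  constructor
  · have h3 : (1 / ((n : ℝ) + 1)) • p ∈ Function.support (unitBump (Space N × ℝ)) := h1
    rw [ContDiffBump.support_eq, mem_ball_zero_iff, norm_smul, Real.norm_of_nonneg (by positivity)]
      at h3
    rw [mem_closedBall_zero_iff]
    have h4 : 1 / ((n : ℝ) + 1) * ‖p‖ < 2 := h3
    rw [one_div, inv_mul_lt_iff₀ hn] at h4
    linarith
  · by_contra hcon
    apply h2
    apply Real.smoothTransition.zero_of_nonpos
    rw [mem_ofPred_eq, not_le, lt_div_iff₀ hn] at hcon
    linarith

theorem isTest_cutoff (n : ℕ) : IsTest (cutoff N n) where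
  smooth := contDiff_cutoff n
  compact := (isCompact_closedBall (0 : Space N × ℝ) (2 * (n + 1))).of_isClosed_subset
    (isClosed_tsupport _) ((tsupport_cutoff_subset n).trans inter_subset_left)
  support := fun p hp => by
    have h := (tsupport_cutoff_subset n hp).2
    have hn : (0 : ℝ) < 1 / (n + 1) := by positivity
    exact lt_of_lt_of_le hn h

theorem cutoff_eventuallyEq_one {n : ℕ} {p : Space N × ℝ} (h1 : ‖p‖ < n + 1)
    (h2 : 2 < (n + 1) * p.2) : cutoff N n =ᶠ[𝓝 p] fun _ => 1 := by
  have hn : (0 : ℝ) < n + 1 := by positivity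
  have e1 : ∀ᶠ q : Space N × ℝ in 𝓝 p, ‖q‖ < n + 1 := continuous_norm.continuousAt.eventually_lt
    continuousAt_const h1
  have e2 : ∀ᶠ q : Space N × ℝ in 𝓝 p, 2 < (n + 1) * q.2 :=
    continuousAt_const.eventually_lt (by fun_prop) h2
  filter_upwards [e1, e2] with q hq1 hq2
  rw [cutoff, ContDiffBump.one_of_mem_closedBall, Real.smoothTransition.one_of_one_le (by linarith),
    one_mul]
  rw [mem_closedBall_zero_iff, norm_smul, Real.norm_of_nonneg (by positivity), one_div,
    inv_mul_le_iff₀ hn]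
  change ‖q‖ ≤ (n + 1) * 1
  linarith

theorem eventually_cutoff_eventuallyEq_one {K : Set (Space N × ℝ)} (hK : IsCompact K)
    (hKu : K ⊆ upper N) : ∀ᶠ n in atTop, ∀ p ∈ K, cutoff N n =ᶠ[𝓝 p] fun _ => 1 := by
  rcases K.eq_empty_or_nonempty with rfl | hne
  · simp
  obtain ⟨q, hq, hmin⟩ := hK.exists_isMinOn hne continuous_snd.continuousOn
  obtain ⟨R, hR⟩ := hK.isBounded.exists_norm_le
  have hq0 : 0 < q.2 := hKu hq
  have t1 : Tendsto (fun n : ℕ => (n : ℝ) + 1) atTop atTop :=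
    tendsto_atTop_add_const_right _ _ tendsto_natCast_atTop_atTop
  filter_upwards [t1.eventually_gt_atTop R, (t1.atTop_mul_const hq0).eventually_gt_atTop 2]
    with n h1 h2 p hp
  refine cutoff_eventuallyEq_one ((hR p hp).trans_lt h1) (h2.trans_le ?_)
  have : q.2 ≤ p.2 := hmin hp
  gcongr

/-- The bound is uniform in `n` and scales like the inverse height, so that it can be paired with
Hardy's inequality. The vertical factor has slope of order `n + 1`, but only where `(n + 1) z ≤ 2`.
The bump at infinity has slope of order `1/(n + 1)`, and the height on its support is at most `2 (n
+ 1)`. -/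
theorem exists_norm_fderiv_cutoff_le (N : ℕ) :
    ∃ C : ℝ, 0 ≤ C ∧ ∀ n, ∀ p ∈ upper N, ‖fderiv ℝ (cutoff N n) p‖ ≤ C / p.2 := by
  obtain ⟨C₁, hC₁0, hC₁⟩ := exists_abs_deriv_smoothTransition_le
  have hA : ContDiff ℝ 1 (unitBump (Space N × ℝ)) := (unitBump (Space N × ℝ)).contDiff
  obtain ⟨C₂, hC₂⟩ := ((unitBump (Space N × ℝ)).hasCompactSupport.fderiv ℝ).exists_bound_of_continuous
    (hA.continuous_fderiv (by norm_num))
  have hC₂0 : 0 ≤ C₂ := (norm_nonneg _).trans (hC₂ 0)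
  refine ⟨2 * C₂ + 2 * C₁, by positivity, fun n p hp => ?_⟩
  have hp0 : 0 < p.2 := hp
  have hn : (0 : ℝ) < n + 1 := by positivity
  by_cases hsup : p ∈ tsupport (cutoff N n)
  swap
  · have h0 : fderiv ℝ (cutoff N n) p = 0 := by
      by_contra hcon
      exact hsup (support_fderiv_subset ℝ hcon)
    rw [h0, norm_zero]
    positivity
  have hpn : p.2 ≤ 2 * (n + 1) := by
    have h1 := (tsupport_cutoff_subset n hsup).1
    rw [mem_closedBall_zero_iff] at h1
    exact (le_abs_self _).trans ((norm_snd_le p).trans h1)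
  have d1 : HasFDerivAt (fun q : Space N × ℝ => unitBump (Space N × ℝ) ((1 / ((n : ℝ) + 1)) • q))
      ((fderiv ℝ (unitBump (Space N × ℝ)) ((1 / ((n : ℝ) + 1)) • p)).comp
        ((1 / ((n : ℝ) + 1)) • ContinuousLinearMap.id ℝ (Space N × ℝ))) p :=
    ((hA.differentiable (by norm_num)) _).hasFDerivAt.comp p
      ((hasFDerivAt_id p).const_smul (1 / ((n : ℝ) + 1)))
  have d2 : HasFDerivAt (fun q : Space N × ℝ => Real.smoothTransition (((n : ℝ) + 1) * q.2 - 1))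
      (deriv Real.smoothTransition (((n : ℝ) + 1) * p.2 - 1) •
        (((n : ℝ) + 1) • ContinuousLinearMap.snd ℝ (Space N) ℝ)) p := by
    have hS : HasDerivAt Real.smoothTransition
        (deriv Real.smoothTransition (((n : ℝ) + 1) * p.2 - 1)) (((n : ℝ) + 1) * p.2 - 1) :=
      ((Real.smoothTransition.contDiff (n := 1)).differentiable (by norm_num) _).hasDerivAt
    exact hS.comp_hasFDerivAt p
      (((hasFDerivAt_snd (𝕜 := ℝ) (p := p)).const_mul ((n : ℝ) + 1)).sub_const 1)
  have hd : HasFDerivAt (cutoff N n) _ p := d1.mul d2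
  rw [hd.fderiv]
  have b1 : ‖(fderiv ℝ (unitBump (Space N × ℝ)) ((1 / ((n : ℝ) + 1)) • p)).comp
        ((1 / ((n : ℝ) + 1)) • ContinuousLinearMap.id ℝ (Space N × ℝ))‖ ≤ 2 * C₂ / p.2 := by
    refine (ContinuousLinearMap.opNorm_comp_le _ _).trans ?_
    have h1 : ‖(1 / ((n : ℝ) + 1)) • ContinuousLinearMap.id ℝ (Space N × ℝ)‖ ≤ 2 / p.2 := by
      rw [norm_smul, Real.norm_of_nonneg (by positivity)]
      calc 1 / ((n : ℝ) + 1) * ‖ContinuousLinearMap.id ℝ (Space N × ℝ)‖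
          ≤ 1 / ((n : ℝ) + 1) * 1 := by gcongr; exact ContinuousLinearMap.norm_id_le
        _ ≤ 2 / p.2 := by
            rw [mul_one, div_le_div_iff₀ hn hp0]; linarith
    calc _ ≤ C₂ * (2 / p.2) := mul_le_mul (hC₂ _) h1 (norm_nonneg _) hC₂0
      _ = _ := by ring
  have b2 : ‖deriv Real.smoothTransition (((n : ℝ) + 1) * p.2 - 1) •
        (((n : ℝ) + 1) • ContinuousLinearMap.snd ℝ (Space N) ℝ)‖ ≤ 2 * C₁ / p.2 := by
    rw [norm_smul]
    by_cases h1 : 1 < ((n : ℝ) + 1) * p.2 - 1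
    · rw [deriv_smoothTransition_of_one_lt h1, norm_zero, zero_mul]; positivity
    · have h2 : (n : ℝ) + 1 ≤ 2 / p.2 := by rw [le_div_iff₀ hp0]; linarith
      have h3 : ‖((n : ℝ) + 1) • ContinuousLinearMap.snd ℝ (Space N) ℝ‖ ≤ 2 / p.2 := by
        rw [norm_smul, Real.norm_of_nonneg hn.le]
        calc ((n : ℝ) + 1) * ‖ContinuousLinearMap.snd ℝ (Space N) ℝ‖ ≤ ((n : ℝ) + 1) * 1 := by
              gcongr; exact ContinuousLinearMap.norm_snd_le ..
          _ ≤ _ := by linarith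
      calc _ ≤ C₁ * (2 / p.2) := mul_le_mul (hC₁ _) h3 (norm_nonneg _) hC₁0
        _ = _ := by ring
  refine (norm_add_le _ _).trans ?_
  rw [norm_smul (unitBump (Space N × ℝ) ((1 / ((n : ℝ) + 1)) • p)),
    norm_smul (Real.smoothTransition (((n : ℝ) + 1) * p.2 - 1)),
    Real.norm_of_nonneg (ContDiffBump.nonneg _),
    Real.norm_of_nonneg (Real.smoothTransition.nonneg _)]
  calc _ ≤ 1 * (2 * C₁ / p.2) + 1 * (2 * C₂ / p.2) := by
        gcongr
        · exact ContDiffBump.le_one _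
        · exact Real.smoothTransition.le_one _
    _ = _ := by ring

end Cutoff

/-! ### Square integrability and covector fields -/

section MemLp

variable {α F : Type*} [MeasurableSpace α] {μ : Measure α} [NormedAddCommGroup F]

theorem memLp_add {f g : α → F} (hf : MemLp f 2 μ) (hg : MemLp g 2 μ) :
    MemLp (fun x => f x + g x) 2 μ := hf.add hg

theorem memLp_const_smul [NormedSpace ℝ F] {f : α → F} (hf : MemLp f 2 μ) (c : ℝ) :
    MemLp (fun x => c • f x) 2 μ := hf.const_smul c

theorem memLp_of_restrict {K : Set α} (hK : MeasurableSet K) {f : α → F}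
    (hf : MemLp f 2 (μ.restrict K)) (h0 : ∀ x ∉ K, f x = 0) : MemLp f 2 μ := by
  have h : K.indicator f = f := indicator_eq_self.2 fun x hx => by
    by_contra hcon; exact hx (h0 x hcon)
  rwa [← h, memLp_indicator_iff_restrict hK]

theorem memLp_bdd_smul [NormedSpace ℝ F] {f : α → F} {k : α → ℝ} {C : ℝ} (hf : MemLp f 2 μ)
    (hk : AEStronglyMeasurable k μ) (hC : ∀ᵐ x ∂μ, |k x| ≤ C) : MemLp (fun x => k x • f x) 2 μ := by
  refine MemLp.of_le_mul (c := C) hf (hk.smul hf.1) ?_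
  filter_upwards [hC] with x hx
  rw [norm_smul]
  gcongr
  exact hx

theorem memLp_clm_comp {G : Type*} [NormedAddCommGroup G] [NormedSpace ℝ F] [NormedSpace ℝ G]
    (L : F →L[ℝ] G) {f : α → F} (hf : MemLp f 2 μ) : MemLp (fun x => L (f x)) 2 μ :=
  L.comp_memLp' hf

theorem memLp_prodMk {G : Type*} [NormedAddCommGroup G] {f : α → F} {g : α → G}
    (hf : MemLp f 2 μ) (hg : MemLp g 2 μ) : MemLp (fun x => (f x, g x)) 2 μ :=
  memLp_prod_iff.2 ⟨hf, hg⟩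

theorem clm_prod_apply {G : Type*} [NormedAddCommGroup G] [NormedSpace ℝ F] [NormedSpace ℝ G]
    (L : F × ℝ →L[ℝ] G) (e : F × ℝ) : L e = L (e.1, 0) + e.2 • L (0, 1) := by
  rw [← map_smul, ← map_add]; simp

section Covector

variable {X : Type*} [NormedAddCommGroup X] [InnerProductSpace ℝ X]

/-- The covector `(a, b) ↦ ⟨x, a⟩ + z b`. -/
def toCovector (x : X) (z : ℝ) : X × ℝ →L[ℝ] ℝ :=
  (innerSL ℝ x).comp (ContinuousLinearMap.fst ℝ X ℝ) + z • ContinuousLinearMap.snd ℝ X ℝ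

@[simp] theorem toCovector_apply (x : X) (z : ℝ) (e : X × ℝ) :
    toCovector x z e = inner ℝ x e.1 + z * e.2 := by
  simp [toCovector]

/-- `toCovector` as a bounded linear map. -/
def toCovectorL (X : Type*) [NormedAddCommGroup X] [InnerProductSpace ℝ X]
    [FiniteDimensional ℝ X] : X × ℝ →L[ℝ] X × ℝ →L[ℝ] ℝ :=
  LinearMap.toContinuousLinearMap
    { toFun := fun p => toCovector p.1 p.2
      map_add' := fun p q => by ext <;> simp [inner_add_left]
      map_smul' := fun c p => by ext <;> simp [inner_smul_left] }

theorem memLp_toCovector [FiniteDimensional ℝ X] {gx : α → X} {gz : α → ℝ}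
    (hx : MemLp gx 2 μ) (hz : MemLp gz 2 μ) :
    MemLp (fun p => toCovector (gx p) (gz p)) 2 μ := by
  have h := memLp_clm_comp (F := X × ℝ) (G := X × ℝ →L[ℝ] ℝ) (toCovectorL X) (memLp_prodMk hx hz)
  exact h

end Covector

end MemLp

/-! ### Weak derivatives in the halfspace -/

section WeakDeriv

variable {N : ℕ}

instance : (volume : Measure (Space N × ℝ)).IsAddHaarMeasure := by
  rw [Measure.volume_eq_prod]; infer_instance

/-- `g` is the weak derivative of `v` in the open upper halfspace, as a covector field; both are
locally square integrable. -/
structure HasWeakDeriv (v : Space N × ℝ → ℝ) (g : Space N × ℝ → Space N × ℝ →L[ℝ] ℝ) : Prop where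
  memLp : ∀ K ⊆ upper N, IsCompact K → MemLp v 2 (volume.restrict K)
  memLp_deriv : ∀ K ⊆ upper N, IsCompact K → MemLp g 2 (volume.restrict K)
  weak : ∀ η, IsTest η → ∀ e : Space N × ℝ,
    ∫ p in upper N, v p * fderiv ℝ η p e = - ∫ p in upper N, g p e * η p

theorem integrable_mul_of_hasCompactSupport {v η : Space N × ℝ → ℝ}
    (hv : ∀ K ⊆ upper N, IsCompact K → MemLp v 2 (volume.restrict K)) (hη : Continuous η)
    (hc : HasCompactSupport η) (hs : tsupport η ⊆ upper N) : Integrable (fun p => v p * η p) := by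
  have h1 : MemLp η 2 (volume.restrict (tsupport η)) :=
    (hη.memLp_of_hasCompactSupport hc).restrict _
  have h2 : IntegrableOn (fun p => v p * η p) (tsupport η) := (hv _ hs hc).integrable_mul h1
  refine IntegrableOn.integrable_of_forall_notMem_eq_zero h2 fun p hp => ?_
  simp [image_eq_zero_of_notMem_tsupport hp]

theorem tsupport_fderiv_apply_subset (η : Space N × ℝ → ℝ) (e : Space N × ℝ) :
    tsupport (fun p => fderiv ℝ η p e) ⊆ tsupport η :=
  closure_minimal (fun p hp => by
    by_contra hcon
    have : fderiv ℝ η p = 0 := by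
      by_contra h; exact hcon (support_fderiv_subset ℝ h)
    simp [this] at hp) (isClosed_tsupport _)

theorem IsTest.continuous_fderiv_apply {η : Space N × ℝ → ℝ} (hη : IsTest η) (e : Space N × ℝ) :
    Continuous (fun p => fderiv ℝ η p e) :=
  (hη.smooth.continuous_fderiv (by norm_num)).clm_apply continuous_const

theorem IsTest.hasCompactSupport_fderiv {η : Space N × ℝ → ℝ} (hη : IsTest η) (e : Space N × ℝ) :
    HasCompactSupport (fun p => fderiv ℝ η p e) :=
  hη.compact.of_isClosed_subset (isClosed_tsupport _) (tsupport_fderiv_apply_subset η e)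

theorem IsTest.integrable_mul_fderiv {η v : Space N × ℝ → ℝ} (hη : IsTest η)
    (hv : ∀ K ⊆ upper N, IsCompact K → MemLp v 2 (volume.restrict K)) (e : Space N × ℝ) :
    Integrable (fun p => v p * fderiv ℝ η p e) :=
  integrable_mul_of_hasCompactSupport hv (hη.continuous_fderiv_apply e)
    (hη.hasCompactSupport_fderiv e) ((tsupport_fderiv_apply_subset η e).trans hη.support)

theorem IsTest.integrable_mul {η v : Space N × ℝ → ℝ} (hη : IsTest η)
    (hv : ∀ K ⊆ upper N, IsCompact K → MemLp v 2 (volume.restrict K)) :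
    Integrable (fun p => v p * η p) :=
  integrable_mul_of_hasCompactSupport hv hη.smooth.continuous hη.compact hη.support

/-- The product of a function that is smooth in the upper halfspace with a test function. -/
theorem IsTest.contDiffOn_mul {η χ : Space N × ℝ → ℝ} (hη : IsTest η)
    (hχ : ContDiffOn ℝ (⊤ : ℕ∞) χ (upper N)) : IsTest (fun p => χ p * η p) where
  smooth := by
    rw [contDiff_iff_contDiffAt]
    intro p
    by_cases hp : p ∈ tsupport η
    · exact (hχ.contDiffAt ((isOpen_upper N).mem_nhds (hη.support hp))).mul hη.smooth.contDiffAt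
    · have : (fun q => χ q * η q) =ᶠ[𝓝 p] fun _ => 0 := by
        filter_upwards [(isClosed_tsupport η).isOpen_compl.mem_nhds hp] with q hq
        simp [image_eq_zero_of_notMem_tsupport hq]
      exact contDiffAt_const.congr_of_eventuallyEq this
  compact := hη.compact.mul_left
  support := (tsupport_mul_subset_right).trans hη.support

theorem HasWeakDeriv.memLp_apply {v : Space N × ℝ → ℝ} {g : Space N × ℝ → Space N × ℝ →L[ℝ] ℝ}
    (h : HasWeakDeriv v g) (e : Space N × ℝ) (K : Set (Space N × ℝ)) (hK : K ⊆ upper N)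
    (hc : IsCompact K) : MemLp (fun p => g p e) 2 (volume.restrict K) :=
  (ContinuousLinearMap.apply ℝ ℝ e).comp_memLp' (h.memLp_deriv K hK hc)

theorem IsWeakGradient.hasWeakDeriv {v : Space N × ℝ → ℝ} {gx : Space N × ℝ → Space N}
    {gz : Space N × ℝ → ℝ} (h : IsWeakGradient v gx gz) :
    HasWeakDeriv v (fun p => toCovector (gx p) (gz p)) where
  memLp := h.memLp
  memLp_deriv K hK hc := by
    exact memLp_toCovector (h.memLp_x K hK hc) (h.memLp_z K hK hc)
  weak η hη e := by
    have hx : ∀ K ⊆ upper N, IsCompact K →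
        MemLp (fun p => inner ℝ (gx p) e.1) 2 (volume.restrict K) := fun K hK hc => by
      simp_rw [real_inner_comm]
      exact (innerSL ℝ e.1).comp_memLp' (h.memLp_x K hK hc)
    have h1 := hη.integrable_mul hx
    have h2 := hη.integrable_mul h.memLp_z
    have h3 := hη.integrable_mul_fderiv h.memLp (e.1, 0)
    have h4 := hη.integrable_mul_fderiv h.memLp (0, 1)
    have he : ∀ p, fderiv ℝ η p e = fderiv ℝ η p (e.1, 0) + e.2 * fderiv ℝ η p (0, 1) :=
      fun p => clm_prod_apply _ e
    calc ∫ p in upper N, v p * fderiv ℝ η p e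
        = ∫ p in upper N, (v p * fderiv ℝ η p (e.1, 0) + e.2 * (v p * fderiv ℝ η p (0, 1))) := by
          refine integral_congr_ae (Eventually.of_forall fun p => ?_)
          simp only [he]; ring
      _ = -(∫ p in upper N, inner ℝ (gx p) e.1 * η p) + e.2 * -(∫ p in upper N, gz p * η p) := by
          rw [integral_add h3.integrableOn (h4.integrableOn.const_mul _), integral_const_mul,
            h.weak_x η hη, h.weak_z η hη]
      _ = _ := by
          rw [mul_neg, ← neg_add, ← integral_const_mul,
            ← integral_add h1.integrableOn (h2.integrableOn.const_mul _)]
          congr 1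
          refine integral_congr_ae (Eventually.of_forall fun p => ?_)
          simp only [toCovector_apply]; ring

theorem HasWeakDeriv.add {v₁ v₂ : Space N × ℝ → ℝ} {g₁ g₂ : Space N × ℝ → Space N × ℝ →L[ℝ] ℝ}
    (h₁ : HasWeakDeriv v₁ g₁) (h₂ : HasWeakDeriv v₂ g₂) :
    HasWeakDeriv (fun p => v₁ p + v₂ p) (fun p => g₁ p + g₂ p) where
  memLp K hK hc := (h₁.memLp K hK hc).add (h₂.memLp K hK hc)
  memLp_deriv K hK hc := memLp_add (h₁.memLp_deriv K hK hc) (h₂.memLp_deriv K hK hc)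
  weak η hη e := by
    simp only [add_mul, add_apply]
    rw [integral_add (hη.integrable_mul_fderiv h₁.memLp e).integrableOn
      (hη.integrable_mul_fderiv h₂.memLp e).integrableOn,
      integral_add (hη.integrable_mul (h₁.memLp_apply e)).integrableOn
      (hη.integrable_mul (h₂.memLp_apply e)).integrableOn, h₁.weak η hη, h₂.weak η hη, neg_add]

theorem HasWeakDeriv.const_mul {v : Space N × ℝ → ℝ} {g : Space N × ℝ → Space N × ℝ →L[ℝ] ℝ}
    (h : HasWeakDeriv v g) (c : ℝ) : HasWeakDeriv (fun p => c * v p) (fun p => c • g p) where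
  memLp K hK hc := (h.memLp K hK hc).const_mul c
  memLp_deriv K hK hc := memLp_const_smul (h.memLp_deriv K hK hc) c
  weak η hη e := by
    simp only [smul_apply, smul_eq_mul, mul_assoc]
    rw [integral_const_mul, integral_const_mul, h.weak η hη, mul_neg]

theorem HasWeakDeriv.sub {v₁ v₂ : Space N × ℝ → ℝ} {g₁ g₂ : Space N × ℝ → Space N × ℝ →L[ℝ] ℝ}
    (h₁ : HasWeakDeriv v₁ g₁) (h₂ : HasWeakDeriv v₂ g₂) :
    HasWeakDeriv (fun p => v₁ p - v₂ p) (fun p => g₁ p - g₂ p) := by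
  have h := h₁.add (h₂.const_mul (-1))
  have e1 : (fun p => v₁ p - v₂ p) = fun p => v₁ p + -1 * v₂ p := by ext p; ring
  have e2 : (fun p => g₁ p - g₂ p) = fun p => g₁ p + (-1 : ℝ) • g₂ p := by
    funext p; exact ContinuousLinearMap.ext fun e => by simp [sub_eq_add_neg]
  rwa [e1, e2]

theorem integral_fderiv_isTest {η : Space N × ℝ → ℝ} (hη : IsTest η) (e : Space N × ℝ) :
    ∫ p in upper N, fderiv ℝ η p e = 0 := by
  have h := integral_mul_fderiv_eq_neg_fderiv_mul_of_integrable
    (μ := (volume : Measure (Space N × ℝ))) (v := e) (f := fun _ => (1 : ℝ)) (g := η)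
    (by simp)
    (by simpa using (hη.continuous_fderiv_apply e).integrable_of_hasCompactSupport
          (hη.hasCompactSupport_fderiv e))
    (by simpa using hη.smooth.continuous.integrable_of_hasCompactSupport hη.compact)
    (fun _ _ => differentiableAt_const _) (fun p _ => hη.smooth.differentiable (by norm_num) p)
  rw [setIntegral_eq_integral_of_forall_compl_eq_zero]
  · simpa using h
  · intro p hp
    exact image_eq_zero_of_notMem_tsupport (f := fun p => fderiv ℝ η p e) fun hcon =>
      hp (hη.support (tsupport_fderiv_apply_subset η e hcon))

theorem hasWeakDeriv_const (c : ℝ) : HasWeakDeriv (N := N) (fun _ => c) (fun _ => 0) where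
  memLp K _ hc := by
    have : IsFiniteMeasure (volume.restrict K) := ⟨by simpa using hc.measure_lt_top⟩
    exact memLp_const c
  memLp_deriv K _ _ := (MemLp.zero (ε := Space N × ℝ →L[ℝ] ℝ))
  weak η hη e := by
    rw [integral_const_mul, integral_fderiv_isTest hη]
    simp

theorem memLp_smul_of_continuousOn {F : Type*} [NormedAddCommGroup F] [NormedSpace ℝ F]
    {K : Set (Space N × ℝ)} (hc : IsCompact K) {χ : Space N × ℝ → ℝ} (hχ : ContinuousOn χ K)
    {g : Space N × ℝ → F} (hg : MemLp g 2 (volume.restrict K)) :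
    MemLp (fun p => χ p • g p) 2 (volume.restrict K) := by
  obtain ⟨C, hC⟩ := hc.exists_bound_of_continuousOn hχ
  have hKm := hc.isClosed.measurableSet
  refine MemLp.of_le_mul (c := C) hg ((hχ.aestronglyMeasurable hKm).smul hg.1) ?_
  filter_upwards [ae_restrict_mem hKm] with p hp
  rw [norm_smul]
  gcongr
  exact hC p hp

theorem memLp_smul_clm_of_continuousOn {F : Type*} [NormedAddCommGroup F] [NormedSpace ℝ F]
    {K : Set (Space N × ℝ)} (hc : IsCompact K) {χ : Space N × ℝ → F}
    (hχ : ContinuousOn χ K) {g : Space N × ℝ → ℝ} (hg : MemLp g 2 (volume.restrict K)) :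
    MemLp (fun p => g p • χ p) 2 (volume.restrict K) := by
  obtain ⟨C, hC⟩ := hc.exists_bound_of_continuousOn hχ
  have hKm := hc.isClosed.measurableSet
  refine MemLp.of_le_mul (c := C) hg (hg.1.smul
    (hχ.aestronglyMeasurable_of_isCompact hc hKm)) ?_
  filter_upwards [ae_restrict_mem hKm] with p hp
  rw [norm_smul, mul_comm]
  gcongr
  exact hC p hp

theorem fderiv_mul_apply' {χ η : Space N × ℝ → ℝ} {p : Space N × ℝ} (h1 : DifferentiableAt ℝ χ p)
    (h2 : DifferentiableAt ℝ η p) (e : Space N × ℝ) :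
    fderiv ℝ (fun q => χ q * η q) p e = χ p * fderiv ℝ η p e + η p * fderiv ℝ χ p e := by
  have h : HasFDerivAt (fun q => χ q * η q) _ p := h1.hasFDerivAt.mul h2.hasFDerivAt
  rw [h.fderiv]
  simp

/-- The product rule for a weakly differentiable function and a function that is smooth in the
upper halfspace. -/
theorem HasWeakDeriv.contDiffOn_mul {v : Space N × ℝ → ℝ}
    {g : Space N × ℝ → Space N × ℝ →L[ℝ] ℝ} (h : HasWeakDeriv v g) {χ : Space N × ℝ → ℝ}
    (hχ : ContDiffOn ℝ (⊤ : ℕ∞) χ (upper N)) :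
    HasWeakDeriv (fun p => χ p * v p) (fun p => χ p • g p + v p • fderiv ℝ χ p) := by
  have hd : ContinuousOn (fderiv ℝ χ) (upper N) :=
    hχ.continuousOn_fderiv_of_isOpen (isOpen_upper N) (by norm_num)
  refine ⟨fun K hK hc => ?_, fun K hK hc => ?_, fun η hη e => ?_⟩
  · exact memLp_smul_of_continuousOn hc (hχ.continuousOn.mono hK) (h.memLp K hK hc)
  · exact memLp_add (memLp_smul_of_continuousOn hc (hχ.continuousOn.mono hK)
      (h.memLp_deriv K hK hc)) (memLp_smul_clm_of_continuousOn hc (hd.mono hK) (h.memLp K hK hc))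
  · have hde : ∀ K ⊆ upper N, IsCompact K →
        MemLp (fun p => v p * fderiv ℝ χ p e) 2 (volume.restrict K) := fun K hK hc => by
      have := memLp_smul_of_continuousOn hc
        ((hd.clm_apply continuousOn_const).mono hK : ContinuousOn (fun p => fderiv ℝ χ p e) K)
        (h.memLp K hK hc)
      simpa [mul_comm] using this
    have i1 := (hη.contDiffOn_mul hχ).integrable_mul_fderiv h.memLp e
    have i2 := hη.integrable_mul hde
    have i3 := (hη.contDiffOn_mul hχ).integrable_mul (h.memLp_apply e)
    have hw := h.weak _ (hη.contDiffOn_mul hχ) e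
    calc ∫ p in upper N, χ p * v p * fderiv ℝ η p e
        = ∫ p in upper N, (v p * fderiv ℝ (fun q => χ q * η q) p e -
            v p * fderiv ℝ χ p e * η p) := by
          refine setIntegral_congr_fun (measurableSet_upper N) fun p hp => ?_
          have hχp : DifferentiableAt ℝ χ p :=
            (hχ.contDiffAt ((isOpen_upper N).mem_nhds hp)).differentiableAt (by norm_num)
          simp only [fderiv_mul_apply' hχp (hη.smooth.differentiable (by norm_num) p)]
          ring
      _ = -(∫ p in upper N, g p e * (χ p * η p)) - ∫ p in upper N, v p * fderiv ℝ χ p e * η p := by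
          rw [integral_sub i1.integrableOn i2.integrableOn, hw]
      _ = _ := by
          rw [← neg_add', ← integral_add i3.integrableOn i2.integrableOn]
          congr 1
          refine integral_congr_ae (Eventually.of_forall fun p => ?_)
          simp only [add_apply, smul_apply, smul_eq_mul]
          ring

/-- A weakly differentiable function times a test function, extended by zero, is weakly
differentiable in the whole space. -/
theorem HasWeakDeriv.isTest_mul {v : Space N × ℝ → ℝ}
    {g : Space N × ℝ → Space N × ℝ →L[ℝ] ℝ} (h : HasWeakDeriv v g) {χ : Space N × ℝ → ℝ}
    (hχ : IsTest χ) :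
    MemLp (fun p => χ p * v p) 2 volume ∧
      MemLp (fun p => χ p • g p + v p • fderiv ℝ χ p) 2 volume ∧
      ∀ η : Space N × ℝ → ℝ, ContDiff ℝ (⊤ : ℕ∞) η → HasCompactSupport η → ∀ e : Space N × ℝ,
        ∫ p, χ p * v p * fderiv ℝ η p e =
          - ∫ p, (χ p • g p + v p • fderiv ℝ χ p) e * η p := by
  have hprod := h.contDiffOn_mul hχ.smooth.contDiffOn
  have hdz : ∀ p ∉ tsupport χ, fderiv ℝ χ p = 0 := fun p hp => by
    by_contra hcon; exact hp (support_fderiv_subset ℝ hcon)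
  have hKm := hχ.compact.isClosed.measurableSet
  refine ⟨?_, ?_, fun η hη hηc e => ?_⟩
  · exact memLp_of_restrict hKm (hprod.memLp _ hχ.support hχ.compact)
      fun p hp => by simp [image_eq_zero_of_notMem_tsupport hp]
  · exact memLp_of_restrict hKm (hprod.memLp_deriv _ hχ.support hχ.compact)
      fun p hp => by simp [image_eq_zero_of_notMem_tsupport hp, hdz p hp]
  · have hη' : IsTest (fun p => η p * χ p) := hχ.contDiffOn_mul hη.contDiffOn
    have hde : ∀ K ⊆ upper N, IsCompact K → MemLp (fun p => v p * η p) 2 (volume.restrict K) :=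
      fun K hK hc => by
        simpa [mul_comm] using
          memLp_smul_of_continuousOn hc hη.continuous.continuousOn (h.memLp K hK hc)
    have i1 := hη'.integrable_mul_fderiv h.memLp e
    have i2 := hχ.integrable_mul_fderiv hde e
    have i3 := hη'.integrable_mul (h.memLp_apply e)
    have hw := h.weak _ hη' e
    have z : ∀ p, p ∉ upper N → p ∉ tsupport χ := fun p hp hcon => hp (hχ.support hcon)
    rw [← setIntegral_eq_integral_of_forall_compl_eq_zero (s := upper N)
        (f := fun p => χ p * v p * fderiv ℝ η p e)
        fun p hp => by simp [image_eq_zero_of_notMem_tsupport (z p hp)],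
      ← setIntegral_eq_integral_of_forall_compl_eq_zero (s := upper N)
        (f := fun p => (χ p • g p + v p • fderiv ℝ χ p) e * η p)
        fun p hp => by simp [image_eq_zero_of_notMem_tsupport (z p hp), hdz p (z p hp)]]
    calc ∫ p in upper N, χ p * v p * fderiv ℝ η p e
        = ∫ p in upper N, (v p * fderiv ℝ (fun q => η q * χ q) p e -
            v p * η p * fderiv ℝ χ p e) := by
          refine integral_congr_ae (Eventually.of_forall fun p => ?_)
          simp only [fderiv_mul_apply' (hη.differentiable (by norm_num) p)
            (hχ.smooth.differentiable (by norm_num) p)]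
          ring
      _ = -(∫ p in upper N, g p e * (η p * χ p)) - ∫ p in upper N, v p * η p * fderiv ℝ χ p e := by
          rw [integral_sub i1.integrableOn i2.integrableOn, hw]
      _ = _ := by
          rw [← neg_add', ← integral_add i3.integrableOn i2.integrableOn]
          congr 1
          refine integral_congr_ae (Eventually.of_forall fun p => ?_)
          simp only [add_apply, smul_apply, smul_eq_mul]
          ring

/-- The chain rule for weakly differentiable functions. -/
theorem HasWeakDeriv.comp {v : Space N × ℝ → ℝ}
    {g : Space N × ℝ → Space N × ℝ →L[ℝ] ℝ} (h : HasWeakDeriv v g) {f f' : ℝ → ℝ} {C : ℝ}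
    (hf : ∀ r, HasDerivAt f (f' r) r) (hf' : Continuous f') (hC : ∀ r, |f' r| ≤ C) :
    HasWeakDeriv (fun p => f (v p)) (fun p => f' (v p) • g p) := by
  have hfc : Continuous f := continuous_iff_continuousAt.2 fun r => (hf r).continuousAt
  have hlip : ∀ a b, |f a - f b| ≤ C * |a - b| := fun a b => by
    simpa using Convex.norm_image_sub_le_of_norm_hasDerivWithin_le (s := univ)
      (fun r _ => (hf r).hasDerivWithinAt) (fun r _ => hC r) convex_univ (mem_univ b) (mem_univ a)
  refine ⟨fun K hK hc => ?_, fun K hK hc => ?_, fun η hη e => ?_⟩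
  · have : IsFiniteMeasure (volume.restrict K) := ⟨by simpa using hc.measure_lt_top⟩
    have h0 : MemLp (fun _ : Space N × ℝ => f 0) 2 (volume.restrict K) := memLp_const _
    have h1 : MemLp (fun p => f (v p) - f 0) 2 (volume.restrict K) := by
      refine MemLp.of_le_mul (c := C) (h.memLp K hK hc)
        ((hfc.comp_aestronglyMeasurable (h.memLp K hK hc).1).sub aestronglyMeasurable_const)
        (Eventually.of_forall fun p => ?_)
      simpa using hlip (v p) 0
    convert h1.add h0 using 1
    ext p; simp
  · exact memLp_bdd_smul (h.memLp_deriv K hK hc)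
      (hf'.comp_aestronglyMeasurable (h.memLp K hK hc).1) (Eventually.of_forall fun p => hC _)
  -- Multiplying by a cutoff that equals one near the support of `η` changes nothing in the
  -- integrals and turns `v` into a weakly differentiable function on the whole space, where the
  -- mollification argument works.
  · obtain ⟨n, hn⟩ := (eventually_cutoff_eventuallyEq_one hη.compact hη.support).exists
    obtain ⟨hV, hG, hw⟩ := h.isTest_mul (isTest_cutoff n)
    have key := integral_comp_mul_fderiv_eq hV hG hw hf hf' hC hη.smooth hη.compact e
    have z : ∀ p, p ∉ upper N → p ∉ tsupport η := fun p hp hcon => hp (hη.support hcon)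
    have z' : ∀ p, p ∉ upper N → fderiv ℝ η p = 0 := fun p hp => by
      by_contra hcon; exact z p hp (support_fderiv_subset ℝ hcon)
    rw [setIntegral_eq_integral_of_forall_compl_eq_zero
        fun p hp => by simp [z' p hp],
      setIntegral_eq_integral_of_forall_compl_eq_zero
        fun p hp => by simp [image_eq_zero_of_notMem_tsupport (z p hp)]]
    convert key using 1
    · refine integral_congr_ae (Eventually.of_forall fun p => ?_)
      by_cases hp : p ∈ tsupport η
      · simp [(hn p hp).eq_of_nhds]
      · have : fderiv ℝ η p = 0 := by
          by_contra hcon; exact hp (support_fderiv_subset ℝ hcon)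
        simp [this]
    · congr 1
      refine integral_congr_ae (Eventually.of_forall fun p => ?_)
      by_cases hp : p ∈ tsupport η
      · simp [(hn p hp).eq_of_nhds, (hn p hp).fderiv_eq]
      · simp [image_eq_zero_of_notMem_tsupport hp]

end WeakDeriv
end FracGauss
end

noncomputable section
namespace FracGauss

/-! ### Weighted inequalities on the half-line -/

section OneDim

theorem lintegral_Ioo_rpow {a w : ℝ} (ha : 0 < a) (hw : 0 < w) :
    ∫⁻ τ in Ioo 0 w, ENNReal.ofReal (τ ^ (a - 1)) = ENNReal.ofReal (w ^ a / a) := by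
  have hi : IntervalIntegrable (fun τ : ℝ => τ ^ (a - 1)) volume 0 w :=
    intervalIntegral.intervalIntegrable_rpow' (by linarith)
  have h := integral_rpow (a := 0) (b := w) (r := a - 1) (Or.inl (by linarith))
  rw [← ofReal_integral_eq_lintegral_ofReal]
  · rw [← integral_Ioc_eq_integral_Ioo, ← intervalIntegral.integral_of_le hw.le, h,
      sub_add_cancel, Real.zero_rpow ha.ne', sub_zero]
  · exact ((intervalIntegrable_iff_integrableOn_Ioo_of_le hw.le).1 hi)
  · filter_upwards [ae_restrict_mem measurableSet_Ioo] with τ hτ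
    exact Real.rpow_nonneg hτ.1.le _

theorem lintegral_Ioi_rpow {a τ : ℝ} (ha : 0 < a) (hτ : 0 < τ) :
    ∫⁻ w in Ioi τ, ENNReal.ofReal (w ^ (-1 - a)) = ENNReal.ofReal (τ ^ (-a) / a) := by
  have hi := integrableOn_Ioi_rpow_of_lt (a := -1 - a) (by linarith) hτ
  rw [← ofReal_integral_eq_lintegral_ofReal hi, integral_Ioi_rpow_of_lt (by linarith) hτ]
  · congr 1
    rw [show -1 - a + 1 = -a by ring, div_neg, neg_div, neg_neg]
  · filter_upwards [ae_restrict_mem measurableSet_Ioi] with w hw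
    exact Real.rpow_nonneg (hτ.trans hw).le _

/-- Weighted Cauchy–Schwarz for `h = τ^(a-1) * (τ^(1-a) h)`: the weight `τ^(a-1)` has mass `w^a/a`.
This is the source of the factor `z^s/s` in the estimates on slices. -/
theorem sq_lintegral_Ioo_le {a w : ℝ} (ha : 0 < a) (hw : 0 < w) {h : ℝ → ℝ≥0∞}
    (hh : AEMeasurable h (volume.restrict (Ioo 0 w))) :
    (∫⁻ τ in Ioo 0 w, h τ) ^ 2 ≤
      ENNReal.ofReal (w ^ a / a) * ∫⁻ τ in Ioo 0 w, ENNReal.ofReal (τ ^ (1 - a)) * h τ ^ 2 := by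
  have hp : ∀ {τ : ℝ}, τ ∈ Ioo 0 w → ∀ r : ℝ, 0 < τ ^ r := fun hτ r =>
    Real.rpow_pos_of_pos hτ.1 r
  have h1 := sq_lintegral_weight_mul_le (μ := volume.restrict (Ioo 0 w))
    (f := fun τ => ENNReal.ofReal (τ ^ (a - 1))) (g := fun τ => ENNReal.ofReal (τ ^ (1 - a)) * h τ)
    (by fun_prop) ((by fun_prop : AEMeasurable _ _).mul hh)
  rw [lintegral_Ioo_rpow ha hw] at h1
  have e : ∀ τ ∈ Ioo 0 w, ENNReal.ofReal (τ ^ (a - 1)) * ENNReal.ofReal (τ ^ (1 - a)) = 1 := by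
    intro τ hτ
    rw [← ENNReal.ofReal_mul (hp hτ _).le, ← Real.rpow_add hτ.1]
    simp
  convert h1 using 2
  · refine setLIntegral_congr_fun measurableSet_Ioo fun τ hτ => ?_
    rw [← mul_assoc, e τ hτ, one_mul]
  · refine setLIntegral_congr_fun measurableSet_Ioo fun τ hτ => ?_
    rw [mul_pow, sq (ENNReal.ofReal (τ ^ (1 - a))), mul_assoc (ENNReal.ofReal (τ ^ (1 - a))),
      ← mul_assoc, e τ hτ, one_mul]

/-- A weighted Hardy inequality. -/
theorem lintegral_hardy {s : ℝ} (hs : 0 < s) {h : ℝ → ℝ≥0∞} (hh : Measurable h) :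
    ∫⁻ w in Ioi 0, ENNReal.ofReal (w ^ (-1 - s)) * (∫⁻ τ in Ioo 0 w, h τ) ^ 2 ≤
      ENNReal.ofReal (4 / s ^ 2) * ∫⁻ τ in Ioi 0, ENNReal.ofReal (τ ^ (1 - s)) * h τ ^ 2 := by
  -- Cauchy–Schwarz is used with exponent `s/2` rather than `s`: with `s` the remaining kernel would
  -- be `w^(-1)`, which is not integrable at infinity. With `s/2` it is `w^(-1-s/2)`, and each of
  -- the two integrations contributes `2/s`, hence `4/s²`.
  have hs2 : 0 < s / 2 := by positivity
  set k : ℝ → ℝ≥0∞ := fun τ => ENNReal.ofReal (τ ^ (1 - s / 2)) * h τ ^ 2 with hk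
  have hkm : Measurable k := by fun_prop
  let S : Set (ℝ × ℝ) := {q | 0 < q.2 ∧ q.2 < q.1}
  have hS : MeasurableSet S :=
    (measurableSet_lt measurable_const measurable_snd).inter
      (measurableSet_lt measurable_snd measurable_fst)
  calc ∫⁻ w in Ioi 0, ENNReal.ofReal (w ^ (-1 - s)) * (∫⁻ τ in Ioo 0 w, h τ) ^ 2
      ≤ ∫⁻ w in Ioi 0, ENNReal.ofReal (2 / s * w ^ (-1 - s / 2)) * ∫⁻ τ in Ioo 0 w, k τ := by
        refine setLIntegral_mono' measurableSet_Ioi fun w hw => ?_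
        refine (mul_le_mul_right (sq_lintegral_Ioo_le hs2 hw hh.aemeasurable) _).trans_eq ?_
        rw [← mul_assoc, ← ENNReal.ofReal_mul (Real.rpow_nonneg (le_of_lt hw) _)]
        congr 2
        rw [show -1 - s / 2 = (-1 - s) + s / 2 by ring, Real.rpow_add hw]
        field_simp
    _ = ∫⁻ w in Ioi 0, ∫⁻ τ in Ioi 0, S.indicator
          (fun q => ENNReal.ofReal (2 / s * q.1 ^ (-1 - s / 2)) * k q.2) (w, τ) := by
        refine setLIntegral_congr_fun measurableSet_Ioi fun w hw => ?_
        rw [← lintegral_const_mul _ hkm, ← lintegral_indicator measurableSet_Ioo,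
          ← lintegral_indicator measurableSet_Ioi]
        refine lintegral_congr fun τ => ?_
        by_cases h1 : 0 < τ <;> by_cases h2 : τ < w <;> simp [indicator, S, h1, h2]
    _ = ∫⁻ τ in Ioi 0, ∫⁻ w in Ioi 0, S.indicator
          (fun q => ENNReal.ofReal (2 / s * q.1 ^ (-1 - s / 2)) * k q.2) (w, τ) := by
        rw [lintegral_lintegral_swap]
        exact (Measurable.indicator (by fun_prop) hS).aemeasurable
    _ = ∫⁻ τ in Ioi 0, ENNReal.ofReal (4 / s ^ 2) * (ENNReal.ofReal (τ ^ (1 - s)) * h τ ^ 2) := by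
        refine setLIntegral_congr_fun measurableSet_Ioi fun τ hτ => ?_
        have hτ0 : 0 < τ := hτ
        have e1 : ∫⁻ w in Ioi 0, S.indicator
            (fun q => ENNReal.ofReal (2 / s * q.1 ^ (-1 - s / 2)) * k q.2) (w, τ) =
            ∫⁻ w in Ioi τ, (ENNReal.ofReal (2 / s) * k τ) * ENNReal.ofReal (w ^ (-1 - s / 2)) := by
          rw [← lintegral_indicator measurableSet_Ioi, ← lintegral_indicator measurableSet_Ioi]
          refine lintegral_congr fun w => ?_
          by_cases h2 : τ < w
          · have h1 : 0 < w := hτ0.trans h2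
            simp only [indicator, S, mem_Ioi, h1, h2, hτ0, mem_ofPred_eq, and_self, if_true]
            rw [ENNReal.ofReal_mul (by positivity)]
            ring
          · by_cases h1 : 0 < w <;> simp [indicator, S, h1, h2]
        rw [e1, lintegral_const_mul _ (by fun_prop), lintegral_Ioi_rpow hs2 hτ0, hk]
        simp only []
        have e2 : ENNReal.ofReal (4 / s ^ 2) * ENNReal.ofReal (τ ^ (1 - s)) =
            ENNReal.ofReal (2 / s) * ENNReal.ofReal (τ ^ (1 - s / 2)) *
              ENNReal.ofReal (τ ^ (-(s / 2)) / (s / 2)) := by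
          rw [← ENNReal.ofReal_mul (by positivity), ← ENNReal.ofReal_mul (by positivity),
            ← ENNReal.ofReal_mul (by positivity)]
          congr 1
          rw [show 1 - s = (1 - s / 2) + -(s / 2) by ring, Real.rpow_add hτ0]
          field_simp
          ring
        rw [← mul_assoc (ENNReal.ofReal (4 / s ^ 2)), e2]
        ring
    _ = _ := by rw [lintegral_const_mul _ (by fun_prop)]

end OneDim

/-! ### Vertical primitives and their estimates -/

section Slices

variable {N : ℕ}

theorem restrict_upper_eq_prod (N : ℕ) : (volume : Measure (Space N × ℝ)).restrict (upper N) =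
    (volume : Measure (Space N)).prod (volume.restrict (Ioi 0)) := by
  have h : upper N = univ ×ˢ Ioi 0 := by ext p; simp [upper]
  rw [h, Measure.volume_eq_prod, ← Measure.prod_restrict, Measure.restrict_univ]

theorem gauss_restrict_upper_eq_prod (N : ℕ) :
    ((gauss N).prod (volume : Measure ℝ)).restrict (upper N) =
    (gauss N).prod (volume.restrict (Ioi 0)) := by
  have h : upper N = univ ×ˢ Ioi 0 := by ext p; simp [upper]
  rw [h, ← Measure.prod_restrict, Measure.restrict_univ]

theorem ae_gauss_iff {P : Space N → Prop} : (∀ᵐ x ∂gauss N, P x) ↔ ∀ᵐ x, P x :=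
  ⟨fun h => (absolutelyContinuous_gauss N).ae_le h, fun h => (gauss_absolutelyContinuous N).ae_le h⟩

theorem ae_wMeasure_iff {s : ℝ} {P : Space N × ℝ → Prop} :
    (∀ᵐ p ∂wMeasure N s, P p) ↔ ∀ᵐ p ∂volume.restrict (upper N), P p :=
  ⟨fun h => (absolutelyContinuous_wMeasure N s).ae_le h,
    fun h => (wMeasure_absolutelyContinuous N s).ae_le h⟩

/-- A property that holds almost everywhere in the upper halfspace holds almost everywhere on
almost every vertical line. -/
theorem ae_ae_vertical {P : Space N × ℝ → Prop} (h : ∀ᵐ p ∂volume.restrict (upper N), P p) :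
    ∀ᵐ x, ∀ᵐ z ∂volume.restrict (Ioi 0), P (x, z) := by
  rw [restrict_upper_eq_prod] at h
  exact Measure.ae_ae_of_ae_prod h

/-- A property that holds almost everywhere in the upper halfspace holds almost everywhere on
almost every horizontal slice. -/
theorem ae_ae_horizontal {P : Space N × ℝ → Prop} (h : ∀ᵐ p ∂volume.restrict (upper N), P p) :
    ∀ᵐ z ∂volume.restrict (Ioi (0 : ℝ)), ∀ᵐ x : Space N, P (x, z) := by
  rw [restrict_upper_eq_prod] at h
  have h2 := (Measure.measurePreserving_swap
    (μ := volume.restrict (Ioi (0 : ℝ))) (ν := (volume : Measure (Space N)))).quasiMeasurePreserving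
  exact Measure.ae_ae_of_ae_prod (h2.ae h)

theorem ae_upper_of_ae_fst {P : Space N → Prop} (h : ∀ᵐ x, P x) :
    ∀ᵐ p ∂volume.restrict (upper N), P p.1 := by
  rw [restrict_upper_eq_prod]
  exact Measure.quasiMeasurePreserving_fst.ae h

theorem lintegral_wMeasure_eq_iterated (s : ℝ) {f : Space N × ℝ → ℝ≥0∞} (hf : Measurable f) :
    ∫⁻ p, f p ∂wMeasure N s =
      ∫⁻ x, (∫⁻ z in Ioi 0, ENNReal.ofReal (z ^ (1 - s)) * f (x, z)) ∂gauss N := by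
  rw [lintegral_wMeasure_eq, gauss_restrict_upper_eq_prod, lintegral_prod]
  exact (((measurable_snd.pow_const _).ennreal_ofReal).mul hf).aemeasurable

/-- The vertical primitive of `g` that vanishes on the boundary. -/
def vertPrim (g : Space N × ℝ → ℝ) (p : Space N × ℝ) : ℝ := ∫ τ in Ioo 0 p.2, g (p.1, τ)

theorem enorm_vertPrim_le (g : Space N × ℝ → ℝ) (p : Space N × ℝ) :
    ‖vertPrim g p‖ₑ ≤ ∫⁻ τ in Ioo 0 p.2, ‖g (p.1, τ)‖ₑ := enorm_integral_le_lintegral_enorm _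

theorem vertPrim_congr {g g' : Space N × ℝ → ℝ} (h : g =ᵐ[volume.restrict (upper N)] g') :
    ∀ᵐ p ∂volume.restrict (upper N), vertPrim g p = vertPrim g' p := by
  have h1 := ae_upper_of_ae_fst (ae_ae_vertical h)
  filter_upwards [h1] with p hp
  refine integral_congr_ae ?_
  exact (Measure.restrict_mono Ioo_subset_Ioi_self le_rfl).absolutelyContinuous.ae_le hp

/-- The one-dimensional Hardy inequality on each vertical line, integrated in `x`. A measurable
representative replaces `g` first; this alters the primitive only on a null set, by Fubini. -/
theorem lintegral_vertPrim_hardy {s : ℝ} (hs : 0 < s) {g : Space N × ℝ → ℝ}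
    (hg : AEStronglyMeasurable g (wMeasure N s)) :
    ∫⁻ p, (‖vertPrim g p‖ₑ / ENNReal.ofReal p.2) ^ 2 ∂wMeasure N s ≤
      ENNReal.ofReal (4 / s ^ 2) * ∫⁻ p, ‖g p‖ₑ ^ 2 ∂wMeasure N s := by
  obtain ⟨g', hg', hae⟩ := hg
  have h1 : ∫⁻ p, ‖g p‖ₑ ^ 2 ∂wMeasure N s = ∫⁻ p, ‖g' p‖ₑ ^ 2 ∂wMeasure N s := by
    refine lintegral_congr_ae ?_
    filter_upwards [hae] with p hp using by rw [hp]
  have hgm : Measurable fun p => ‖g' p‖ₑ := hg'.enorm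
  let H : Space N × ℝ → ℝ≥0∞ := fun p => ∫⁻ τ in Ioo 0 p.2, ‖g' (p.1, τ)‖ₑ
  have hH : Measurable H := by
    have e : H = fun p => ∫⁻ τ, {q : (Space N × ℝ) × ℝ | 0 < q.2 ∧ q.2 < q.1.2}.indicator
        (fun q => ‖g' (q.1.1, q.2)‖ₑ) (p, τ) := by
      ext p
      simp only [H]
      rw [← lintegral_indicator measurableSet_Ioo]
      refine lintegral_congr fun τ => ?_
      simp [indicator]
    rw [e]
    refine Measurable.lintegral_prod_right' (Measurable.indicator (by fun_prop) ?_)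
    exact (measurableSet_lt measurable_const measurable_snd).inter
      (measurableSet_lt measurable_snd (measurable_snd.comp measurable_fst))
  calc ∫⁻ p, (‖vertPrim g p‖ₑ / ENNReal.ofReal p.2) ^ 2 ∂wMeasure N s
      ≤ ∫⁻ p, (H p / ENNReal.ofReal p.2) ^ 2 ∂wMeasure N s := by
        refine lintegral_mono_ae ?_
        have := vertPrim_congr (ae_wMeasure_iff.1 hae)
        filter_upwards [ae_wMeasure_iff.2 this] with p hp
        rw [hp]
        gcongr
        exact enorm_vertPrim_le _ _
    _ = ∫⁻ x, (∫⁻ z in Ioi 0, ENNReal.ofReal (z ^ (1 - s)) *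
          (H (x, z) / ENNReal.ofReal z) ^ 2) ∂gauss N := lintegral_wMeasure_eq_iterated s (by fun_prop)
    _ ≤ ∫⁻ x, ENNReal.ofReal (4 / s ^ 2) *
          (∫⁻ z in Ioi 0, ENNReal.ofReal (z ^ (1 - s)) * ‖g' (x, z)‖ₑ ^ 2) ∂gauss N := by
        refine lintegral_mono fun x => ?_
        refine le_trans (le_of_eq ?_) (lintegral_hardy hs (h := fun τ => ‖g' (x, τ)‖ₑ)
          (by fun_prop))
        refine setLIntegral_congr_fun measurableSet_Ioi fun z hz => ?_
        have hz0 : 0 < z := hz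
        simp only [H]
        rw [div_eq_mul_inv, mul_pow, mul_comm (_ ^ 2), ← mul_assoc]
        congr 1
        rw [← ENNReal.ofReal_inv_of_pos hz0, ← ENNReal.ofReal_pow (by positivity),
          ← ENNReal.ofReal_mul (by positivity), ← Real.rpow_natCast, ← Real.rpow_neg_one,
          ← Real.rpow_mul hz0.le, ← Real.rpow_add hz0]
        congr 2
        push_cast
        ring
    _ = _ := by
        rw [lintegral_const_mul, h1, lintegral_wMeasure_eq_iterated s (by fun_prop)]
        exact Measurable.lintegral_prod_right' (f := fun q : Space N × ℝ =>
          ENNReal.ofReal (q.2 ^ (1 - s)) * ‖g' q‖ₑ ^ 2) (by fun_prop)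

/-- Integrates `sq_lintegral_Ioo_le` over the vertical lines. In contrast to the Hardy bound, it
holds at each individual height and is small for small `z`. -/
theorem lintegral_vertPrim_slice {s : ℝ} (hs : 0 < s) {g : Space N × ℝ → ℝ}
    (hg : AEStronglyMeasurable g (wMeasure N s)) {z : ℝ} (hz : 0 < z) :
    ∫⁻ x, ‖vertPrim g (x, z)‖ₑ ^ 2 ∂gauss N ≤
      ENNReal.ofReal (z ^ s / s) * ∫⁻ p, ‖g p‖ₑ ^ 2 ∂wMeasure N s := by
  obtain ⟨g', hg', hae⟩ := hg
  have h1 : ∫⁻ p, ‖g p‖ₑ ^ 2 ∂wMeasure N s = ∫⁻ p, ‖g' p‖ₑ ^ 2 ∂wMeasure N s := by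
    refine lintegral_congr_ae ?_
    filter_upwards [hae] with p hp using by rw [hp]
  have hgm : Measurable fun p => ‖g' p‖ₑ := hg'.enorm
  calc ∫⁻ x, ‖vertPrim g (x, z)‖ₑ ^ 2 ∂gauss N
      ≤ ∫⁻ x, (∫⁻ τ in Ioo 0 z, ‖g' (x, τ)‖ₑ) ^ 2 ∂gauss N := by
        refine lintegral_mono_ae ?_
        filter_upwards [ae_gauss_iff.2 (ae_ae_vertical (ae_wMeasure_iff.1 hae))] with x hx
        gcongr
        refine (enorm_vertPrim_le _ _).trans_eq (lintegral_congr_ae ?_)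
        filter_upwards [(Measure.restrict_mono Ioo_subset_Ioi_self
          le_rfl).absolutelyContinuous.ae_le hx] with τ hτ using by rw [hτ]
    _ ≤ ∫⁻ x, ENNReal.ofReal (z ^ s / s) *
          (∫⁻ τ in Ioi 0, ENNReal.ofReal (τ ^ (1 - s)) * ‖g' (x, τ)‖ₑ ^ 2) ∂gauss N := by
        refine lintegral_mono fun x => ?_
        refine (sq_lintegral_Ioo_le hs hz (h := fun τ => ‖g' (x, τ)‖ₑ)
          (by fun_prop)).trans ?_
        gcongr
        exact Ioo_subset_Ioi_self
    _ = _ := by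
        rw [lintegral_const_mul, h1, lintegral_wMeasure_eq_iterated s (by fun_prop)]
        exact Measurable.lintegral_prod_right' (f := fun q : Space N × ℝ =>
          ENNReal.ofReal (q.2 ^ (1 - s)) * ‖g' q‖ₑ ^ 2) (by fun_prop)

end Slices
end FracGauss
end

noncomputable section
namespace FracGauss

open scoped Convolution

/-! ### Vertical primitives of test functions -/

section UpPrim

/-- The vertical primitive of `ψ` that vanishes far away from the boundary. -/
def upPrim {X : Type*} (ψ : X × ℝ → ℝ) (p : X × ℝ) : ℝ := ∫ τ in Ioi p.2, ψ (p.1, τ)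

variable {X : Type*} [NormedAddCommGroup X] {ψ : X × ℝ → ℝ} {R : ℝ}

theorem integrable_vertical (hψ : Continuous ψ) (hR : ∀ p, R < ‖p‖ → ψ p = 0) (x : X) :
    Integrable (fun τ => ψ (x, τ)) := by
  refine Continuous.integrable_of_hasCompactSupport (by fun_prop) ?_
  refine HasCompactSupport.of_support_subset_isCompact (isCompact_Icc (a := -R) (b := R)) ?_
  intro τ hτ
  by_contra hcon
  apply hτ
  apply hR
  rw [mem_Icc, ← abs_le, not_le] at hcon
  exact hcon.trans_le (norm_snd_le (x, τ))

/-- Writing the primitive as a convolution in the vertical variable with the indicator of the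
negative half-line gives its joint smoothness in `(x, z)` from the theory of convolutions with
parameters. -/
theorem upPrim_eq_convolution {X : Type*} (ψ : X × ℝ → ℝ) (p : X × ℝ) :
    upPrim ψ p = ((Iio (0 : ℝ)).indicator (fun _ => (1 : ℝ))
      ⋆[ContinuousLinearMap.lsmul ℝ ℝ, volume] fun τ => ψ (p.1, τ)) p.2 := by
  rw [convolution_eq_swap, upPrim, ← integral_indicator measurableSet_Ioi]
  refine integral_congr_ae (Eventually.of_forall fun τ => ?_)
  by_cases h : p.2 < τ <;> simp [indicator, h]

theorem contDiff_upPrim [NormedSpace ℝ X] (hψ : ContDiff ℝ (⊤ : ℕ∞) ψ) (hR : ∀ p, R < ‖p‖ → ψ p = 0) :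
    ContDiff ℝ (⊤ : ℕ∞) (upPrim ψ) := by
  have h := contDiffOn_convolution_right_with_param (𝕜 := ℝ) (n := ⊤)
    (ContinuousLinearMap.lsmul ℝ ℝ : ℝ →L[ℝ] ℝ →L[ℝ] ℝ) (μ := (volume : Measure ℝ))
    (f := (Iio (0 : ℝ)).indicator (fun _ => (1 : ℝ))) (g := fun (x : X) τ => ψ (x, τ))
    (s := univ) (k := Icc (-R) R) isOpen_univ isCompact_Icc
    (fun x τ _ hτ => hR _ (by
      rw [mem_Icc, ← abs_le, not_le] at hτ
      exact hτ.trans_le (norm_snd_le (x, τ))))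
    ((locallyIntegrable_const (1 : ℝ)).indicator measurableSet_Iio) (by exact hψ.contDiffOn)
  rw [univ_prod_univ, contDiffOn_univ] at h
  have e : upPrim ψ = fun q : X × ℝ => ((Iio (0 : ℝ)).indicator (fun _ => (1 : ℝ))
      ⋆[ContinuousLinearMap.lsmul ℝ ℝ, volume] fun τ => ψ (q.1, τ)) q.2 :=
    funext (upPrim_eq_convolution ψ)
  rw [e]
  exact h

theorem fderiv_upPrim [NormedSpace ℝ X] (hψ : ContDiff ℝ (⊤ : ℕ∞) ψ)
    (hR : ∀ p, R < ‖p‖ → ψ p = 0) (p : X × ℝ) :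
    fderiv ℝ (upPrim ψ) p (0, 1) = - ψ p := by
  have h1 := ((contDiff_upPrim hψ hR).differentiable (by norm_num) p).hasFDerivAt
  have h2 : HasDerivAt (fun τ : ℝ => (p.1, τ)) ((0 : X), (1 : ℝ)) p.2 :=
    (hasDerivAt_const p.2 p.1).prodMk (hasDerivAt_id p.2)
  have h3 : HasDerivAt (fun τ => upPrim ψ (p.1, τ)) (fderiv ℝ (upPrim ψ) p (0, 1)) p.2 :=
    (show HasFDerivAt (upPrim ψ) _ (p.1, p.2) from h1).comp_hasDerivAt p.2 h2
  have hi := integrable_vertical hψ.continuous hR p.1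
  have h4 : HasDerivAt (fun τ => upPrim ψ (p.1, 0) - ∫ t in (0 : ℝ)..τ, ψ (p.1, t)) (- ψ p) p.2 := by
    have hc : Continuous fun t => ψ (p.1, t) := hψ.continuous.comp (by fun_prop)
    exact (intervalIntegral.integral_hasDerivAt_right (hc.intervalIntegrable _ _)
      hc.stronglyMeasurable.stronglyMeasurableAtFilter hc.continuousAt).const_sub _
  have e : (fun τ => upPrim ψ (p.1, τ)) =
      fun τ => upPrim ψ (p.1, 0) - ∫ t in (0 : ℝ)..τ, ψ (p.1, t) := by
    ext τ
    rw [← intervalIntegral.integral_Ioi_sub_Ioi' hi.integrableOn hi.integrableOn]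
    simp [upPrim]
  rw [e] at h3
  exact h3.unique h4

theorem upPrim_eq_zero_of_lt_norm_fst (hR : ∀ p, R < ‖p‖ → ψ p = 0) {p : X × ℝ} (h : R < ‖p.1‖) :
    upPrim ψ p = 0 := by
  refine setIntegral_eq_zero_of_forall_eq_zero fun τ _ => hR _ ?_
  exact h.trans_le (norm_fst_le (p.1, τ))

theorem upPrim_eq_zero_of_le_snd (hR : ∀ p, R < ‖p‖ → ψ p = 0) {p : X × ℝ} (h : R ≤ p.2) :
    upPrim ψ p = 0 := by
  refine setIntegral_eq_zero_of_forall_eq_zero fun τ hτ => hR _ ?_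
  exact (lt_of_le_of_lt h hτ).trans_le ((le_abs_self τ).trans (norm_snd_le (p.1, τ)))

/-- Fubini on the triangle `0 < w < τ`. The function `a` is integrable only on bounded intervals, so
the product is truncated at `R`, beyond which `b` vanishes. -/
theorem integral_mul_integral_Ioi {a b : ℝ → ℝ} {R : ℝ} (ha : IntegrableOn a (Ioo 0 R))
    (hb : Integrable b) (hbR : ∀ τ, R < τ → b τ = 0) :
    ∫ w in Ioi 0, a w * ∫ τ in Ioi w, b τ = ∫ τ in Ioi 0, b τ * ∫ w in Ioo 0 τ, a w := by
  let S : Set (ℝ × ℝ) := {q | 0 < q.1 ∧ q.1 < q.2}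
  have hS : MeasurableSet S :=
    (measurableSet_lt measurable_const measurable_fst).inter
      (measurableSet_lt measurable_fst measurable_snd)
  have hint : Integrable (S.indicator fun q : ℝ × ℝ => a q.1 * b q.2)
      (volume.prod volume) := by
    have h1 : Integrable (fun q : ℝ × ℝ => (Ioo 0 R).indicator a q.1 * (Iio R).indicator b q.2)
        (volume.prod volume) :=
      Integrable.mul_prod ((integrable_indicator_iff measurableSet_Ioo).2 ha)
        (hb.indicator measurableSet_Iio)
    refine (h1.indicator hS).congr ?_
    -- The strict truncation `Iio R` loses the line `τ = R`, where nothing forces `b` to vanish; the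
    -- line is null.
    have hne : ∀ᵐ q : ℝ × ℝ ∂(volume.prod volume), q.2 ≠ R :=
      Measure.quasiMeasurePreserving_snd.ae (Measure.ae_ne volume R)
    filter_upwards [hne] with q hq
    by_cases hqS : q ∈ S
    · rw [indicator_of_mem hqS, indicator_of_mem hqS]
      obtain ⟨h2, h3⟩ := hqS
      rcases lt_trichotomy q.2 R with h4 | h4 | h4
      · simp [indicator, h2, h4, h3.trans h4]
      · exact absurd h4 hq
      · simp [indicator, h4.not_gt, hbR _ h4]
    · rw [indicator_of_notMem hqS, indicator_of_notMem hqS]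
  have hswap := integral_integral_swap (f := fun w τ => S.indicator (fun q => a q.1 * b q.2) (w, τ))
    hint
  convert hswap using 1
  · rw [← integral_indicator measurableSet_Ioi]
    refine integral_congr_ae (Eventually.of_forall fun w => ?_)
    by_cases hw : 0 < w
    · simp only [indicator, mem_Ioi, hw, if_true]
      rw [← integral_const_mul, ← integral_indicator measurableSet_Ioi]
      refine integral_congr_ae (Eventually.of_forall fun τ => ?_)
      simp [indicator, S, hw]
    · simp [indicator, S, hw]
  · rw [← integral_indicator measurableSet_Ioi]
    refine integral_congr_ae (Eventually.of_forall fun τ => ?_)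
    by_cases hτ : 0 < τ
    · simp only [indicator, mem_Ioi, hτ, if_true]
      rw [← integral_const_mul, ← integral_indicator measurableSet_Ioo]
      refine integral_congr_ae (Eventually.of_forall fun w => ?_)
      simp [indicator, S, mul_comm]
    · have : ∀ w, (w, τ) ∉ S := fun w hw => hτ (hw.1.trans hw.2)
      simp [indicator, this, hτ]

end UpPrim

/-! ### Zero trace: the function is the primitive of its vertical derivative -/

section Vertical

variable {N : ℕ}

/-- Countably many compact sets, the supports of the cutoffs, exhaust the open halfspace. -/
theorem aestronglyMeasurable_upper {F : Type*} [NormedAddCommGroup F] {v : Space N × ℝ → F}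
    (hv : ∀ K ⊆ upper N, IsCompact K → MemLp v 2 (volume.restrict K)) :
    AEStronglyMeasurable v (volume.restrict (upper N)) := by
  have h : upper N = ⋃ n : ℕ, tsupport (cutoff N n) := by
    refine Subset.antisymm (fun p hp => ?_) (iUnion_subset fun n => (isTest_cutoff n).support)
    obtain ⟨n, hn⟩ := (eventually_cutoff_eventuallyEq_one (K := {p}) isCompact_singleton
      (singleton_subset_iff.2 hp)).exists
    refine mem_iUnion.2 ⟨n, subset_tsupport _ ?_⟩
    rw [Function.mem_support, (hn p rfl).eq_of_nhds]
    norm_num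
  rw [h, aestronglyMeasurable_iUnion_iff]
  exact fun n => (hv _ (isTest_cutoff n).support (isTest_cutoff n).compact).1

/-- Integrability holds up to the boundary, where the weight may vanish. With `a` the weight and `b
= ‖g‖`, one has `b ≤ a b² + 1/a`; the first term is the energy, and `1/a` is integrable on the
cylinder because `z^(s-1)` is integrable at zero. -/
theorem integrableOn_cylinder {s : ℝ} (hs : 0 < s) {g : Space N × ℝ → ℝ}
    (hg : MemLp g 2 (wMeasure N s)) (R : ℝ) :
    IntegrableOn g (Metric.closedBall 0 R ×ˢ Ioo 0 R) volume := by
  set Q : Set (Space N × ℝ) := Metric.closedBall 0 R ×ˢ Ioo 0 R with hQ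
  have hQm : MeasurableSet Q := Metric.isClosed_closedBall.measurableSet.prod measurableSet_Ioo
  have hQu : Q ⊆ upper N := fun p hp => hp.2.1
  have hm : AEStronglyMeasurable g (volume.restrict (upper N)) :=
    hg.1.mono_ac (absolutelyContinuous_wMeasure N s)
  refine ⟨hm.mono_measure (Measure.restrict_mono hQu le_rfl), ?_⟩
  have hpt : ∀ p ∈ Q, ‖g p‖ₑ ≤ ENNReal.ofReal (wDensity s p) * ‖g p‖ₑ ^ 2 +
      ENNReal.ofReal ((gaussDensity p.1)⁻¹) * ENNReal.ofReal (p.2 ^ (s - 1)) := by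
    intro p hp
    have hw := wDensity_pos (s := s) (hQu hp)
    have hp2 : 0 < p.2 := hp.2.1
    have hinv : (gaussDensity p.1)⁻¹ * p.2 ^ (s - 1) = (wDensity s p)⁻¹ := by
      rw [wDensity, mul_inv, ← Real.rpow_neg hp2.le, neg_sub]
    rw [← ENNReal.ofReal_mul (inv_nonneg.2 (gaussDensity_pos _).le), hinv,
      ← ofReal_norm, ← ENNReal.ofReal_pow (norm_nonneg _), ← ENNReal.ofReal_mul hw.le,
      ← ENNReal.ofReal_add (by positivity) (by positivity)]
    refine ENNReal.ofReal_le_ofReal ?_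
    set b := ‖g p‖
    set a := wDensity s p
    have h1 : b = a * b * a⁻¹ := by field_simp
    -- Completing the square in `a b`: `(ab)² - ab + 1 = (ab - 1/2)² + 3/4`.
    have h2 : a * b ^ 2 + a⁻¹ - b = ((a * b - 1 / 2) ^ 2 + 3 / 4) * a⁻¹ := by field_simp; ring
    have h3 : 0 ≤ ((a * b - 1 / 2) ^ 2 + 3 / 4) * a⁻¹ := by positivity
    linarith
  refine lt_of_le_of_lt (setLIntegral_mono' hQm hpt) ?_
  have hmeas : Measurable fun p : Space N × ℝ =>
      ENNReal.ofReal ((gaussDensity p.1)⁻¹) * ENNReal.ofReal (p.2 ^ (s - 1)) :=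
    ((continuous_gaussDensity.measurable.comp measurable_fst).inv.ennreal_ofReal).mul
      (measurable_snd.pow_const _).ennreal_ofReal
  rw [lintegral_add_right _ hmeas]
  refine ENNReal.add_lt_top.2 ⟨?_, ?_⟩
  · refine (lintegral_mono_set hQu).trans_lt ?_
    rw [← lintegral_wMeasure]
    exact (memLp_two_iff_lintegral.1 hg).2
  · rw [hQ, Measure.volume_eq_prod, ← Measure.prod_restrict,
      lintegral_prod_mul (f := fun x : Space N => ENNReal.ofReal ((gaussDensity x)⁻¹))
        (g := fun z : ℝ => ENNReal.ofReal (z ^ (s - 1)))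
        (continuous_gaussDensity.measurable.inv.ennreal_ofReal.aemeasurable)
        (by fun_prop)]
    refine ENNReal.mul_lt_top ?_ ?_
    · have hc : ContinuousOn (fun x : Space N => (gaussDensity x)⁻¹) (Metric.closedBall 0 R) :=
        (continuous_gaussDensity.inv₀ fun x => (gaussDensity_pos x).ne').continuousOn
      have := (hc.integrableOn_compact (isCompact_closedBall (0 : Space N) R) (μ := volume)).2
      refine lt_of_le_of_lt (lintegral_mono fun x => ?_) this
      rw [Real.enorm_eq_ofReal (inv_nonneg.2 (gaussDensity_pos _).le)]
    · rcases le_or_gt R 0 with h | h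
      · simp [Ioo_eq_empty (not_lt.2 h)]
      · rw [lintegral_Ioo_rpow hs h]
        exact ENNReal.ofReal_lt_top

theorem stronglyMeasurable_vertPrim {g : Space N × ℝ → ℝ} (hg : StronglyMeasurable g) :
    StronglyMeasurable (vertPrim g) := by
  have e : vertPrim g = fun p => ∫ τ, {q : (Space N × ℝ) × ℝ | 0 < q.2 ∧ q.2 < q.1.2}.indicator
      (fun q => g (q.1.1, q.2)) (p, τ) := by
    ext p
    rw [vertPrim, ← integral_indicator measurableSet_Ioo]
    refine integral_congr_ae (Eventually.of_forall fun τ => ?_)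
    simp [indicator]
  rw [e]
  refine StronglyMeasurable.integral_prod_right' (StronglyMeasurable.indicator ?_ ?_)
  · exact hg.comp_measurable (by fun_prop)
  · exact (measurableSet_lt measurable_const measurable_snd).inter
      (measurableSet_lt measurable_snd (measurable_snd.comp measurable_fst))

/-- On the cylinder the primitive is dominated by the full vertical integral of `|g|` up to `R`,
which is integrable in `x` by Fubini. -/
theorem integrableOn_vertPrim {s : ℝ} (hs : 0 < s) {g : Space N × ℝ → ℝ}
    (hg : MemLp g 2 (wMeasure N s)) (hgm : StronglyMeasurable g) (R : ℝ) :
    IntegrableOn (vertPrim g) (Metric.closedBall 0 R ×ˢ Ioo 0 R) volume := by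
  have hi := integrableOn_cylinder hs hg R
  rw [IntegrableOn, Measure.volume_eq_prod, ← Measure.prod_restrict] at hi ⊢
  have h1 : Integrable (fun x => ∫ τ in Ioo 0 R, ‖g (x, τ)‖)
      (volume.restrict (Metric.closedBall (0 : Space N) R)) := hi.integral_norm_prod_left
  have h2 : Integrable (fun p : Space N × ℝ => ∫ τ in Ioo 0 R, ‖g (p.1, τ)‖)
      ((volume.restrict (Metric.closedBall (0 : Space N) R)).prod (volume.restrict (Ioo 0 R))) :=
    h1.comp_fst _
  refine h2.mono' (stronglyMeasurable_vertPrim hgm).aestronglyMeasurable ?_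
  have h3 := Measure.quasiMeasurePreserving_fst
    (ν := volume.restrict (Ioo (0 : ℝ) R)) |>.ae hi.prod_right_ae
  have h4 : ∀ᵐ p ∂((volume.restrict (Metric.closedBall (0 : Space N) R)).prod
      (volume.restrict (Ioo 0 R))), p.2 ∈ Ioo 0 R :=
    Measure.quasiMeasurePreserving_snd.ae (ae_restrict_mem measurableSet_Ioo)
  filter_upwards [h3, h4] with p hp hp2
  refine (norm_integral_le_integral_norm _).trans ?_
  exact setIntegral_mono_set hp.norm (Eventually.of_forall fun _ => norm_nonneg _)
    (Ioo_subset_Ioo_right hp2.2.le).eventuallyLE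

theorem exists_cylinder {K : Set (Space N × ℝ)} (hK : IsCompact K) (hKu : K ⊆ upper N) :
    ∃ R : ℝ, 0 < R ∧ K ⊆ Metric.closedBall 0 R ×ˢ Ioo 0 R ∧ ∀ p ∈ K, ‖p‖ ≤ R := by
  obtain ⟨R, hR⟩ := hK.isBounded.exists_norm_le
  have h : ∀ p ∈ K, ‖p‖ < |R| + 1 := fun p hp =>
    (hR p hp).trans_lt ((le_abs_self R).trans_lt (lt_add_one _))
  refine ⟨|R| + 1, by positivity, fun p hp => ⟨?_, hKu hp, ?_⟩, fun p hp => (h p hp).le⟩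
  · rw [mem_closedBall_zero_iff]
    exact (norm_fst_le p).trans (h p hp).le
  · exact (le_abs_self _).trans_lt ((norm_snd_le p).trans_lt (h p hp))

end Vertical
end FracGauss
end

noncomputable section
namespace FracGauss

section Vertical

variable {N : ℕ}

/-- A vertical cutoff at scale `1/(n + 1)` has derivative of order `n + 1` on a layer of thickness
`δ = 3/(n + 1)`. By Cauchy–Schwarz the `L¹` norm of `v` on the layer is at most of order `(δ ∫
|v|²)^(1/2)`, and zero trace says that `∫ |v|²` is `o(δ)`. So the `L¹` norm is `o(δ)`, which beats
the factor `n + 1`. The Gaussian density is bounded below on the ball, so Lebesgue and Gaussian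
integrals are comparable there. -/
theorem tendsto_boundary_term {v : Space N × ℝ → ℝ} (hvm : AEStronglyMeasurable v
      (volume.restrict (upper N))) (htr : HasTrace v (fun _ => 0)) (R C : ℝ) :
    Tendsto (fun n : ℕ => ENNReal.ofReal (C * (n + 1)) *
      ∫⁻ p in Metric.closedBall 0 R ×ˢ Ioo 0 (3 / ((n : ℝ) + 1)), ‖v p‖ₑ) atTop (𝓝 0) := by
  obtain ⟨c, hc, hcB⟩ : ∃ c : ℝ, 0 < c ∧ ∀ x ∈ Metric.closedBall (0 : Space N) R,
      c ≤ gaussDensity x := by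
    rcases (Metric.closedBall (0 : Space N) R).eq_empty_or_nonempty with h | hne
    · exact ⟨1, one_pos, by simp [h]⟩
    · obtain ⟨q, _, hmin⟩ := (isCompact_closedBall (0 : Space N) R).exists_isMinOn hne
        continuous_gaussDensity.continuousOn
      exact ⟨_, gaussDensity_pos q, fun p hp => hmin hp⟩
  set B := Metric.closedBall (0 : Space N) R with hB
  have hBm : MeasurableSet B := Metric.isClosed_closedBall.measurableSet
  let δ : ℕ → ℝ := fun n => 3 / ((n : ℝ) + 1)
  have hδ : ∀ n, 0 < δ n := fun n => by positivity
  have hδ0 : Tendsto δ atTop (𝓝[>] 0) := by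
    refine tendsto_nhdsWithin_iff.2 ⟨?_, Eventually.of_forall hδ⟩
    have := (tendsto_one_div_add_atTop_nhds_zero_nat (𝕜 := ℝ)).const_mul 3
    simpa only [δ, mul_one_div, mul_zero] using this
  let I : ℝ → ℝ≥0∞ := fun δ => ∫⁻ p in univ ×ˢ Ioo 0 δ, ‖v p‖ₑ ^ 2 ∂((gauss N).prod volume)
  have hI : Tendsto (fun n => I (δ n) / ENNReal.ofReal (δ n)) atTop (𝓝 0) := by
    have := htr.comp hδ0
    simpa [I, Function.comp_def] using this
  set A : ℝ≥0∞ := ENNReal.ofReal (3 * C) ^ 2 * (volume B * ENNReal.ofReal c⁻¹) with hA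
  have hAtop : A ≠ ∞ := ENNReal.mul_ne_top (ENNReal.pow_ne_top ENNReal.ofReal_ne_top)
    (ENNReal.mul_ne_top (isCompact_closedBall _ _).measure_lt_top.ne ENNReal.ofReal_ne_top)
  have hsq : ∀ n : ℕ, (ENNReal.ofReal (C * (n + 1)) *
      ∫⁻ p in B ×ˢ Ioo 0 (δ n), ‖v p‖ₑ) ^ 2 ≤ A * (I (δ n) / ENNReal.ofReal (δ n)) := by
    intro n
    have hQm : MeasurableSet (B ×ˢ Ioo 0 (δ n)) := hBm.prod measurableSet_Ioo
    have hQu : B ×ˢ Ioo 0 (δ n) ⊆ upper N := fun p hp => hp.2.1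
    have h1 : (∫⁻ p in B ×ˢ Ioo 0 (δ n), ‖v p‖ₑ) ^ 2 ≤
        (volume B * ENNReal.ofReal (δ n)) * ∫⁻ p in B ×ˢ Ioo 0 (δ n), ‖v p‖ₑ ^ 2 := by
      have := sq_lintegral_weight_mul_le (μ := volume.restrict (B ×ˢ Ioo 0 (δ n)))
        (f := fun _ => 1) (g := fun p => ‖v p‖ₑ) aemeasurable_const
        (hvm.mono_measure (Measure.restrict_mono hQu le_rfl)).enorm
      simpa [Measure.volume_eq_prod, Measure.prod_prod] using this
    have h2 : ∫⁻ p in B ×ˢ Ioo 0 (δ n), ‖v p‖ₑ ^ 2 ≤ ENNReal.ofReal c⁻¹ * I (δ n) := by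
      simp only [I]
      rw [lintegral_gauss_prod _ (MeasurableSet.univ.prod measurableSet_Ioo),
        ← lintegral_const_mul' _ _ ENNReal.ofReal_ne_top]
      refine le_trans ?_ (lintegral_mono_set (s := B ×ˢ Ioo 0 (δ n))
        (prod_mono (subset_univ _) le_rfl))
      refine setLIntegral_mono' hQm fun p hp => ?_
      rw [← mul_assoc, ← ENNReal.ofReal_mul (by positivity)]
      refine le_mul_of_one_le_left zero_le ?_
      rw [ENNReal.one_le_ofReal, inv_mul_eq_div, one_le_div hc]
      exact hcB _ hp.1
    have h3 : ENNReal.ofReal (C * (n + 1)) = ENNReal.ofReal (3 * C) / ENNReal.ofReal (δ n) := by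
      rw [← ENNReal.ofReal_div_of_pos (hδ n)]
      congr 1
      simp only [δ]
      field_simp
    have hd0 : ENNReal.ofReal (δ n) ≠ 0 := by simpa using hδ n
    calc (ENNReal.ofReal (C * (n + 1)) * ∫⁻ p in B ×ˢ Ioo 0 (δ n), ‖v p‖ₑ) ^ 2
        ≤ (ENNReal.ofReal (3 * C) / ENNReal.ofReal (δ n)) ^ 2 *
          ((volume B * ENNReal.ofReal (δ n)) * (ENNReal.ofReal c⁻¹ * I (δ n))) := by
          rw [mul_pow, h3]
          gcongr
          exact h1.trans (by gcongr)
      _ = A * (I (δ n) / ENNReal.ofReal (δ n)) * (ENNReal.ofReal (δ n) * (ENNReal.ofReal (δ n))⁻¹) := by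
          rw [hA, div_eq_mul_inv, div_eq_mul_inv]; ring
      _ = _ := by rw [ENNReal.mul_inv_cancel hd0 ENNReal.ofReal_ne_top, mul_one]
  have hlim : Tendsto (fun n => (A * (I (δ n) / ENNReal.ofReal (δ n))) ^ (1 / 2 : ℝ))
      atTop (𝓝 0) := by
    have h1 := ENNReal.Tendsto.const_mul (a := A) hI (Or.inr hAtop)
    rw [mul_zero] at h1
    have := (ENNReal.continuous_rpow_const (y := (1 / 2 : ℝ))).tendsto 0 |>.comp h1
    simpa [Function.comp_def] using this
  refine tendsto_of_tendsto_of_tendsto_of_le_of_le tendsto_const_nhds hlim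
    (fun _ => zero_le) fun n => ?_
  refine le_trans (le_of_eq ?_) (ENNReal.rpow_le_rpow (hsq n) (by norm_num : (0 : ℝ) ≤ 1 / 2))
  rw [← ENNReal.rpow_natCast, ← ENNReal.rpow_mul]
  norm_num [δ]

/-- `upPrim` and `vertPrim` are adjoint: integration upwards on one factor becomes integration from
the boundary on the other, line by line. -/
theorem integral_upPrim_mul {s : ℝ} (hs : 0 < s) {g ψ : Space N × ℝ → ℝ}
    (hg : MemLp g 2 (wMeasure N s)) (hψ : Continuous ψ) {R : ℝ}
    (hR : ∀ p, R < ‖p‖ → ψ p = 0)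
    (h1 : Integrable (fun p => g p * upPrim ψ p) (volume.restrict (upper N)))
    (h2 : Integrable (fun p => ψ p * vertPrim g p) (volume.restrict (upper N))) :
    ∫ p in upper N, g p * upPrim ψ p = ∫ p in upper N, ψ p * vertPrim g p := by
  have hi := integrableOn_cylinder hs hg R
  rw [IntegrableOn, Measure.volume_eq_prod, ← Measure.prod_restrict] at hi
  have hx := (ae_restrict_iff' Metric.isClosed_closedBall.measurableSet).1 hi.prod_right_ae
  rw [restrict_upper_eq_prod] at h1 h2 ⊢
  rw [integral_prod _ h1, integral_prod _ h2]
  refine integral_congr_ae ?_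
  filter_upwards [hx] with x hx
  by_cases hxR : x ∈ Metric.closedBall (0 : Space N) R
  · refine integral_mul_integral_Ioi (hx hxR) (integrable_vertical hψ hR x) fun τ hτ => ?_
    exact hR _ (hτ.trans_le ((le_abs_self τ).trans (norm_snd_le (x, τ))))
  · rw [mem_closedBall_zero_iff, not_le] at hxR
    have e1 : ∀ z, upPrim ψ (x, z) = 0 := fun z => upPrim_eq_zero_of_lt_norm_fst hR hxR
    have e2 : ∀ z, ψ (x, z) = 0 := fun z => hR _ (hxR.trans_le (norm_fst_le (x, z)))
    simp [e1, e2]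

/-- The antiderivative `Ψ` of `-ψ` is not supported away from the boundary, so `hw` is tested with
`Ψ` times a vertical cutoff. As the cutoff opens up, the term in which it is differentiated
disappears by the zero trace, leaving `∫ v ψ = ∫ g Ψ`, and adjointness finishes. Only the vertical
derivative of `v` is involved. -/
theorem integral_mul_eq_integral_mul_vertPrim {s : ℝ} (hs : 0 < s) {v g : Space N × ℝ → ℝ}
    (hv : ∀ K ⊆ upper N, IsCompact K → MemLp v 2 (volume.restrict K))
    (hg : MemLp g 2 (wMeasure N s)) (hgm : StronglyMeasurable g)
    (hw : ∀ η, IsTest η →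
      ∫ p in upper N, v p * fderiv ℝ η p (0, 1) = - ∫ p in upper N, g p * η p)
    (htr : HasTrace v (fun _ => 0)) {ψ : Space N × ℝ → ℝ} (hψ : IsTest ψ) :
    Integrable (fun p => ψ p * vertPrim g p) ∧
      ∫ p in upper N, ψ p * v p = ∫ p in upper N, ψ p * vertPrim g p := by
  obtain ⟨R, hR0, hRK, hRn⟩ := exists_cylinder hψ.compact hψ.support
  have hR : ∀ p, R < ‖p‖ → ψ p = 0 := fun p hp =>
    image_eq_zero_of_notMem_tsupport fun hcon => (hRn p hcon).not_gt hp
  set Q : Set (Space N × ℝ) := Metric.closedBall 0 R ×ˢ Ioo 0 R with hQ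
  have hQm : MeasurableSet Q := Metric.isClosed_closedBall.measurableSet.prod measurableSet_Ioo
  have hQu : Q ⊆ upper N := fun p hp => hp.2.1
  set Ψ := upPrim ψ with hΨ
  have hΨs : ContDiff ℝ (⊤ : ℕ∞) Ψ := contDiff_upPrim hψ.smooth hR
  have hΨ0 : ∀ p ∈ upper N, p ∉ Q → Ψ p = 0 := by
    intro p hp hpQ
    by_cases h1 : p.1 ∈ Metric.closedBall (0 : Space N) R
    · refine upPrim_eq_zero_of_le_snd hR ?_
      by_contra h2
      exact hpQ ⟨h1, hp, not_le.1 h2⟩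
    · rw [mem_closedBall_zero_iff, not_le] at h1
      exact upPrim_eq_zero_of_lt_norm_fst hR h1
  obtain ⟨CΨ, hCΨ⟩ := ((isCompact_closedBall (0 : Space N) R).prod
    (isCompact_Icc (a := (0 : ℝ)) (b := R))).exists_bound_of_continuousOn hΨs.continuous.continuousOn
  have hΨb : ∀ p ∈ upper N, |Ψ p| ≤ |CΨ| := by
    intro p hp
    by_cases hpQ : p ∈ Q
    · exact (hCΨ p ⟨hpQ.1, hpQ.2.1.le, hpQ.2.2.le⟩).trans (le_abs_self _)
    · rw [hΨ0 p hp hpQ, abs_zero]; exact abs_nonneg _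
  obtain ⟨C₁, hC₁0, hC₁⟩ := exists_abs_deriv_smoothTransition_le
  have hgQ := integrableOn_cylinder hs hg R
  have hgΨ : Integrable (fun p => g p * Ψ p) (volume.restrict (upper N)) := by
    have h1 : IntegrableOn (fun p => g p * Ψ p) Q := by
      refine Integrable.mul_bdd (c := |CΨ|) hgQ hΨs.continuous.aestronglyMeasurable ?_
      filter_upwards [ae_restrict_mem hQm] with p hp using hΨb p (hQu hp)
    exact h1.of_forall_sdiff_eq_zero (measurableSet_upper N) fun p hp => by
      rw [hΨ0 p hp.1 hp.2, mul_zero]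
  have hψV : Integrable (fun p => ψ p * vertPrim g p) := by
    have h1 : IntegrableOn (fun p => ψ p * vertPrim g p) Q := by
      obtain ⟨Cψ, hCψ⟩ := hψ.compact.exists_bound_of_continuous hψ.smooth.continuous
      exact (integrableOn_vertPrim hs hg hgm R).bdd_mul (c := Cψ)
        hψ.smooth.continuous.aestronglyMeasurable (Eventually.of_forall hCψ)
    refine h1.integrable_of_forall_notMem_eq_zero fun p hp => ?_
    rw [image_eq_zero_of_notMem_tsupport fun hcon => hp (hRK hcon), zero_mul]
  refine ⟨hψV, ?_⟩
  rw [← integral_upPrim_mul hs hg hψ.smooth.continuous hR hgΨ hψV.integrableOn]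
  -- A cutoff at the boundary alone suffices, since `Ψ` already vanishes for large `x` and for large
  -- heights.
  let S : ℕ → Space N × ℝ → ℝ := fun n p => Real.smoothTransition (((n : ℝ) + 1) * p.2 - 1)
  have hSs : ∀ n, ContDiff ℝ (⊤ : ℕ∞) (S n) := fun n =>
    Real.smoothTransition.contDiff.comp ((contDiff_const.mul contDiff_snd).sub contDiff_const)
  have hSd : ∀ n p, fderiv ℝ (S n) p (0, 1) =
      deriv Real.smoothTransition (((n : ℝ) + 1) * p.2 - 1) * ((n : ℝ) + 1) := by
    intro n p
    have hS : HasDerivAt Real.smoothTransition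
        (deriv Real.smoothTransition (((n : ℝ) + 1) * p.2 - 1)) (((n : ℝ) + 1) * p.2 - 1) :=
      ((Real.smoothTransition.contDiff (n := 1)).differentiable (by norm_num) _).hasDerivAt
    have h := hS.comp_hasFDerivAt p
      (((hasFDerivAt_snd (𝕜 := ℝ) (p := p)).const_mul ((n : ℝ) + 1)).sub_const 1)
    have h' : fderiv ℝ (S n) p = deriv Real.smoothTransition (((n : ℝ) + 1) * p.2 - 1) •
        (((n : ℝ) + 1) • ContinuousLinearMap.snd ℝ (Space N) ℝ) := h.fderiv
    rw [h']
    simp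
  have hη : ∀ n, IsTest (fun p => Ψ p * S n p) := by
    intro n
    have hn : (0 : ℝ) < n + 1 := by positivity
    have hsub : tsupport (fun p => Ψ p * S n p) ⊆
        Metric.closedBall 0 R ×ˢ Icc (1 / ((n : ℝ) + 1)) R := by
      refine closure_minimal ?_ (Metric.isClosed_closedBall.prod isClosed_Icc)
      intro p hp
      have h1 : Ψ p ≠ 0 := left_ne_zero_of_mul hp
      have h2 : S n p ≠ 0 := right_ne_zero_of_mul hp
      have h3 : 1 / ((n : ℝ) + 1) ≤ p.2 := by
        by_contra hcon
        apply h2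
        apply Real.smoothTransition.zero_of_nonpos
        rw [not_le, lt_div_iff₀ hn] at hcon
        linarith
      have h4 : p ∈ upper N := lt_of_lt_of_le (by positivity) h3
      have h5 : p ∈ Q := by
        by_contra hcon; exact h1 (hΨ0 p h4 hcon)
      exact ⟨h5.1, h3, h5.2.2.le⟩
    refine ⟨hΨs.mul (hSs n), ?_, ?_⟩
    · exact ((isCompact_closedBall (0 : Space N) R).prod isCompact_Icc).of_isClosed_subset
        (isClosed_tsupport _) hsub
    · intro p hp
      exact lt_of_lt_of_le (by positivity : (0 : ℝ) < 1 / (n + 1)) (hsub hp).2.1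
  have hSb : ∀ n p, |S n p| ≤ 1 := fun n p => by
    rw [abs_of_nonneg (Real.smoothTransition.nonneg _)]; exact Real.smoothTransition.le_one _
  have hvψ : Integrable (fun p => v p * ψ p) := hψ.integrable_mul hv
  have hvψS : ∀ n, Integrable (fun p => v p * ψ p * S n p) := fun n =>
    hvψ.mul_bdd (c := 1) (hSs n).continuous.aestronglyMeasurable (Eventually.of_forall (hSb n))
  have hderiv : ∀ n p, fderiv ℝ (fun q => Ψ q * S n q) p (0, 1) =
      Ψ p * fderiv ℝ (S n) p (0, 1) - ψ p * S n p := by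
    intro n p
    rw [fderiv_mul_apply' (hΨs.differentiable (by norm_num) p)
      ((hSs n).differentiable (by norm_num) p), hΨ, fderiv_upPrim hψ.smooth hR]
    ring
  have hvT : ∀ n, Integrable (fun p => v p * (Ψ p * fderiv ℝ (S n) p (0, 1))) := by
    intro n
    have := ((hη n).integrable_mul_fderiv hv (0, 1)).add (hvψS n)
    refine this.congr (Eventually.of_forall fun p => ?_)
    simp only [Pi.add_apply, hderiv]
    ring
  have hid : ∀ n, ∫ p in upper N, v p * ψ p * S n p =
      (∫ p in upper N, v p * (Ψ p * fderiv ℝ (S n) p (0, 1))) +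
        ∫ p in upper N, g p * Ψ p * S n p := by
    intro n
    have h1 := hw _ (hη n)
    have h2 : ∫ p in upper N, v p * fderiv ℝ (fun q => Ψ q * S n q) p (0, 1) =
        (∫ p in upper N, v p * (Ψ p * fderiv ℝ (S n) p (0, 1))) -
          ∫ p in upper N, v p * ψ p * S n p := by
      rw [← integral_sub (hvT n).integrableOn (hvψS n).integrableOn]
      refine integral_congr_ae (Eventually.of_forall fun p => ?_)
      simp only [hderiv]
      ring
    have h3 : ∫ p in upper N, g p * (Ψ p * S n p) = ∫ p in upper N, g p * Ψ p * S n p := by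
      refine integral_congr_ae (Eventually.of_forall fun p => ?_)
      simp only [mul_assoc]
    rw [h2, h3] at h1
    linarith
  have hS1 : ∀ p ∈ upper N, Tendsto (fun n => S n p) atTop (𝓝 1) := by
    intro p hp
    have t1 : Tendsto (fun n : ℕ => (n : ℝ) + 1) atTop atTop :=
      tendsto_atTop_add_const_right _ _ tendsto_natCast_atTop_atTop
    refine tendsto_const_nhds.congr' ?_
    filter_upwards [(t1.atTop_mul_const hp).eventually_ge_atTop 2] with n hn
    exact (Real.smoothTransition.one_of_one_le (by linarith)).symm
  have hL : Tendsto (fun n => ∫ p in upper N, v p * ψ p * S n p) atTop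
      (𝓝 (∫ p in upper N, v p * ψ p)) := by
    refine tendsto_integral_of_dominated_convergence (fun p => |v p * ψ p|)
      (fun n => (hvψS n).1.restrict) hvψ.abs.integrableOn
      (fun n => Eventually.of_forall fun p => ?_) ?_
    · rw [norm_mul]
      exact mul_le_of_le_one_right (norm_nonneg _) (hSb n p)
    · filter_upwards [ae_restrict_mem (measurableSet_upper N)] with p hp
      simpa using (hS1 p hp).const_mul (v p * ψ p)
  have hG : Tendsto (fun n => ∫ p in upper N, g p * Ψ p * S n p) atTop
      (𝓝 (∫ p in upper N, g p * Ψ p)) := by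
    refine tendsto_integral_of_dominated_convergence (fun p => |g p * Ψ p|)
      (fun n => hgΨ.1.mul (hSs n).continuous.aestronglyMeasurable) hgΨ.abs
      (fun n => Eventually.of_forall fun p => ?_) ?_
    · rw [norm_mul]
      exact mul_le_of_le_one_right (norm_nonneg _) (hSb n p)
    · filter_upwards [ae_restrict_mem (measurableSet_upper N)] with p hp
      simpa using (hS1 p hp).const_mul (g p * Ψ p)
  have hT : Tendsto (fun n => ∫ p in upper N, v p * (Ψ p * fderiv ℝ (S n) p (0, 1))) atTop
      (𝓝 0) := by
    have hb := tendsto_boundary_term (aestronglyMeasurable_upper hv) htr R (|CΨ| * C₁)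
    rw [tendsto_zero_iff_norm_tendsto_zero]
    have hle : ∀ n : ℕ, ‖∫ p in upper N, v p * (Ψ p * fderiv ℝ (S n) p (0, 1))‖ₑ ≤
        ENNReal.ofReal (|CΨ| * C₁ * (n + 1)) *
          ∫⁻ p in Metric.closedBall 0 R ×ˢ Ioo 0 (3 / ((n : ℝ) + 1)), ‖v p‖ₑ := by
      intro n
      have hn : (0 : ℝ) < n + 1 := by positivity
      refine (enorm_integral_le_lintegral_enorm _).trans ?_
      rw [← lintegral_const_mul' _ _ ENNReal.ofReal_ne_top,
        ← lintegral_indicator (measurableSet_upper N), ← lintegral_indicator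
          (Metric.isClosed_closedBall.measurableSet.prod measurableSet_Ioo)]
      refine lintegral_mono fun p => ?_
      by_cases hp : p ∈ upper N
      swap
      · simp [hp]
      rw [indicator_of_mem hp]
      by_cases hpQ : p ∈ Metric.closedBall 0 R ×ˢ Ioo 0 (3 / ((n : ℝ) + 1))
      · rw [indicator_of_mem hpQ, ← ofReal_norm, ← ofReal_norm,
          ← ENNReal.ofReal_mul (by positivity)]
        refine ENNReal.ofReal_le_ofReal ?_
        rw [norm_mul, norm_mul, hSd, norm_mul, Real.norm_of_nonneg hn.le, mul_comm ‖v p‖]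
        gcongr ?_ * _
        rw [← mul_assoc]
        gcongr
        · exact hΨb p hp
        · exact hC₁ _
      · rw [indicator_of_notMem hpQ]
        suffices h : Ψ p * fderiv ℝ (S n) p (0, 1) = 0 by simp [h]
        by_cases h1 : p.1 ∈ Metric.closedBall (0 : Space N) R
        -- The transition ends at height `2/(n + 1)`; the layer of thickness `3/(n + 1)` leaves room
        -- for the strict inequality that makes the derivative vanish.
        · have h2 : 3 / ((n : ℝ) + 1) ≤ p.2 := by
            by_contra hcon; exact hpQ ⟨h1, hp, not_le.1 hcon⟩
          rw [div_le_iff₀ hn] at h2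
          rw [hSd, deriv_smoothTransition_of_one_lt (by linarith)]
          ring
        · rw [mem_closedBall_zero_iff, not_le] at h1
          rw [hΨ, upPrim_eq_zero_of_lt_norm_fst hR h1, zero_mul]
    have h0 := tendsto_of_tendsto_of_tendsto_of_le_of_le tendsto_const_nhds hb
      (fun _ => zero_le) hle
    have h2 := (ENNReal.tendsto_toReal ENNReal.zero_ne_top).comp h0
    simpa [Function.comp_def] using h2
  have hlim := hT.add hG
  rw [zero_add] at hlim
  have := tendsto_nhds_unique (hL.congr hid) hlim
  simpa only [mul_comm] using this

/-- A function of zero trace is the vertical primitive of its weak vertical derivative, if this has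
finite energy. -/
theorem ae_eq_vertPrim {s : ℝ} (hs : 0 < s) {v g : Space N × ℝ → ℝ}
    (hv : ∀ K ⊆ upper N, IsCompact K → MemLp v 2 (volume.restrict K))
    (hg : MemLp g 2 (wMeasure N s))
    (hw : ∀ η, IsTest η →
      ∫ p in upper N, v p * fderiv ℝ η p (0, 1) = - ∫ p in upper N, g p * η p)
    (htr : HasTrace v (fun _ => 0)) :
    ∀ᵐ p ∂volume.restrict (upper N), v p = vertPrim g p := by
  obtain ⟨g', hg', hae⟩ := hg.1
  have hae' : g =ᵐ[volume.restrict (upper N)] g' := ae_wMeasure_iff.1 hae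
  have hg2 : MemLp g' 2 (wMeasure N s) := hg.ae_eq hae
  have hw' : ∀ η, IsTest η →
      ∫ p in upper N, v p * fderiv ℝ η p (0, 1) = - ∫ p in upper N, g' p * η p := by
    intro η hη
    rw [hw η hη]
    congr 1
    refine integral_congr_ae ?_
    filter_upwards [hae'] with p hp using by rw [hp]
  have hvl : LocallyIntegrableOn v (upper N) := by
    refine (locallyIntegrableOn_iff (isOpen_upper N).isLocallyClosed).2 fun K hK hc => ?_
    have : IsFiniteMeasure (volume.restrict K) := ⟨by simpa using hc.measure_lt_top⟩
    exact (hv K hK hc).integrable (by norm_num)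
  have hVl : LocallyIntegrableOn (vertPrim g') (upper N) := by
    refine (locallyIntegrableOn_iff (isOpen_upper N).isLocallyClosed).2 fun K hK hc => ?_
    obtain ⟨R, _, hRK, _⟩ := exists_cylinder hc hK
    exact (integrableOn_vertPrim hs hg2 hg' R).mono_set hRK
  have key := (isOpen_upper N).ae_eq_zero_of_integral_contDiff_smul_eq_zero (hvl.sub hVl)
    fun ψ hψ hψc hψs => by
      have ht : IsTest ψ := ⟨hψ, hψc, hψs⟩
      obtain ⟨h1, h2⟩ := integral_mul_eq_integral_mul_vertPrim hs hv hg2 hg' hw' htr ht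
      have h3 : Integrable (fun p => ψ p * v p) := by
        simpa only [mul_comm] using ht.integrable_mul hv
      have hz : ∀ p ∉ upper N, ψ p = 0 := fun p hp =>
        image_eq_zero_of_notMem_tsupport fun hcon => hp (hψs hcon)
      rw [setIntegral_eq_integral_of_forall_compl_eq_zero fun p hp => by simp [hz p hp],
        setIntegral_eq_integral_of_forall_compl_eq_zero fun p hp => by simp [hz p hp]] at h2
      simp only [Pi.sub_apply, smul_eq_mul, mul_sub]
      rw [integral_sub h3 h1, h2, sub_self]
  filter_upwards [(ae_restrict_iff' (measurableSet_upper N)).2 key, vertPrim_congr hae']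
    with p h1 h2
  rw [h2]
  exact sub_eq_zero.1 h1

end Vertical
end FracGauss
end

noncomputable section
namespace FracGauss

/-! ### Enlarging the class of test functions -/

section WeakEquation
open scoped Convolution

variable {N : ℕ}

theorem aestronglyMeasurable_clm_apply {α F G : Type*} [MeasurableSpace α] {μ : Measure α}
    [NormedAddCommGroup F] [NormedSpace ℝ F] [NormedAddCommGroup G] [NormedSpace ℝ G]
    {f : α → F →L[ℝ] G} {g : α → F} (hf : AEStronglyMeasurable f μ)
    (hg : AEStronglyMeasurable g μ) : AEStronglyMeasurable (fun x => f x (g x)) μ :=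
  isBoundedBilinearMap_apply.continuous.comp_aestronglyMeasurable (hf.prodMk hg)

theorem convolution_eq_zero_of_notMem_cthickening {F : Type*} [NormedAddCommGroup F]
    [NormedSpace ℝ F] {φ : ContDiffBump (0 : Space N × ℝ)} {δ : ℝ} (hδ : φ.rOut ≤ δ)
    {V : Space N × ℝ → F} {K : Set (Space N × ℝ)} (hV : ∀ p ∉ K, V p = 0) {p : Space N × ℝ}
    (hp : p ∉ Metric.cthickening δ K) :
    (φ.normed volume ⋆[ContinuousLinearMap.lsmul ℝ ℝ, volume] V) p = 0 := by
  rw [convolution_def]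
  refine integral_eq_zero_of_ae (Eventually.of_forall fun t => ?_)
  by_cases ht : t ∈ Metric.ball (0 : Space N × ℝ) φ.rOut
  · have h : p - t ∉ K := by
      intro hcon
      refine hp (Metric.mem_cthickening_of_dist_le p (p - t) δ K hcon ?_)
      rw [dist_eq_norm, sub_sub_cancel]
      exact ((mem_ball_zero_iff.1 ht).le).trans hδ
    simp [hV _ h]
  · have h : φ.normed volume t = 0 := by
      rw [← Function.notMem_support, φ.support_normed_eq]
      exact ht
    simp [h]

/-- The weak equation may be tested with the product of a test function and a weakly
differentiable function. -/
theorem HasWeakDeriv.integral_isTest_mul_eq_zero {s : ℝ} {v : Space N × ℝ → ℝ}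
    {g : Space N × ℝ → Space N × ℝ →L[ℝ] ℝ} (h : HasWeakDeriv v g) {χ : Space N × ℝ → ℝ}
    (hχ : IsTest χ) {X : Space N × ℝ → Space N × ℝ} (hX : MemLp X 2 (wMeasure N s))
    (heq : ∀ η, IsTest η → ∫ p, fderiv ℝ η p (X p) ∂wMeasure N s = 0) :
    ∫ p, (χ p • g p + v p • fderiv ℝ χ p) (X p) ∂wMeasure N s = 0 := by
  obtain ⟨hV, hG, hw⟩ := h.isTest_mul hχ
  set V : Space N × ℝ → ℝ := fun p => χ p * v p with hVdef
  set G : Space N × ℝ → Space N × ℝ →L[ℝ] ℝ := fun p => χ p • g p + v p • fderiv ℝ χ p with hGdef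
  have hV0 : ∀ p ∉ tsupport χ, V p = 0 := fun p hp => by
    simp [hVdef, image_eq_zero_of_notMem_tsupport hp]
  have hG0 : ∀ p ∉ tsupport χ, G p = 0 := fun p hp => by
    have : fderiv ℝ χ p = 0 := by
      by_contra hcon; exact hp (support_fderiv_subset ℝ hcon)
    simp [hGdef, image_eq_zero_of_notMem_tsupport hp, this]
  have hVl : LocallyIntegrable V volume := hV.locallyIntegrable (by norm_num)
  have hGl : LocallyIntegrable G volume := hG.locallyIntegrable (by norm_num)
  obtain ⟨δ, hδ, hsub⟩ := IsCompact.exists_cthickening_subset_open hχ.compact (isOpen_upper N)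
    hχ.support
  set K := Metric.cthickening δ (tsupport χ) with hK
  have hKc : IsCompact K := IsCompact.cthickening hχ.compact
  have hKm : MeasurableSet K := hKc.isClosed.measurableSet
  have hsubK : tsupport χ ⊆ K := Metric.self_subset_cthickening _
  -- Moving the weight into the vector field and truncating to a compact neighbourhood of the
  -- support makes `Y` square integrable for Lebesgue measure, so that the `L²` convergence of
  -- mollifications applies.
  let Y : Space N × ℝ → Space N × ℝ := K.indicator fun p => wDensity s p • X p
  have hY : MemLp Y 2 volume := by
    refine memLp_of_restrict hKm ?_ (fun p hp => by simp [Y, hp])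
    have h1 : MemLp (fun p => wDensity s p • X p) 2 (volume.restrict K) :=
      memLp_smul_of_continuousOn hKc ((continuousOn_wDensity s).mono hsub)
        (memLp_restrict_of_memLp_wMeasure hX hKc hsub)
    refine h1.ae_eq ?_
    filter_upwards [ae_restrict_mem hKm] with p hp
    simp [Y, hp]
  have hIY : ∀ H : Space N × ℝ → Space N × ℝ →L[ℝ] ℝ, (∀ p ∉ K, H p = 0) →
      ∫ p, H p (X p) ∂wMeasure N s = ∫ p, H p (Y p) := by
    intro H hH
    rw [integral_wMeasure, setIntegral_eq_integral_of_forall_compl_eq_zero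
      fun p hp => by simp [hH p fun hcon => hp (hsub hcon)]]
    refine integral_congr_ae (Eventually.of_forall fun p => ?_)
    by_cases hp : p ∈ K
    · simp [Y, hp]
    · simp [hH p hp]
  let φ := shrinkingBump (Space N × ℝ)
  let D : ℕ → Space N × ℝ → Space N × ℝ →L[ℝ] ℝ := fun n =>
    (φ n).normed volume ⋆[ContinuousLinearMap.lsmul ℝ ℝ, volume] G
  have hDc : ∀ n, Continuous (D n) := fun n =>
    (φ n).hasCompactSupport_normed.continuous_convolution_left _ (φ n).continuous_normed hGl
  have hint : Integrable (fun p => G p (Y p)) :=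
    (hG.norm.integrable_mul hY.norm).mono' (aestronglyMeasurable_clm_apply hG.1 hY.1)
      (Eventually.of_forall fun p => (G p).le_opNorm _)
  have hlim := tendsto_integral_mul_bilin (ν := volume)
    (ContinuousLinearMap.id ℝ (Space N × ℝ →L[ℝ] ℝ)) (h := D) (h₀ := G) (ψ := Y)
    (k := fun _ _ => 1) (k₀ := fun _ => 1) (C := 1) (fun n => (hDc n).aestronglyMeasurable) hG.1
    (tendsto_lintegral_normed_convolution_sub tendsto_shrinkingBump_rOut hG) hY hint
    (fun _ => aestronglyMeasurable_const) (by simp) (Eventually.of_forall fun _ => tendsto_const_nhds)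
  simp only [one_mul, ContinuousLinearMap.id_apply] at hlim
  rw [hIY G fun p hp => hG0 p fun hcon => hp (hsubK hcon)]
  refine tendsto_nhds_unique hlim (tendsto_const_nhds.congr' ?_)
  have hev : ∀ᶠ n in atTop, (φ n).rOut ≤ δ :=
    (tendsto_shrinkingBump_rOut (E := Space N × ℝ)).eventually_le_const hδ
  filter_upwards [hev] with n hn
  -- Once the mollification radius is below `δ`, the mollified product is still supported in the
  -- open halfspace and is a legitimate test function.
  set W := (φ n).normed volume ⋆[ContinuousLinearMap.lsmul ℝ ℝ, volume] V with hW
  have hW0 : tsupport W ⊆ K := by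
    refine closure_minimal (fun p hp => ?_) hKc.isClosed
    by_contra hcon
    exact hp (convolution_eq_zero_of_notMem_cthickening hn hV0 hcon)
  have hWt : IsTest W := ⟨(φ n).hasCompactSupport_normed.contDiff_convolution_left _
      (φ n).contDiff_normed hVl, hKc.of_isClosed_subset (isClosed_tsupport _) hW0, hW0.trans hsub⟩
  have hWd : ∀ p, fderiv ℝ W p = D n p := fun p =>
    (hasFDerivAt_normed_convolution (φ n) hVl hGl hw p).fderiv
  have := heq W hWt
  simp only [hWd] at this
  rw [← hIY (D n) fun p hp => convolution_eq_zero_of_notMem_cthickening hn hG0 hp, this]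

/-- The weak equation may be tested with every function of finite energy and zero trace. -/
theorem HasWeakDeriv.integral_apply_eq_zero {s : ℝ} (hs : 0 < s) {v : Space N × ℝ → ℝ}
    {g : Space N × ℝ → Space N × ℝ →L[ℝ] ℝ} (h : HasWeakDeriv v g)
    (hg : MemLp g 2 (wMeasure N s)) (htr : HasTrace v (fun _ => 0))
    {X : Space N × ℝ → Space N × ℝ} (hX : MemLp X 2 (wMeasure N s))
    (heq : ∀ η, IsTest η → ∫ p, fderiv ℝ η p (X p) ∂wMeasure N s = 0) :
    ∫ p, g p (X p) ∂wMeasure N s = 0 := by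
  have hgz : MemLp (fun p => g p (0, 1)) 2 (wMeasure N s) :=
    memLp_clm_comp (F := Space N × ℝ →L[ℝ] ℝ) (ContinuousLinearMap.apply ℝ ℝ ((0, 1) : Space N × ℝ)) hg
  have hvp := ae_eq_vertPrim hs h.memLp hgz (fun η hη => h.weak η hη (0, 1)) htr
  have hup : ∀ᵐ p ∂wMeasure N s, p ∈ upper N :=
    ae_wMeasure_iff.2 (ae_restrict_mem (measurableSet_upper N))
  have hvm : AEStronglyMeasurable v (wMeasure N s) :=
    (aestronglyMeasurable_upper h.memLp).mono_ac (wMeasure_absolutelyContinuous N s)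
  -- This is where the zero trace enters: `v` is a vertical primitive, so Hardy's inequality
  -- applies. Together with the bound `C/z` on the gradients of the cutoffs, it provides the
  -- integrable majorant `hb`.
  have hvw : MemLp (fun p => v p / p.2) 2 (wMeasure N s) := by
    refine memLp_two_iff_lintegral.2 ⟨(hvm.aemeasurable.div
      measurable_snd.aemeasurable).aestronglyMeasurable, lt_of_le_of_lt ?_
      (ENNReal.mul_lt_top (ENNReal.ofReal_lt_top (r := 4 / s ^ 2)) (memLp_two_iff_lintegral.1 hgz).2)⟩
    refine le_trans (lintegral_mono_ae ?_) (lintegral_vertPrim_hardy hs hgz.1)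
    filter_upwards [ae_wMeasure_iff.2 hvp, hup] with p hp hpu
    rw [hp, ← ofReal_norm, ← ofReal_norm, ← ENNReal.ofReal_div_of_pos hpu, norm_div,
      Real.norm_of_nonneg (le_of_lt hpu)]
  obtain ⟨C, hC0, hC⟩ := exists_norm_fderiv_cutoff_le N
  have hb : Integrable (fun p => (‖g p‖ + C * ‖v p / p.2‖) * ‖X p‖) (wMeasure N s) :=
    (hg.norm.add (hvw.norm.const_mul C)).integrable_mul hX.norm
  have hlim : Tendsto (fun n => ∫ p, (cutoff N n p • g p + v p • fderiv ℝ (cutoff N n) p) (X p)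
      ∂wMeasure N s) atTop (𝓝 (∫ p, g p (X p) ∂wMeasure N s)) := by
    refine tendsto_integral_of_dominated_convergence
      (fun p => (‖g p‖ + C * ‖v p / p.2‖) * ‖X p‖) (fun n => ?_) hb (fun n => ?_) ?_
    · have h1 : AEStronglyMeasurable (fun p => cutoff N n p • g p) (wMeasure N s) :=
        (contDiff_cutoff n).continuous.aestronglyMeasurable.smul hg.1
      have h2 : AEStronglyMeasurable (fun p => v p • fderiv ℝ (cutoff N n) p) (wMeasure N s) :=
        hvm.smul ((contDiff_cutoff n).continuous_fderiv (by norm_num)).aestronglyMeasurable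
      exact aestronglyMeasurable_clm_apply (h1.add h2) hX.1
    · filter_upwards [hup] with p hp
      have hp0 : 0 < p.2 := hp
      refine (ContinuousLinearMap.le_opNorm _ _).trans ?_
      gcongr
      refine (norm_add_le _ _).trans ?_
      rw [norm_smul (cutoff N n p), norm_smul (v p), norm_div, Real.norm_of_nonneg hp0.le,
        Real.norm_of_nonneg (cutoff_nonneg n p)]
      refine add_le_add ?_ ?_
      · exact mul_le_of_le_one_left (norm_nonneg _) (cutoff_le_one n p)
      · calc ‖v p‖ * ‖fderiv ℝ (cutoff N n) p‖ ≤ ‖v p‖ * (C / p.2) := by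
              gcongr; exact hC n p hp
          _ = C * (‖v p‖ / p.2) := by ring
    · filter_upwards [hup] with p hp
      refine tendsto_const_nhds.congr' ?_
      filter_upwards [eventually_cutoff_eventuallyEq_one (isCompact_singleton (x := p))
        (by simpa using hp)] with n hn
      have h1 := hn p rfl
      have h2 : fderiv ℝ (cutoff N n) p = 0 := by rw [h1.fderiv_eq]; simp
      rw [h1.eq_of_nhds, h2, one_smul, smul_zero, add_zero]
  refine tendsto_nhds_unique hlim (tendsto_const_nhds.congr fun n => ?_)
  exact (h.integral_isTest_mul_eq_zero (isTest_cutoff n) hX heq).symm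

end WeakEquation
end FracGauss
end

noncomputable section
namespace FracGauss

/-! ### Calculus of traces -/

section Trace

variable {N : ℕ} {v v₁ v₂ w : Space N × ℝ → ℝ} {u u₁ u₂ ω : Space N → ℝ}

theorem gauss_prod_restrict_absolutelyContinuous (N : ℕ) (S : Set (Space N × ℝ)) :
    ((gauss N).prod (volume : Measure ℝ)).restrict S ≪ volume.restrict S := by
  rw [gauss_prod_eq_withDensity]
  exact (withDensity_absolutelyContinuous _ _).restrict S

theorem univ_prod_Ioo_subset_upper (δ : ℝ) : (univ : Set (Space N)) ×ˢ Ioo 0 δ ⊆ upper N :=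
  fun _ hp => hp.2.1

theorem HasTrace.of_le {C : ℝ} (h : HasTrace v u)
    (hle : ∀ p ∈ upper N, |w p - ω p.1| ≤ C * |v p - u p.1|) : HasTrace w ω := by
  have h1 := ENNReal.Tendsto.const_mul (a := ENNReal.ofReal |C| ^ 2) h (Or.inr (by simp))
  rw [mul_zero] at h1
  refine tendsto_of_tendsto_of_tendsto_of_le_of_le tendsto_const_nhds h1 (fun _ => zero_le)
    fun δ => ?_
  dsimp only
  rw [← mul_div_assoc, ← lintegral_const_mul' _ _ (by simp)]
  gcongr ?_ / _
  refine setLIntegral_mono' (MeasurableSet.univ.prod measurableSet_Ioo) fun p hp => ?_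
  rw [← mul_pow, ← ofReal_norm, ← ofReal_norm, ← ENNReal.ofReal_mul (abs_nonneg _)]
  gcongr
  refine (hle p hp.2.1).trans ?_
  gcongr
  exacts [le_abs_self C, le_rfl]

theorem HasTrace.sub (h₁ : HasTrace v₁ u₁) (h₂ : HasTrace v₂ u₂)
    (hv : AEStronglyMeasurable v₁ (volume.restrict (upper N))) (hu : AEStronglyMeasurable u₁ volume) :
    HasTrace (fun p => v₁ p - v₂ p) (fun x => u₁ x - u₂ x) := by
  have h := (ENNReal.Tendsto.const_mul (a := 2) h₁ (Or.inr (by simp))).add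
    (ENNReal.Tendsto.const_mul (a := 2) h₂ (Or.inr (by simp)))
  rw [mul_zero, add_zero] at h
  refine tendsto_of_tendsto_of_tendsto_of_le_of_le tendsto_const_nhds h (fun _ => zero_le)
    fun δ => ?_
  dsimp only
  have hm : AEStronglyMeasurable (fun p : Space N × ℝ => v₁ p - u₁ p.1)
      (((gauss N).prod volume).restrict (univ ×ˢ Ioo 0 δ)) := by
    refine AEStronglyMeasurable.mono_ac (gauss_prod_restrict_absolutelyContinuous N _) ?_
    refine (hv.mono_measure (Measure.restrict_mono (univ_prod_Ioo_subset_upper δ) le_rfl)).sub ?_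
    exact (hu.comp_fst (ν := volume)).restrict
  rw [← mul_div_assoc, ← mul_div_assoc, ← ENNReal.add_div, ← lintegral_const_mul' _ _ (by simp),
    ← lintegral_const_mul' _ _ (by simp), ← lintegral_add_left' ((hm.enorm.pow_const 2).const_mul 2)]
  gcongr ?_ / _
  refine lintegral_mono fun p => ?_
  rw [← ofReal_norm, ← ofReal_norm, ← ofReal_norm, ← ENNReal.ofReal_pow (norm_nonneg _),
    ← ENNReal.ofReal_pow (norm_nonneg _), ← ENNReal.ofReal_pow (norm_nonneg _),
    show (2 : ℝ≥0∞) = ENNReal.ofReal 2 by simp, ← ENNReal.ofReal_mul (by norm_num),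
    ← ENNReal.ofReal_mul (by norm_num), ← ENNReal.ofReal_add (by positivity) (by positivity)]
  refine ENNReal.ofReal_le_ofReal ?_
  simp only [Real.norm_eq_abs, sq_abs]
  nlinarith [sq_nonneg ((v₁ p - u₁ p.1) + (v₂ p - u₂ p.1))]

/-- A bounded function of the height has its limit at height `0` as its trace. -/
theorem hasTrace_comp_snd {m : ℝ → ℝ} {m₀ : ℝ} (hm : Tendsto m (𝓝[>] 0) (𝓝 m₀)) :
    HasTrace (N := N) (fun p => m p.2) (fun _ => m₀) := by
  rw [HasTrace, ENNReal.tendsto_nhds_zero]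
  intro ε hε
  obtain ⟨η, hη0, hηε⟩ : ∃ η : ℝ, 0 < η ∧ ENNReal.ofReal η ^ 2 ≤ ε := by
    have : Tendsto (fun η : ℝ => ENNReal.ofReal η ^ 2) (𝓝[>] 0) (𝓝 0) := by
      have h := ((ENNReal.continuous_pow 2).comp ENNReal.continuous_ofReal).tendsto 0
      simp only [Function.comp_def, ENNReal.ofReal_zero] at h
      exact (h.mono_left nhdsWithin_le_nhds).trans (by simp)
    obtain ⟨η, h1, h2⟩ := ((ENNReal.tendsto_nhds_zero.1 this ε hε).and self_mem_nhdsWithin).exists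
    exact ⟨η, h2, h1⟩
  obtain ⟨δ₀, hδ₀, hδ⟩ := mem_nhdsGT_iff_exists_Ioo_subset.1
    (Metric.tendsto_nhds.1 hm η hη0)
  filter_upwards [Ioo_mem_nhdsGT hδ₀] with δ hδm
  refine ENNReal.div_le_of_le_mul ?_
  calc ∫⁻ p in univ ×ˢ Ioo 0 δ, ‖m p.2 - m₀‖ₑ ^ 2 ∂((gauss N).prod volume)
      ≤ ∫⁻ _ in (univ : Set (Space N)) ×ˢ Ioo 0 δ, ε ∂((gauss N).prod volume) := by
        refine setLIntegral_mono' (MeasurableSet.univ.prod measurableSet_Ioo) fun p hp => ?_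
        refine le_trans ?_ hηε
        rw [← ofReal_norm]
        gcongr
        have := hδ (show p.2 ∈ Ioo 0 δ₀ from ⟨hp.2.1, hp.2.2.trans hδm.2⟩)
        exact le_of_lt this
    _ = ε * ENNReal.ofReal δ := by simp [Measure.prod_prod]

end Trace

/-! ### Solutions minimize the energy -/

section Solution

variable {N : ℕ}

/-- The squared Euclidean norm of `ℝ^N × ℝ`. -/
def normSq (q : Space N × ℝ) : ℝ := ‖q.1‖ ^ 2 + q.2 ^ 2

theorem normSq_nonneg (q : Space N × ℝ) : 0 ≤ normSq q := by unfold normSq; positivity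

theorem toCovector_self (q : Space N × ℝ) : toCovector q.1 q.2 q = normSq q := by
  simp [normSq, sq]

theorem energy_eq (s : ℝ) (gx : Space N × ℝ → Space N) (gz : Space N × ℝ → ℝ) :
    energy (s / 2) gx gz = ∫⁻ p, ENNReal.ofReal (normSq (gx p, gz p)) ∂wMeasure N s := by
  rw [lintegral_wMeasure_eq, energy]
  refine setLIntegral_congr_fun (measurableSet_upper N) fun p hp => ?_
  have hp : 0 < p.2 := hp
  rw [← ENNReal.ofReal_mul (by positivity), mul_comm, normSq]
  congr 4
  ring

theorem integrable_normSq {α : Type*} [MeasurableSpace α] {μ : Measure α} {X : α → Space N × ℝ}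
    (hX : MemLp X 2 μ) : Integrable (fun p => normSq (X p)) μ :=
  (hX.fst.norm.integrable_sq).add hX.snd.integrable_sq

theorem IsWeakGradient.memLp_wMeasure {v : Space N × ℝ → ℝ} {gx : Space N × ℝ → Space N}
    {gz : Space N × ℝ → ℝ} (h : IsWeakGradient v gx gz) {s : ℝ} (hE : energy (s / 2) gx gz < ∞) :
    MemLp (fun p => (gx p, gz p)) 2 (wMeasure N s) := by
  rw [energy_eq] at hE
  have hac := wMeasure_absolutelyContinuous N s
  refine memLp_prodMk ?_ ?_
  · refine memLp_two_iff_lintegral.2 ⟨(aestronglyMeasurable_upper h.memLp_x).mono_ac hac,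
      (lintegral_mono fun p => ?_).trans_lt hE⟩
    rw [← ofReal_norm, ← ENNReal.ofReal_pow (norm_nonneg _)]
    exact ENNReal.ofReal_le_ofReal (le_add_of_nonneg_right (sq_nonneg _))
  · refine memLp_two_iff_lintegral.2 ⟨(aestronglyMeasurable_upper h.memLp_z).mono_ac hac,
      (lintegral_mono fun p => ?_).trans_lt hE⟩
    rw [← ofReal_norm, ← ENNReal.ofReal_pow (norm_nonneg _), Real.norm_eq_abs, sq_abs]
    exact ENNReal.ofReal_le_ofReal (le_add_of_nonneg_left (sq_nonneg _))

/-- `U` is a weak solution of the extension problem with boundary values `u` and with the gradient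
`X`, which has finite energy. -/
structure IsSolution (s : ℝ) (u : Space N → ℝ) (U : Space N × ℝ → ℝ)
    (X : Space N × ℝ → Space N × ℝ) : Prop where
  trace : HasTrace U u
  deriv : HasWeakDeriv U (fun p => toCovector (X p).1 (X p).2)
  memLp : MemLp X 2 (wMeasure N s)
  weak : ∀ η, IsTest η → ∫ p, fderiv ℝ η p (X p) ∂wMeasure N s = 0

theorem IsExtension.exists_isSolution {s : ℝ} {u : Space N → ℝ} {U : Space N × ℝ → ℝ}
    (h : IsExtension (s / 2) u U) : ∃ X, IsSolution s u U X := by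
  obtain ⟨gx, gz, hg, hE, hw⟩ := h.weak_solution
  refine ⟨fun p => (gx p, gz p), h.trace, hg.hasWeakDeriv, hg.memLp_wMeasure hE, fun η hη => ?_⟩
  rw [integral_wMeasure_eq, ← hw η hη, show (2 : ℝ) * (s / 2) = s by ring]
  refine setIntegral_congr_fun (measurableSet_upper N) fun p _ => ?_
  rw [clm_prod_apply (fderiv ℝ η p) (gx p, gz p), smul_eq_mul]

/-- The Dirichlet energy of a gradient. -/
def dirichlet (s : ℝ) (X : Space N × ℝ → Space N × ℝ) : ℝ := ∫ p, normSq (X p) ∂wMeasure N s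

theorem dirichlet_nonneg (s : ℝ) (X : Space N × ℝ → Space N × ℝ) : 0 ≤ dirichlet s X :=
  integral_nonneg fun _ => normSq_nonneg _

theorem IsSolution.memLp_deriv {s : ℝ} {u : Space N → ℝ} {U : Space N × ℝ → ℝ}
    {X : Space N × ℝ → Space N × ℝ} (h : IsSolution s u U X) :
    MemLp (fun p => toCovector (X p).1 (X p).2) 2 (wMeasure N s) :=
  memLp_toCovector h.memLp.fst h.memLp.snd

theorem toCovector_apply_le (q r : Space N × ℝ) :
    toCovector q.1 q.2 r ≤ normSq q / 2 + normSq r / 2 := by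
  have h1 := real_inner_le_norm q.1 r.1
  simp only [toCovector_apply, normSq]
  nlinarith [sq_nonneg (‖q.1‖ - ‖r.1‖), sq_nonneg (q.2 - r.2)]

/-- The solution minimizes the energy. -/
theorem IsSolution.dirichlet_le_seminormSq {s : ℝ} (hs : 0 < s) {u : Space N → ℝ}
    (hu : AEStronglyMeasurable u volume) {U : Space N × ℝ → ℝ} {X : Space N × ℝ → Space N × ℝ}
    (h : IsSolution s u U X) : ENNReal.ofReal (dirichlet s X) ≤ seminormSq (s / 2) u := by
  refine le_iInf fun v => le_iInf fun gx => le_iInf fun gz => le_iInf fun hv => le_iInf fun htr => ?_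
  by_cases hE : energy (s / 2) gx gz < ∞
  swap
  · rw [not_lt_top_iff.1 hE]; exact le_top
  have hY := hv.memLp_wMeasure hE
  set Y : Space N × ℝ → Space N × ℝ := fun p => (gx p, gz p) with hYdef
  have hvg : MemLp (fun p => toCovector (gx p) (gz p)) 2 (wMeasure N s) :=
    memLp_toCovector hY.fst hY.snd
  have hg : MemLp (fun p => toCovector (X p).1 (X p).2 - toCovector (gx p) (gz p)) 2
      (wMeasure N s) := by
    have := memLp_add h.memLp_deriv (memLp_const_smul hvg (-1))
    simpa [sub_eq_add_neg] using this
  have htr0 : HasTrace (fun p => U p - v p) (fun _ => 0) := by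
    simpa using h.trace.sub htr (aestronglyMeasurable_upper h.deriv.memLp) hu
  -- The competitor has the same trace, so `U - v` is admissible, and the equation reads `D = ∫ ∇U ·
  -- ∇v`. Young's inequality bounds the right side by half of each energy.
  have key := (h.deriv.sub hv.hasWeakDeriv).integral_apply_eq_zero hs hg htr0 h.memLp h.weak
  have hi : Integrable (fun p => toCovector (gx p) (gz p) (X p)) (wMeasure N s) :=
    (hvg.norm.integrable_mul h.memLp.norm).mono' (aestronglyMeasurable_clm_apply hvg.1 h.memLp.1)
      (Eventually.of_forall fun p => ContinuousLinearMap.le_opNorm _ _)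
  have hX2 := integrable_normSq h.memLp
  have hY2 := integrable_normSq hY
  simp only [sub_apply, toCovector_self] at key
  rw [integral_sub hX2 hi, sub_eq_zero] at key
  have hle : ∫ p, toCovector (gx p) (gz p) (X p) ∂wMeasure N s ≤
      ∫ p, (normSq (Y p) / 2 + normSq (X p) / 2) ∂wMeasure N s :=
    integral_mono hi ((hY2.div_const 2).add (hX2.div_const 2))
      fun p => toCovector_apply_le (Y p) (X p)
  rw [integral_add (hY2.div_const 2) (hX2.div_const 2), integral_div, integral_div, ← key] at hle
  rw [energy_eq, ← ofReal_integral_eq_lintegral_ofReal hY2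
    (Eventually.of_forall fun _ => normSq_nonneg _)]
  refine ENNReal.ofReal_le_ofReal ?_
  simp only [dirichlet]
  linarith

end Solution
end FracGauss
end

noncomputable section
namespace FracGauss

/-! ### A smooth positive part -/

section Ramp

/-- A smooth version of the positive part, with derivative `Real.smoothTransition`. -/
def ramp (r : ℝ) : ℝ := ∫ τ in (0 : ℝ)..r, Real.smoothTransition τ

theorem hasDerivAt_ramp (r : ℝ) : HasDerivAt ramp (Real.smoothTransition r) r :=
  intervalIntegral.integral_hasDerivAt_right
    (Real.smoothTransition.continuous.intervalIntegrable _ _)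
    (Real.smoothTransition.continuous.stronglyMeasurableAtFilter _ _)
    Real.smoothTransition.continuous.continuousAt

theorem contDiff_ramp : ContDiff ℝ (⊤ : ℕ∞) ramp := by
  rw [contDiff_infty_iff_deriv]
  refine ⟨fun r => (hasDerivAt_ramp r).differentiableAt, ?_⟩
  rw [show deriv ramp = Real.smoothTransition from funext fun r => (hasDerivAt_ramp r).deriv]
  exact Real.smoothTransition.contDiff

theorem ramp_of_nonpos {r : ℝ} (h : r ≤ 0) : ramp r = 0 := by
  rw [ramp, intervalIntegral.integral_symm, neg_eq_zero]
  refine intervalIntegral.integral_zero_ae (Eventually.of_forall fun τ hτ => ?_)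
  rw [uIoc_of_le h] at hτ
  exact Real.smoothTransition.zero_of_nonpos hτ.2

theorem ramp_pos {r : ℝ} (h : 0 < r) : 0 < ramp r :=
  intervalIntegral.intervalIntegral_pos_of_pos_on
    (Real.smoothTransition.continuous.intervalIntegrable _ _)
    (fun _ hτ => Real.smoothTransition.pos_of_pos hτ.1) h

theorem ramp_nonneg (r : ℝ) : 0 ≤ ramp r := by
  rcases le_or_gt r 0 with h | h
  exacts [(ramp_of_nonpos h).ge, (ramp_pos h).le]

theorem monotone_ramp : Monotone ramp :=
  monotone_of_deriv_nonneg (fun r => (hasDerivAt_ramp r).differentiableAt) fun r => by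
    rw [(hasDerivAt_ramp r).deriv]; exact Real.smoothTransition.nonneg r

theorem ramp_le_self {r : ℝ} (h : 0 ≤ r) : ramp r ≤ r := by
  calc ramp r ≤ ∫ _ in (0 : ℝ)..r, (1 : ℝ) :=
        intervalIntegral.integral_mono_on h
          (Real.smoothTransition.continuous.intervalIntegrable _ _) intervalIntegrable_const
          fun τ _ => Real.smoothTransition.le_one τ
    _ = r := by simp

end Ramp

/-! ### The maximum principle -/

section MaximumPrinciple

variable {N : ℕ} {s : ℝ} {u : Space N → ℝ} {U : Space N × ℝ → ℝ} {X : Space N × ℝ → Space N × ℝ}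

theorem ae_wMeasure_mem_upper : ∀ᵐ p ∂wMeasure N s, p ∈ upper N :=
  ae_wMeasure_iff.2 (ae_restrict_mem (measurableSet_upper N))

theorem abs_sub_le_of_hasDerivAt {f f' : ℝ → ℝ} {C : ℝ} (hf : ∀ r, HasDerivAt f (f' r) r)
    (hC : ∀ r, |f' r| ≤ C) (a b : ℝ) : |f a - f b| ≤ C * |a - b| := by
  simpa using Convex.norm_image_sub_le_of_norm_hasDerivWithin_le (s := univ)
    (fun r _ => (hf r).hasDerivWithinAt) (fun r _ => hC r) convex_univ (mem_univ b) (mem_univ a)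

theorem HasTrace.comp (h : HasTrace U u) {f f' : ℝ → ℝ} {C : ℝ}
    (hf : ∀ r, HasDerivAt f (f' r) r) (hC : ∀ r, |f' r| ≤ C) :
    HasTrace (fun p => f (U p)) (fun x => f (u x)) :=
  h.of_le fun _ _ => abs_sub_le_of_hasDerivAt hf hC _ _

theorem IsSolution.aestronglyMeasurable (h : IsSolution s u U X) :
    AEStronglyMeasurable U (wMeasure N s) :=
  (aestronglyMeasurable_upper h.deriv.memLp).mono_ac (wMeasure_absolutelyContinuous N s)

/-- A nondecreasing function that vanishes at the boundary values vanishes at all values of the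
solution. -/
theorem IsSolution.comp_eq_zero (hs : 0 < s) (h : IsSolution s u U X)
    (hUc : ContinuousOn U (upper N)) {f f' : ℝ → ℝ}
    {C : ℝ} (hf : ∀ r, HasDerivAt f (f' r) r) (hf' : Continuous f') (hf0 : ∀ r, 0 ≤ f' r)
    (hC : ∀ r, f' r ≤ C) (hu : ∀ x, f (u x) = 0) : EqOn (fun p => f (U p)) (fun _ => 0) (upper N) := by
  have hC' : ∀ r, |f' r| ≤ C := fun r => by rw [abs_of_nonneg (hf0 r)]; exact hC r
  have hd := h.deriv.comp hf hf' hC'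
  have htr : HasTrace (fun p => f (U p)) (fun _ => 0) := by simpa [hu] using h.trace.comp hf hC'
  have hfU : AEStronglyMeasurable (fun p => f' (U p)) (wMeasure N s) :=
    hf'.comp_aestronglyMeasurable h.aestronglyMeasurable
  have hg := memLp_bdd_smul h.memLp_deriv hfU (Eventually.of_forall fun p => hC' (U p))
  -- Testing with `f(U)` itself gives `∫ f'(U) |∇U|² = 0`. The integrand is nonnegative, so the weak
  -- vertical derivative of `f(U)` vanishes almost everywhere; having zero trace, `f(U)` is then the
  -- primitive of `0`.
  have key := hd.integral_apply_eq_zero hs hg htr h.memLp h.weak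
  simp only [smul_apply, toCovector_self, smul_eq_mul] at key
  have hi : Integrable (fun p => f' (U p) * normSq (X p)) (wMeasure N s) :=
    (integrable_normSq h.memLp).bdd_mul hfU (Eventually.of_forall fun p => hC' (U p))
  have h0 := (integral_eq_zero_iff_of_nonneg
    (fun p => mul_nonneg (hf0 _) (normSq_nonneg _)) hi).1 key
  have hz : ∀ᵐ p ∂wMeasure N s, (f' (U p) • toCovector (X p).1 (X p).2) (0, 1) = 0 := by
    filter_upwards [h0] with p hp
    rcases mul_eq_zero.1 hp with h1 | h1
    · simp [h1]
    · have : (X p).2 = 0 := by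
        have := h1.le
        simp only [normSq] at this
        nlinarith [sq_nonneg ‖(X p).1‖, sq_nonneg (X p).2]
      simp [this]
  have hv := ae_eq_vertPrim hs hd.memLp (g := fun _ => 0) (MemLp.zero' ..)
    (fun η hη => by
      rw [hd.weak η hη (0, 1)]
      congr 1
      refine integral_congr_ae ?_
      filter_upwards [ae_wMeasure_iff.1 hz] with p hp
      rw [hp]) htr
  have hfc : Continuous f := continuous_iff_continuousAt.2 fun r => (hf r).continuousAt
  refine Measure.eqOn_open_of_ae_eq (μ := volume) ?_ (isOpen_upper N)
    (hfc.comp_continuousOn hUc) continuousOn_const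
  filter_upwards [hv] with p hp
  simpa [vertPrim] using hp

/-- The maximum principle. -/
theorem IsSolution.mem_Icc (hs : 0 < s) (h : IsSolution s u U X)
    (hUc : ContinuousOn U (upper N)) (hu : ∀ x, u x ∈ Icc (0 : ℝ) 1) {p : Space N × ℝ}
    (hp : p ∈ upper N) : U p ∈ Icc (0 : ℝ) 1 := by
  constructor
  -- A smooth negative part: nondecreasing, zero on `[0, ∞)` and strictly negative below zero.
  · have h1 := h.comp_eq_zero hs hUc (f := fun r => - ramp (-r))
      (f' := fun r => Real.smoothTransition (-r)) (C := 1)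
      (fun r => (((hasDerivAt_ramp (-r)).comp r (hasDerivAt_neg r)).neg).congr_deriv (by simp))
      (Real.smoothTransition.continuous.comp continuous_neg)
      (fun r => Real.smoothTransition.nonneg _) (fun r => Real.smoothTransition.le_one _)
      (fun x => by simp [ramp_of_nonpos (neg_nonpos.2 (hu x).1)]) hp
    by_contra hcon
    have := ramp_pos (neg_pos.2 (not_le.1 hcon))
    simp only at h1
    linarith
  · have h1 := h.comp_eq_zero hs hUc (f := fun r => ramp (r - 1))
      (f' := fun r => Real.smoothTransition (r - 1)) (C := 1)
      (fun r => (hasDerivAt_ramp (r - 1)).comp_sub_const r 1)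
      (Real.smoothTransition.continuous.comp (continuous_id.sub continuous_const))
      (fun r => Real.smoothTransition.nonneg _) (fun r => Real.smoothTransition.le_one _)
      (fun x => ramp_of_nonpos (sub_nonpos.2 (hu x).2)) hp
    by_contra hcon
    have := ramp_pos (sub_pos.2 (not_le.1 hcon))
    simp only at h1
    linarith

end MaximumPrinciple

/-! ### The height profile -/

section Flux

variable {N : ℕ} {s : ℝ}

/-- The weight `w^(s-1)` on heights below `z`. -/
def heightKernel (s z w : ℝ) : ℝ := (Ioo 0 z).indicator (fun w => w ^ (s - 1)) w

theorem measurable_heightKernel (s z : ℝ) : Measurable (heightKernel s z) :=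
  (measurable_id.pow_const (s - 1)).indicator measurableSet_Ioo

theorem heightKernel_nonneg (s z w : ℝ) : 0 ≤ heightKernel s z w :=
  indicator_nonneg (fun _ hw => Real.rpow_nonneg hw.1.le _) _

theorem memLp_heightKernel (N : ℕ) (hs : 0 < s) {z : ℝ} (hz : 0 < z) :
    MemLp (fun p : Space N × ℝ => heightKernel s z p.2) 2 (wMeasure N s) := by
  have hm : Measurable (fun p : Space N × ℝ => heightKernel s z p.2) :=
    (measurable_heightKernel s z).comp measurable_snd
  refine memLp_two_iff_lintegral.2 ⟨hm.aestronglyMeasurable, ?_⟩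
  rw [lintegral_wMeasure_eq_iterated s (hm.enorm.pow_const 2)]
  have : ∀ x : Space N, (∫⁻ w in Ioi 0, ENNReal.ofReal (w ^ (1 - s)) * ‖heightKernel s z w‖ₑ ^ 2) =
      ENNReal.ofReal (z ^ s / s) := by
    intro x
    -- The square `w^(2s-2)` of the kernel times the weight `w^(1-s)` is `w^(s-1)`, with integral
    -- `z^s/s`.
    rw [← lintegral_Ioo_rpow hs hz, ← lintegral_indicator measurableSet_Ioi,
      ← lintegral_indicator measurableSet_Ioo]
    refine lintegral_congr fun w => ?_
    by_cases hw : w ∈ Ioo 0 z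
    · have hw0 : 0 < w := hw.1
      rw [indicator_of_mem hw, indicator_of_mem (show w ∈ Ioi 0 from hw0), heightKernel,
        indicator_of_mem hw, ← ofReal_norm, Real.norm_of_nonneg (by positivity),
        ← ENNReal.ofReal_pow (by positivity), ← ENNReal.ofReal_mul (by positivity)]
      congr 1
      rw [sq, ← mul_assoc, ← Real.rpow_add hw0]
      simp
    · have : heightKernel s z w = 0 := indicator_of_notMem hw _
      simp [this, indicator_of_notMem hw]
  exact (lintegral_congr (μ := gauss N) this).trans_lt (by simp)

/-- Smooth approximation of `(z^s - w^s)₊ / s`. -/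
def heightProfile (s z : ℝ) (n : ℕ) (w : ℝ) : ℝ :=
  ramp (((n : ℝ) + 1) * (z ^ s / s - w ^ s / s)) / ((n : ℝ) + 1)

theorem hasDerivAt_heightProfile (hs : 0 < s) (z : ℝ) (n : ℕ) {w : ℝ} (hw : 0 < w) :
    HasDerivAt (heightProfile s z n)
      (-(w ^ (s - 1) * Real.smoothTransition (((n : ℝ) + 1) * (z ^ s / s - w ^ s / s)))) w := by
  have hn : (n : ℝ) + 1 ≠ 0 := by positivity
  have h1 : HasDerivAt (fun w : ℝ => ((n : ℝ) + 1) * (z ^ s / s - w ^ s / s))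
      (((n : ℝ) + 1) * (-(s * w ^ (s - 1) / s))) w :=
    (((Real.hasDerivAt_rpow_const (Or.inl hw.ne')).div_const s).const_sub _).const_mul _
  have h2 := ((hasDerivAt_ramp _).comp w h1).div_const ((n : ℝ) + 1)
  refine h2.congr_deriv ?_
  field_simp

theorem contDiffOn_heightProfile (s z : ℝ) (n : ℕ) :
    ContDiffOn ℝ (⊤ : ℕ∞) (fun p : Space N × ℝ => heightProfile s z n p.2) (upper N) := by
  intro p hp
  have hp0 : p.2 ≠ 0 := (show 0 < p.2 from hp).ne'
  refine ContDiffAt.contDiffWithinAt ?_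
  refine ContDiffAt.div_const ?_ _
  refine contDiff_ramp.contDiffAt.comp p ?_
  refine contDiffAt_const.mul (contDiffAt_const.sub (ContDiffAt.div_const ?_ _))
  exact contDiffAt_snd.rpow_const_of_ne hp0

theorem heightProfile_nonneg (s z : ℝ) (n : ℕ) (w : ℝ) : 0 ≤ heightProfile s z n w :=
  div_nonneg (ramp_nonneg _) (by positivity)

theorem heightProfile_le (hs : 0 < s) {z : ℝ} (hz : 0 < z) (n : ℕ) {w : ℝ} (hw : 0 ≤ w) :
    heightProfile s z n w ≤ z ^ s / s := by
  have hn : (0 : ℝ) < n + 1 := by positivity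
  rw [heightProfile, div_le_iff₀ hn]
  have h1 : ((n : ℝ) + 1) * (z ^ s / s - w ^ s / s) ≤ ((n : ℝ) + 1) * (z ^ s / s) := by
    gcongr
    have : 0 ≤ w ^ s / s := by positivity
    linarith
  calc _ ≤ ramp (((n : ℝ) + 1) * (z ^ s / s)) := monotone_ramp h1
    _ ≤ ((n : ℝ) + 1) * (z ^ s / s) := ramp_le_self (by positivity)
    _ = _ := mul_comm _ _

theorem tendsto_heightProfile (hs : 0 < s) (z : ℝ) (n : ℕ) :
    Tendsto (heightProfile s z n) (𝓝[>] 0) (𝓝 (heightProfile s z n 0)) := by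
  have hr : Continuous ramp := contDiff_ramp.continuous
  have h1 : Continuous (fun w : ℝ => w ^ s) := Real.continuous_rpow_const hs.le
  have : Continuous (heightProfile s z n) := by
    unfold heightProfile
    fun_prop
  exact (this.tendsto 0).mono_left nhdsWithin_le_nhds

end Flux
end FracGauss
end

noncomputable section
namespace FracGauss

/-! ### The flux inequality -/

section FluxInequality

variable {N : ℕ} {s : ℝ} {u : Space N → ℝ} {U : Space N × ℝ → ℝ} {X : Space N × ℝ → Space N × ℝ}

/-- On the values `0` and `1` every function is affine: `f(u) = f(0) + (f(1) - f(0)) u`. Subtracting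
the corresponding affine function of `U`, scaled by the profile at height `0`, cancels the trace of
profile times `f(U)`. -/
theorem IsSolution.hasTrace_profile (hs : 0 < s) (h : IsSolution s u U X)
    (hum : AEStronglyMeasurable u volume) (hu : ∀ x, u x = 0 ∨ u x = 1) {f f' : ℝ → ℝ} {C B : ℝ}
    (hf : ∀ r, HasDerivAt f (f' r) r) (hC : ∀ r, |f' r| ≤ C) (hB : ∀ r, |f r| ≤ B) {z : ℝ}
    (hz : 0 < z) (n : ℕ) :
    HasTrace (fun p => heightProfile s z n p.2 * f (U p) -
      (f 1 - f 0) * heightProfile s z n 0 * U p - f 0 * heightProfile s z n 0) (fun _ => 0) := by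
  set m := heightProfile s z n with hm
  set c := (f 1 - f 0) * m 0 with hc
  have hC0 : 0 ≤ C := (abs_nonneg _).trans (hC 0)
  have hB0 : 0 ≤ B := (abs_nonneg _).trans (hB 0)
  have hζ : 0 ≤ z ^ s / s := by positivity
  have h1 : HasTrace (fun p => (z ^ s / s * C + |c|) * |U p - u p.1|) (fun _ => 0) :=
    h.trace.of_le (C := z ^ s / s * C + |c|) fun p _ => by
      rw [sub_zero, abs_mul, abs_abs, abs_of_nonneg (by positivity)]
  -- The sign turns the difference in `HasTrace.sub` into the sum of the two nonnegative error
  -- bounds.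
  have h2 : HasTrace (N := N) (fun p => -(B * |m p.2 - m 0|)) (fun _ => 0) :=
    (hasTrace_comp_snd (tendsto_heightProfile hs z n)).of_le (C := B) fun p _ => by
      rw [sub_zero, abs_neg, abs_mul, abs_abs, abs_of_nonneg hB0]
  have hUm := aestronglyMeasurable_upper h.deriv.memLp
  have hm1 : AEStronglyMeasurable (fun p => (z ^ s / s * C + |c|) * |U p - u p.1|)
      (volume.restrict (upper N)) :=
    ((hUm.sub (hum.comp_fst (ν := volume)).restrict).norm).const_mul _
  have h3 := h1.sub h2 hm1 aestronglyMeasurable_const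
  refine h3.of_le (C := 1) fun p hp => ?_
  have hp0 : 0 < p.2 := hp
  simp only [sub_zero, sub_neg_eq_add, one_mul]
  -- The error splits into a part controlled by `|U - u|` and a part controlled by the oscillation
  -- of the profile near height `0`.
  have e : m p.2 * f (U p) - c * U p - f 0 * m 0 =
      (m p.2 * (f (U p) - f (u p.1)) - c * (U p - u p.1)) + (m p.2 - m 0) * f (u p.1) := by
    rcases hu p.1 with h | h <;> rw [h, hc] <;> ring
  rw [e]
  refine le_trans (abs_add_le _ _) (le_trans ?_ (le_abs_self _))
  refine add_le_add ((abs_sub _ _).trans ?_) ?_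
  · rw [abs_mul, abs_mul, add_mul, abs_of_nonneg (heightProfile_nonneg s z n p.2), mul_assoc]
    gcongr
    · exact heightProfile_le hs hz n hp0.le
    · exact abs_sub_le_of_hasDerivAt hf hC _ _
  · rw [abs_mul, mul_comm]
    gcongr
    exact hB _

theorem fderiv_heightProfile (hs : 0 < s) (z : ℝ) (n : ℕ) {p : Space N × ℝ} (hp : p ∈ upper N) :
    fderiv ℝ (fun q : Space N × ℝ => heightProfile s z n q.2) p =
      (-(p.2 ^ (s - 1) * Real.smoothTransition (((n : ℝ) + 1) * (z ^ s / s - p.2 ^ s / s)))) •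
        ContinuousLinearMap.snd ℝ (Space N) ℝ :=
  ((hasDerivAt_heightProfile hs z n hp).comp_hasFDerivAt p hasFDerivAt_snd).fderiv

/-- The derivative of the smoothed profile is dominated, uniformly in `n`, by the kernel to which it
converges: the transition lies in `[0, 1]` and vanishes at heights from `z` on. -/
theorem abs_mul_smoothTransition_le (hs : 0 < s) {z : ℝ} (hz : 0 < z) (n : ℕ) {w : ℝ} (hw : 0 < w) :
    |w ^ (s - 1) * Real.smoothTransition (((n : ℝ) + 1) * (z ^ s / s - w ^ s / s))| ≤
      heightKernel s z w := by
  by_cases hwz : w < z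
  · rw [heightKernel, indicator_of_mem (show w ∈ Ioo 0 z from ⟨hw, hwz⟩), abs_mul,
      abs_of_nonneg (Real.rpow_nonneg hw.le _), abs_of_nonneg (Real.smoothTransition.nonneg _)]
    exact mul_le_of_le_one_right (Real.rpow_nonneg hw.le _) (Real.smoothTransition.le_one _)
  · rw [Real.smoothTransition.zero_of_nonpos, mul_zero, abs_zero]
    · exact heightKernel_nonneg _ _ _
    · refine mul_nonpos_of_nonneg_of_nonpos (by positivity) (sub_nonpos.2 ?_)
      gcongr
      exact not_lt.1 hwz

theorem tendsto_mul_smoothTransition (hs : 0 < s) {z : ℝ} (hz : 0 < z) {w : ℝ} (hw : 0 < w) :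
    Tendsto (fun n : ℕ => w ^ (s - 1) *
      Real.smoothTransition (((n : ℝ) + 1) * (z ^ s / s - w ^ s / s))) atTop
      (𝓝 (heightKernel s z w)) := by
  by_cases hwz : w < z
  · rw [heightKernel, indicator_of_mem (show w ∈ Ioo 0 z from ⟨hw, hwz⟩)]
    have hpos : 0 < z ^ s / s - w ^ s / s := by
      rw [sub_pos]; gcongr
    have t1 : Tendsto (fun n : ℕ => (n : ℝ) + 1) atTop atTop :=
      tendsto_atTop_add_const_right _ _ tendsto_natCast_atTop_atTop
    refine tendsto_const_nhds.congr' ?_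
    filter_upwards [(t1.atTop_mul_const hpos).eventually_ge_atTop 1] with n hn
    rw [Real.smoothTransition.one_of_one_le hn, mul_one]
  · have h0 : heightKernel s z w = 0 := indicator_of_notMem (fun hcon => hwz hcon.2) _
    rw [h0]
    refine tendsto_const_nhds.congr fun n => ?_
    rw [Real.smoothTransition.zero_of_nonpos, mul_zero]
    refine mul_nonpos_of_nonneg_of_nonpos (by positivity) (sub_nonpos.2 ?_)
    gcongr
    exact not_lt.1 hwz

/-- The flux through horizontal slices, weighted by a nondecreasing function of the solution. -/
theorem IsSolution.neg_le_integral_flux (hs : 0 < s) (h : IsSolution s u U X)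
    (hum : AEStronglyMeasurable u volume) (hu : ∀ x, u x = 0 ∨ u x = 1) {f f' : ℝ → ℝ} {C B : ℝ}
    (hf : ∀ r, HasDerivAt f (f' r) r) (hf' : Continuous f') (hf0 : ∀ r, 0 ≤ f' r)
    (hC : ∀ r, f' r ≤ C) (hB : ∀ r, |f r| ≤ B) {z : ℝ} (hz : 0 < z) :
    -((f 1 - f 0) * (z ^ s / s) * dirichlet s X) ≤
      ∫ p, f (U p) * (X p).2 * heightKernel s z p.2 ∂wMeasure N s := by
  have hC' : ∀ r, |f' r| ≤ C := fun r => by rw [abs_of_nonneg (hf0 r)]; exact hC r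
  have hC0 : 0 ≤ C := (abs_nonneg _).trans (hC' 0)
  have hB0 : 0 ≤ B := (abs_nonneg _).trans (hB 0)
  have hfc : Continuous f := continuous_iff_continuousAt.2 fun r => (hf r).continuousAt
  have hfm : AEStronglyMeasurable (fun p => f (U p)) (wMeasure N s) :=
    hfc.comp_aestronglyMeasurable h.aestronglyMeasurable
  have hfm' : AEStronglyMeasurable (fun p => f' (U p)) (wMeasure N s) :=
    hf'.comp_aestronglyMeasurable h.aestronglyMeasurable
  have hmono : f 0 ≤ f 1 := monotone_of_deriv_nonneg (fun r => (hf r).differentiableAt)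
    (fun r => by rw [(hf r).deriv]; exact hf0 r) zero_le_one
  let κ : ℕ → Space N × ℝ → ℝ := fun n p => p.2 ^ (s - 1) *
    Real.smoothTransition (((n : ℝ) + 1) * (z ^ s / s - p.2 ^ s / s))
  have hκm : ∀ n, AEStronglyMeasurable (κ n) (wMeasure N s) := by
    intro n
    refine Measurable.aestronglyMeasurable ?_
    refine (measurable_snd.pow_const _).mul (Real.smoothTransition.continuous.measurable.comp ?_)
    exact (((measurable_snd.pow_const _).div_const _).const_sub _).const_mul _
  have hk := memLp_heightKernel N hs hz
  have hκ : ∀ n, MemLp (κ n) 2 (wMeasure N s) := fun n => hk.mono (hκm n) <| by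
    filter_upwards [ae_wMeasure_mem_upper] with p hp
    exact (abs_mul_smoothTransition_le hs hz n hp).trans (le_abs_self _)
  have hD := integrable_normSq h.memLp
  have hzX : MemLp (fun p => (X p).2) 2 (wMeasure N s) := h.memLp.snd
  have hiF : ∀ n, Integrable (fun p => f (U p) * (X p).2 * κ n p) (wMeasure N s) := by
    intro n
    have := (hzX.integrable_mul (hκ n)).bdd_mul hfm (Eventually.of_forall fun p => hB (U p))
    simpa only [Pi.mul_apply, mul_assoc] using this
  have hstep : ∀ n, -((f 1 - f 0) * (z ^ s / s) * dirichlet s X) ≤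
      ∫ p, f (U p) * (X p).2 * κ n p ∂wMeasure N s := by
    intro n
    set m : Space N × ℝ → ℝ := fun p => heightProfile s z n p.2 with hm
    set c := (f 1 - f 0) * heightProfile s z n 0 with hc
    have hm0 : ∀ p, 0 ≤ m p := fun p => heightProfile_nonneg _ _ _ _
    have hmb : ∀ᵐ p ∂wMeasure N s, |m p| ≤ z ^ s / s := by
      filter_upwards [ae_wMeasure_mem_upper] with p hp
      rw [abs_of_nonneg (hm0 p)]
      exact heightProfile_le hs hz n (le_of_lt hp)
    have hmm : AEStronglyMeasurable m (wMeasure N s) :=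
      ((contDiffOn_heightProfile s z n).continuousOn.aestronglyMeasurable
        (measurableSet_upper N)).mono_ac (wMeasure_absolutelyContinuous N s)
    -- The test function is `m f(U) - c U - const`, of zero trace. Its pairing with the gradient is
    -- `m f'(U) |∇U|²`, minus the flux weighted by `κ n`, minus `c |∇U|²`.
    have hd := (((h.deriv.comp hf hf' hC').contDiffOn_mul
      (contDiffOn_heightProfile s z n)).sub (h.deriv.const_mul c)).sub
      (hasWeakDeriv_const (f 0 * heightProfile s z n 0))
    have htr := h.hasTrace_profile hs hum hu hf hC' hB hz n
    have hg : MemLp (fun p => (m p • f' (U p) • toCovector (X p).1 (X p).2 +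
        f (U p) • fderiv ℝ m p - c • toCovector (X p).1 (X p).2) - 0) 2 (wMeasure N s) := by
      have g1 := memLp_bdd_smul (memLp_bdd_smul h.memLp_deriv hfm'
        (Eventually.of_forall fun p => hC' (U p))) hmm hmb
      have g2 : MemLp (fun p => (-κ n p) • ContinuousLinearMap.snd ℝ (Space N) ℝ) 2 (wMeasure N s) :=
        memLp_clm_comp (G := Space N × ℝ →L[ℝ] ℝ)
          (ContinuousLinearMap.toSpanSingleton ℝ (ContinuousLinearMap.snd ℝ (Space N) ℝ))
          (hκ n).neg
      have g3 := memLp_bdd_smul g2 hfm (Eventually.of_forall fun p => hB (U p))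
      refine (memLp_add (memLp_add g1 g3) (memLp_const_smul h.memLp_deriv (-c))).ae_eq ?_
      filter_upwards [ae_wMeasure_mem_upper] with p hp
      rw [hm, fderiv_heightProfile hs z n hp, sub_zero, neg_smul c, sub_eq_add_neg]
    have key := hd.integral_apply_eq_zero hs hg htr h.memLp h.weak
    have hi1 : Integrable (fun p => m p * (f' (U p) * normSq (X p))) (wMeasure N s) :=
      (hD.bdd_mul hfm' (Eventually.of_forall fun p => hC' (U p))).bdd_mul hmm hmb
    have e : ∫ p, (m p * (f' (U p) * normSq (X p)) - f (U p) * (X p).2 * κ n p -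
        c * normSq (X p)) ∂wMeasure N s = 0 := by
      rw [← key]
      refine integral_congr_ae ?_
      filter_upwards [ae_wMeasure_mem_upper] with p hp
      rw [fderiv_heightProfile hs z n hp]
      simp only [add_apply, sub_apply, smul_apply, toCovector_self, smul_eq_mul,
        ContinuousLinearMap.coe_snd', zero_apply, κ, m]
      ring
    have hi12 := hi1.sub (hiF n)
    simp only [Pi.sub_def] at hi12
    rw [integral_sub hi12 (hD.const_mul c), integral_sub hi1 (hiF n), integral_const_mul] at e
    -- Monotonicity of `f` is used here: the bulk term has a sign and is discarded.
    have hnn : 0 ≤ ∫ p, m p * (f' (U p) * normSq (X p)) ∂wMeasure N s :=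
      integral_nonneg fun p => mul_nonneg (hm0 p) (mul_nonneg (hf0 _) (normSq_nonneg _))
    have hcle : c * dirichlet s X ≤ (f 1 - f 0) * (z ^ s / s) * dirichlet s X := by
      rw [hc]
      have := dirichlet_nonneg s X
      gcongr
      exact heightProfile_le hs hz n le_rfl
    simp only [dirichlet] at hcle ⊢
    linarith
  refine ge_of_tendsto (tendsto_integral_of_dominated_convergence
    (fun p => B * (|(X p).2| * heightKernel s z p.2)) (fun n => (hiF n).1) ?_ (fun n => ?_) ?_)
    (Eventually.of_forall hstep)
  · exact (hzX.abs.integrable_mul hk).const_mul B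
  · filter_upwards [ae_wMeasure_mem_upper] with p hp
    rw [norm_mul, norm_mul, mul_assoc]
    gcongr
    exacts [hB _, le_rfl, abs_mul_smoothTransition_le hs hz n hp]
  · filter_upwards [ae_wMeasure_mem_upper] with p hp
    exact (tendsto_mul_smoothTransition hs hz hp).const_mul _

end FluxInequality
end FracGauss
end

noncomputable section
namespace FracGauss

/-! ### Estimates on horizontal slices -/

section Slices

variable {N : ℕ} {s : ℝ}

theorem integrable_gauss_of_integrable_wMeasure {f : Space N × ℝ → ℝ}
    (hf : Integrable f (wMeasure N s)) :
    Integrable (fun p => f p * p.2 ^ (1 - s)) (((gauss N).prod volume).restrict (upper N)) := by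
  have hm : AEStronglyMeasurable f (((gauss N).prod volume).restrict (upper N)) :=
    hf.1.mono_ac ((gauss_prod_restrict_absolutelyContinuous N _).trans
      (absolutelyContinuous_wMeasure N s))
  refine ⟨hm.mul (measurable_snd.pow_const _).aestronglyMeasurable, ?_⟩
  have h := hf.2
  rw [HasFiniteIntegral, lintegral_wMeasure_eq] at h
  refine lt_of_le_of_lt (setLIntegral_mono' (measurableSet_upper N) fun p hp => ?_) h
  have hp : 0 < p.2 := hp
  rw [enorm_mul, mul_comm, Real.enorm_of_nonneg (by positivity)]

/-- Fubini; the kernel `w^(s-1)` on heights below `z` undoes the weight `w^(1-s)`. It converts the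
weighted flux into the increment of a slice integral. -/
theorem integral_vertPrim_slice (hs : 0 < s) {g : Space N × ℝ → ℝ} (hg : MemLp g 2 (wMeasure N s))
    {z : ℝ} (hz : 0 < z) :
    ∫ x, vertPrim g (x, z) ∂gauss N = ∫ p, g p * heightKernel s z p.2 ∂wMeasure N s := by
  have hi : Integrable (fun p => g p * heightKernel s z p.2) (wMeasure N s) :=
    hg.integrable_mul (memLp_heightKernel N hs hz)
  have hi' := integrable_gauss_of_integrable_wMeasure hi
  rw [integral_wMeasure_eq, gauss_restrict_upper_eq_prod, integral_prod _
    (by rwa [← gauss_restrict_upper_eq_prod])]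
  refine integral_congr_ae (Eventually.of_forall fun x => ?_)
  simp only [vertPrim]
  rw [← integral_indicator measurableSet_Ioi, ← integral_indicator measurableSet_Ioo]
  congr 1
  ext w
  by_cases hw : w ∈ Ioo 0 z
  · have hw0 : 0 < w := hw.1
    have e : heightKernel s z w = w ^ (s - 1) := indicator_of_mem hw _
    rw [indicator_of_mem hw, indicator_of_mem (show w ∈ Ioi 0 from hw0), e, mul_assoc,
      ← Real.rpow_add hw0]
    simp
  · have e : heightKernel s z w = 0 := indicator_of_notMem hw _
    rw [indicator_of_notMem hw]
    simp [indicator, e]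

/-- A bounded function that does not depend on the height has weak vertical derivative zero. -/
theorem integral_fst_mul_fderiv_eq_zero {a : Space N → ℝ} {B : ℝ} (ham : AEStronglyMeasurable a volume)
    (hB : ∀ x, |a x| ≤ B) {η : Space N × ℝ → ℝ} (hη : IsTest η) :
    ∫ p in upper N, a p.1 * fderiv ℝ η p (0, 1) = 0 := by
  have hi : Integrable (fun p : Space N × ℝ => a p.1 * fderiv ℝ η p (0, 1)) :=
    ((hη.continuous_fderiv_apply (0, 1)).integrable_of_hasCompactSupport
      (hη.hasCompactSupport_fderiv (0, 1))).bdd_mul (ham.comp_fst (ν := volume))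
      (Eventually.of_forall fun p => hB p.1)
  have hi' := hi.restrict (s := upper N)
  rw [restrict_upper_eq_prod] at hi' ⊢
  rw [integral_prod _ hi']
  refine integral_eq_zero_of_ae (Eventually.of_forall fun x => ?_)
  simp only [Pi.zero_apply]
  rw [integral_const_mul]
  have hd : ∀ w, HasDerivAt (fun w => η (x, w)) (fderiv ℝ η (x, w) (0, 1)) w := fun w =>
    ((hη.smooth.differentiable (by norm_num)) (x, w)).hasFDerivAt.comp_hasDerivAt w
      ((hasDerivAt_const w x).prodMk (hasDerivAt_id w))
  have hc : HasCompactSupport (fun w => η (x, w)) :=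
    hη.compact.comp_isClosedEmbedding
      ⟨Topology.IsEmbedding.of_comp (by fun_prop) continuous_snd Topology.IsEmbedding.id, by
        have : range (fun w : ℝ => (x, w)) = Prod.fst ⁻¹' {x} := by
          ext ⟨a, b⟩; simp [eq_comm]
        rw [this]; exact isClosed_singleton.preimage continuous_fst⟩
  have h1 : ContDiff ℝ 1 (fun w => η (x, w)) :=
    (hη.smooth.of_le (by norm_num)).comp (contDiff_const.prodMk contDiff_id)
  have h2 := hc.integral_Ioi_deriv_eq h1 0
  rw [show deriv (fun w => η (x, w)) = fun w => fderiv ℝ η (x, w) (0, 1) from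
    funext fun w => (hd w).deriv] at h2
  have h3 : η (x, 0) = 0 := image_eq_zero_of_notMem_tsupport fun hcon =>
    lt_irrefl (0 : ℝ) (hη.support hcon)
  rw [h2, h3]
  simp

variable {u : Space N → ℝ} {U : Space N × ℝ → ℝ} {X : Space N × ℝ → Space N × ℝ}

/-- The increment of a function of the solution along vertical lines. -/
theorem IsSolution.ae_eq_vertPrim_comp (hs : 0 < s) (h : IsSolution s u U X)
    (hum : AEStronglyMeasurable u volume) (hu : ∀ x, u x ∈ Icc (0 : ℝ) 1) {G f : ℝ → ℝ} {B : ℝ}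
    (hG : ∀ r, HasDerivAt G (f r) r) (hf : Continuous f) (hB : ∀ r, |f r| ≤ B) :
    ∀ᵐ p ∂volume.restrict (upper N),
      G (U p) - G (u p.1) = vertPrim (fun p => f (U p) * (X p).2) p := by
  have hGc : Continuous G := continuous_iff_continuousAt.2 fun r => (hG r).continuousAt
  have hd := h.deriv.comp hG hf hB
  have hum' : AEStronglyMeasurable (fun x => G (u x)) volume := hGc.comp_aestronglyMeasurable hum
  obtain ⟨A, hA⟩ := (isCompact_Icc (a := (0 : ℝ)) (b := 1)).exists_bound_of_continuousOn
    hGc.continuousOn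
  have hA' : ∀ x, |G (u x)| ≤ A := fun x => hA _ (hu x)
  have hGu : ∀ K ⊆ upper N, IsCompact K →
      MemLp (fun p : Space N × ℝ => G (u p.1)) 2 (volume.restrict K) := fun K _ hc => by
    have : IsFiniteMeasure (volume.restrict K) := ⟨by simpa using hc.measure_lt_top⟩
    exact MemLp.of_bound ((hum'.comp_fst (ν := volume)).restrict) A
      (Eventually.of_forall fun p => hA' p.1)
  have hg : MemLp (fun p => f (U p) * (X p).2) 2 (wMeasure N s) :=
    memLp_bdd_smul h.memLp.snd (hf.comp_aestronglyMeasurable h.aestronglyMeasurable)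
      (Eventually.of_forall fun p => hB (U p))
  -- The boundary function `u` is merely measurable and has no weak horizontal gradient in general.
  -- It is constant in height, so the difference `G(U) - G(u)` still has a weak vertical derivative,
  -- which is all that is needed.
  refine ae_eq_vertPrim hs (fun K hK hc => (hd.memLp K hK hc).sub (hGu K hK hc)) hg
    (fun η hη => ?_) ?_
  · have h1 := hd.weak η hη (0, 1)
    have h2 := integral_fst_mul_fderiv_eq_zero hum' hA' hη
    simp only [sub_mul]
    rw [integral_sub (hη.integrable_mul_fderiv hd.memLp _).integrableOn
      (hη.integrable_mul_fderiv hGu _).integrableOn, h1, h2, sub_zero]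
    simp
  · refine h.trace.of_le (C := B) fun p _ => ?_
    rw [sub_zero]
    exact abs_sub_le_of_hasDerivAt hG hB _ _

/-- An inequality between continuous functions on `(0, ∞)` that holds almost everywhere holds
everywhere. -/
theorem le_of_ae_le_Ioi {F R : ℝ → ℝ} (hF : ContinuousOn F (Ioi 0)) (hR : ContinuousOn R (Ioi 0))
    (h : ∀ᵐ z ∂volume.restrict (Ioi (0 : ℝ)), F z ≤ R z) {z : ℝ} (hz : 0 < z) : F z ≤ R z := by
  -- The inequality is phrased as the equality `max F R = R`, to which the uniqueness of continuous
  -- representatives applies.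
  have h1 : EqOn (fun z => max (F z) (R z)) R (Ioi 0) :=
    Measure.eqOn_open_of_ae_eq (μ := volume) (by filter_upwards [h] with z hz using max_eq_right hz)
      isOpen_Ioi (hF.sup hR) hR
  exact (le_max_left _ _).trans_eq (h1 hz)

theorem continuousOn_slice (hUc : ContinuousOn U (upper N)) {z : ℝ} (hz : 0 < z) :
    Continuous (fun x => U (x, z)) :=
  continuousOn_univ.1 (hUc.comp (by fun_prop) fun _ _ => hz)

theorem integrable_comp_slice (hUc : ContinuousOn U (upper N))
    (hU : ∀ p ∈ upper N, U p ∈ Icc (0 : ℝ) 1) {G : ℝ → ℝ} (hG : Continuous G)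
    {z : ℝ} (hz : 0 < z) : Integrable (fun x => G (U (x, z))) (gauss N) := by
  obtain ⟨A, hA⟩ := (isCompact_Icc (a := (0 : ℝ)) (b := 1)).exists_bound_of_continuousOn
    hG.continuousOn
  exact Integrable.of_bound (hG.comp (continuousOn_slice hUc hz)).aestronglyMeasurable A
    (Eventually.of_forall fun x => hA _ (hU (x, z) hz))

theorem integrable_comp_boundary (hum : AEStronglyMeasurable u volume)
    (hu : ∀ x, u x ∈ Icc (0 : ℝ) 1) {G : ℝ → ℝ} (hG : Continuous G) :
    Integrable (fun x => G (u x)) (gauss N) := by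
  obtain ⟨A, hA⟩ := (isCompact_Icc (a := (0 : ℝ)) (b := 1)).exists_bound_of_continuousOn
    hG.continuousOn
  exact Integrable.of_bound (hG.comp_aestronglyMeasurable
    (hum.mono_ac (gauss_absolutelyContinuous N))) A (Eventually.of_forall fun x => hA _ (hu x))

theorem continuousOn_integral_slice (hum : AEStronglyMeasurable u volume)
    (hu : ∀ x, u x ∈ Icc (0 : ℝ) 1) (hUc : ContinuousOn U (upper N))
    (hU : ∀ p ∈ upper N, U p ∈ Icc (0 : ℝ) 1) {Φ : ℝ × ℝ → ℝ} (hΦ : Continuous Φ) :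
    ContinuousOn (fun z => ∫ x, Φ (u x, U (x, z)) ∂gauss N) (Ioi 0) := by
  obtain ⟨A, hA⟩ := ((isCompact_Icc (a := (0 : ℝ)) (b := 1)).prod
    (isCompact_Icc (a := (0 : ℝ)) (b := 1))).exists_bound_of_continuousOn hΦ.continuousOn
  refine continuousOn_of_dominated (bound := fun _ => A) (fun z hz => ?_) (fun z hz => ?_)
    (integrable_const A) (Eventually.of_forall fun x => ?_)
  · exact hΦ.comp_aestronglyMeasurable ((hum.mono_ac (gauss_absolutelyContinuous N)).prodMk
      (continuousOn_slice hUc hz).aestronglyMeasurable)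
  · exact Eventually.of_forall fun x => hA _ ⟨hu x, hU (x, z) hz⟩
  · exact hΦ.comp_continuousOn (continuousOn_const.prodMk
      (hUc.comp (by fun_prop) fun z hz => hz))

theorem continuousOn_rpow_div (s : ℝ) (c : ℝ) : ContinuousOn (fun z : ℝ => c * (z ^ s / s)) (Ioi 0) :=
  continuousOn_const.mul ((continuousOn_id.rpow_const fun _ hz => Or.inl (ne_of_gt hz)).div_const s)

/-- The loss of a convex integral between the boundary and height `z` is minus the flux weighted by
`f(U)`. The identity holds on almost every slice; since both sides of the inequality depend
continuously on the height, it extends to every slice. -/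
theorem IsSolution.integral_comp_sub_le (hs : 0 < s) (h : IsSolution s u U X)
    (hum : AEStronglyMeasurable u volume) (hu : ∀ x, u x = 0 ∨ u x = 1)
    (hUc : ContinuousOn U (upper N)) (hU : ∀ p ∈ upper N, U p ∈ Icc (0 : ℝ) 1)
    {G f f' : ℝ → ℝ} {C B : ℝ} (hG : ∀ r, HasDerivAt G (f r) r)
    (hf : ∀ r, HasDerivAt f (f' r) r) (hf' : Continuous f') (hf0 : ∀ r, 0 ≤ f' r)
    (hC : ∀ r, f' r ≤ C) (hB : ∀ r, |f r| ≤ B) {z : ℝ} (hz : 0 < z) :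
    ∫ x, (G (u x) - G (U (x, z))) ∂gauss N ≤ (f 1 - f 0) * dirichlet s X * (z ^ s / s) := by
  have hu' : ∀ x, u x ∈ Icc (0 : ℝ) 1 := fun x => by rcases hu x with h | h <;> simp [h]
  have hGc : Continuous G := continuous_iff_continuousAt.2 fun r => (hG r).continuousAt
  have hfc : Continuous f := continuous_iff_continuousAt.2 fun r => (hf r).continuousAt
  refine le_of_ae_le_Ioi (F := fun z => ∫ x, (G (u x) - G (U (x, z))) ∂gauss N)
    (R := fun z => (f 1 - f 0) * dirichlet s X * (z ^ s / s))
    (continuousOn_integral_slice hum hu' hUc hU (Φ := fun q => G q.1 - G q.2) (by fun_prop))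
    (continuousOn_rpow_div s _) ?_ hz
  have hg : MemLp (fun p => f (U p) * (X p).2) 2 (wMeasure N s) :=
    memLp_bdd_smul h.memLp.snd (hfc.comp_aestronglyMeasurable h.aestronglyMeasurable)
      (Eventually.of_forall fun p => hB (U p))
  filter_upwards [ae_ae_horizontal (h.ae_eq_vertPrim_comp hs hum hu' hG hfc hB),
    ae_restrict_mem measurableSet_Ioi] with w hw hw0
  have e : ∫ x, (G (u x) - G (U (x, w))) ∂gauss N =
      - ∫ x, vertPrim (fun p => f (U p) * (X p).2) (x, w) ∂gauss N := by
    rw [← integral_neg]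
    refine integral_congr_ae ?_
    filter_upwards [ae_gauss_iff.2 hw] with x hx
    rw [← hx]; ring
  rw [e, integral_vertPrim_slice hs hg hw0]
  have := h.neg_le_integral_flux hs hum hu hf hf' hf0 hC hB hw0
  linarith

/-- `U - u` is the vertical primitive of `∂_z U`, whose slice norm is controlled by the vertical
part of the energy alone. Continuity in the height again passes from almost every slice to all of
them. -/
theorem IsSolution.integral_sq_sub_le (hs : 0 < s) (h : IsSolution s u U X)
    (hum : AEStronglyMeasurable u volume) (hu : ∀ x, u x ∈ Icc (0 : ℝ) 1)
    (hUc : ContinuousOn U (upper N)) (hU : ∀ p ∈ upper N, U p ∈ Icc (0 : ℝ) 1)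
    {z : ℝ} (hz : 0 < z) :
    ∫ x, (U (x, z) - u x) ^ 2 ∂gauss N ≤ dirichlet s X * (z ^ s / s) := by
  refine le_of_ae_le_Ioi (F := fun z => ∫ x, (U (x, z) - u x) ^ 2 ∂gauss N)
    (R := fun z => dirichlet s X * (z ^ s / s))
    (continuousOn_integral_slice hum hu hUc hU (Φ := fun q => (q.2 - q.1) ^ 2) (by fun_prop))
    (continuousOn_rpow_div s _) ?_ hz
  have hv := h.ae_eq_vertPrim_comp hs hum hu (G := fun r => r) (f := fun _ => 1) (B := 1)
    hasDerivAt_id continuous_const (by simp)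
  simp only [one_mul] at hv
  filter_upwards [ae_ae_horizontal hv, ae_restrict_mem measurableSet_Ioi] with w hw hw0
  have hw0 : 0 < w := hw0
  have h1 := lintegral_vertPrim_slice hs h.memLp.snd.1 hw0
  have h2 : ∫⁻ x, ENNReal.ofReal ((U (x, w) - u x) ^ 2) ∂gauss N ≤
      ENNReal.ofReal (w ^ s / s) * ENNReal.ofReal (dirichlet s X) := by
    refine le_trans (lintegral_mono_ae ?_) (h1.trans ?_)
    · filter_upwards [ae_gauss_iff.2 hw] with x hx
      rw [← hx, ← ofReal_norm, ← ENNReal.ofReal_pow (norm_nonneg _), Real.norm_eq_abs, sq_abs]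
    · gcongr
      rw [dirichlet, ofReal_integral_eq_lintegral_ofReal (integrable_normSq h.memLp)
        (Eventually.of_forall fun _ => normSq_nonneg _)]
      refine lintegral_mono fun p => ?_
      rw [← ofReal_norm, ← ENNReal.ofReal_pow (norm_nonneg _), Real.norm_eq_abs, sq_abs]
      exact ENNReal.ofReal_le_ofReal (le_add_of_nonneg_left (sq_nonneg _))
  rw [← ENNReal.ofReal_mul (by positivity)] at h2
  have hm : AEStronglyMeasurable (fun x => (U (x, w) - u x) ^ 2) (gauss N) :=
    (((continuousOn_slice hUc hw0).aestronglyMeasurable).sub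
      (hum.mono_ac (gauss_absolutelyContinuous N))).pow 2
  rw [integral_eq_lintegral_of_nonneg_ae (Eventually.of_forall fun _ => sq_nonneg _) hm, mul_comm]
  refine ENNReal.toReal_le_of_le_ofReal ?_ h2
  have := dirichlet_nonneg s X
  positivity

end Slices
end FracGauss
end

noncomputable section
namespace FracGauss

/-! ### Superlevel sets close to the boundary -/

section Superlevel

/-- A smooth convex approximation of `r ↦ |r - t| - (1 - 2t) r`. -/
def tiltedAbs (ε t r : ℝ) : ℝ := √((r - t) ^ 2 + ε ^ 2) - (1 - 2 * t) * r

theorem hasDerivAt_sqrt_sq_add {ε : ℝ} (hε : 0 < ε) (t r : ℝ) :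
    HasDerivAt (fun r => √((r - t) ^ 2 + ε ^ 2)) ((r - t) / √((r - t) ^ 2 + ε ^ 2)) r := by
  have hp : (r - t) ^ 2 + ε ^ 2 ≠ 0 := by positivity
  have h := (((((hasDerivAt_id r).sub_const t).pow 2).add_const (ε ^ 2))).sqrt hp
  refine h.congr_deriv ?_
  simp only [id, Pi.pow_apply]
  norm_num
  ring

theorem hasDerivAt_tiltedAbs {ε : ℝ} (hε : 0 < ε) (t r : ℝ) :
    HasDerivAt (tiltedAbs ε t) ((r - t) / √((r - t) ^ 2 + ε ^ 2) - (1 - 2 * t)) r := by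
  have h := (hasDerivAt_sqrt_sq_add hε t r).sub ((hasDerivAt_id r).const_mul (1 - 2 * t))
  exact h.congr_deriv (by rw [mul_one])

theorem hasDerivAt_div_sqrt {ε : ℝ} (hε : 0 < ε) (t r : ℝ) :
    HasDerivAt (fun r => (r - t) / √((r - t) ^ 2 + ε ^ 2) - (1 - 2 * t))
      (ε ^ 2 / √((r - t) ^ 2 + ε ^ 2) ^ 3) r := by
  have hp : 0 < (r - t) ^ 2 + ε ^ 2 := by positivity
  have hq : √((r - t) ^ 2 + ε ^ 2) ≠ 0 := (Real.sqrt_pos.2 hp).ne'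
  have h := (((hasDerivAt_id r).sub_const t).div (hasDerivAt_sqrt_sq_add hε t r) hq).sub_const
    (1 - 2 * t)
  refine h.congr_deriv ?_
  have hs := Real.sq_sqrt hp.le
  simp only [id]
  field_simp
  rw [hs]
  ring

theorem abs_le_sqrt_sq_add (ε t r : ℝ) : |r - t| ≤ √((r - t) ^ 2 + ε ^ 2) :=
  Real.abs_le_sqrt (le_add_of_nonneg_right (sq_nonneg ε))

theorem sqrt_sq_add_le {ε : ℝ} (hε : 0 < ε) (t r : ℝ) : √((r - t) ^ 2 + ε ^ 2) ≤ |r - t| + ε := by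
  refine Real.sqrt_le_iff.2 ⟨by positivity, ?_⟩
  nlinarith [abs_nonneg (r - t), sq_abs (r - t)]

theorem abs_div_sqrt_le (ε t r : ℝ) :
    |(r - t) / √((r - t) ^ 2 + ε ^ 2)| ≤ 1 := by
  rw [abs_div, abs_of_nonneg (Real.sqrt_nonneg _)]
  exact div_le_one_of_le₀ (abs_le_sqrt_sq_add ε t r) (Real.sqrt_nonneg _)

variable {N : ℕ} {s : ℝ} {u : Space N → ℝ} {U : Space N × ℝ → ℝ} {X : Space N × ℝ → Space N × ℝ}

/-- The convex estimate applied to `tiltedAbs`, letting `ε` tend to zero. The linear tilt does not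
affect the increment of the derivative between `0` and `1`, which is at most `2` as for the absolute
value. -/
theorem IsSolution.integral_abs_sub_le (hs : 0 < s) (h : IsSolution s u U X)
    (hum : AEStronglyMeasurable u volume) (hu : ∀ x, u x = 0 ∨ u x = 1)
    (hUc : ContinuousOn U (upper N)) (hU : ∀ p ∈ upper N, U p ∈ Icc (0 : ℝ) 1) (t : ℝ)
    {z : ℝ} (hz : 0 < z) :
    ∫ x, (|u x - t| - |U (x, z) - t| + (1 - 2 * t) * (U (x, z) - u x)) ∂gauss N ≤
      2 * (dirichlet s X * (z ^ s / s)) := by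
  have hu' : ∀ x, u x ∈ Icc (0 : ℝ) 1 := fun x => by rcases hu x with h | h <;> simp [h]
  refine le_of_forall_pos_le_add fun ε hε => ?_
  have hq : ∀ r, 0 < √((r - t) ^ 2 + ε ^ 2) := fun r => Real.sqrt_pos.2 (by positivity)
  have hc : Continuous (fun r : ℝ => √((r - t) ^ 2 + ε ^ 2)) := by fun_prop
  have hle := h.integral_comp_sub_le hs hum hu hUc hU (C := ε⁻¹) (B := 1 + |1 - 2 * t|)
    (hasDerivAt_tiltedAbs hε t) (hasDerivAt_div_sqrt hε t)
    (continuous_const.div (hc.pow 3) fun r => (pow_pos (hq r) 3).ne')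
    (fun r => by positivity) (fun r => by
      have h1 : ε ≤ √((r - t) ^ 2 + ε ^ 2) :=
        Real.le_sqrt_of_sq_le (le_add_of_nonneg_left (sq_nonneg _))
      rw [inv_eq_one_div, div_le_div_iff₀ (pow_pos (hq r) 3) hε, one_mul]
      calc ε ^ 2 * ε = ε ^ 3 := by ring
        _ ≤ _ := by gcongr)
    (fun r => (abs_sub _ _).trans (by gcongr; exact abs_div_sqrt_le ε t r)) hz
  have hcabs : Continuous (fun r : ℝ => |r - t|) := by fun_prop
  have hcl : Continuous (fun r : ℝ => r) := continuous_id
  have hGc : Continuous (tiltedAbs ε t) := by unfold tiltedAbs; fun_prop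
  have i1 := integrable_comp_boundary hum hu' hcabs
  have i2 := integrable_comp_slice hUc hU hcabs hz
  have i3 := integrable_comp_boundary hum hu' hcl
  have i4 := integrable_comp_slice hUc hU hcl hz
  have i5 := integrable_comp_boundary hum hu' hGc
  have i6 := integrable_comp_slice hUc hU hGc hz
  calc ∫ x, (|u x - t| - |U (x, z) - t| + (1 - 2 * t) * (U (x, z) - u x)) ∂gauss N
      ≤ ∫ x, ((tiltedAbs ε t (u x) - tiltedAbs ε t (U (x, z))) + ε) ∂gauss N := by
        refine integral_mono ((i1.sub i2).add ((i4.sub i3).const_mul _))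
          ((i5.sub i6).add (integrable_const ε)) fun x => ?_
        have h1 := abs_le_sqrt_sq_add ε t (u x)
        have h2 := sqrt_sq_add_le hε t (U (x, z))
        simp only [tiltedAbs]
        linarith
    _ = (∫ x, (tiltedAbs ε t (u x) - tiltedAbs ε t (U (x, z))) ∂gauss N) + ε := by
        have i56 : Integrable (fun x => tiltedAbs ε t (u x) - tiltedAbs ε t (U (x, z))) (gauss N) :=
          i5.sub i6
        rw [integral_add i56 (integrable_const ε)]
        simp
    _ ≤ _ := by
        refine add_le_add (hle.trans ?_) le_rfl
        rw [← mul_assoc]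
        -- The derivative of the smoothed absolute value lies in `[-1, 1]`, whence the factor `2`.
        have h1 := (abs_le.1 (abs_div_sqrt_le ε t 1)).2
        have h2 := (abs_le.1 (abs_div_sqrt_le ε t 0)).1
        have h3 := dirichlet_nonneg s X
        gcongr
        linarith

/-- The defect that controls the difference between a set and the superlevel sets. -/
def levelDefect (t a r : ℝ) : ℝ :=
  4 / 3 * (r - a) ^ 2 + 8 / 3 * (|a - t| - |r - t| + (1 - 2 * t) * (r - a))

/-- For `a` in `{0, 1}` and `r` in `[0, 1]` the second bracket equals `2 min (r (1 - t)) (t (1 -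
r))`, irrespective of `a`. The tilt by `1 - 2t` is chosen for this: it makes the convex function
agree at `0` and `1`. -/
theorem levelDefect_nonneg {t a r : ℝ} (ht : t ∈ Icc (1 / 4 : ℝ) (3 / 4)) (ha : a = 0 ∨ a = 1)
    (hr : r ∈ Icc (0 : ℝ) 1) : 0 ≤ levelDefect t a r := by
  obtain ⟨h1, h2⟩ := ht
  obtain ⟨h3, h4⟩ := hr
  unfold levelDefect
  rcases ha with rfl | rfl <;> rcases le_total r t with h | h
  · rw [abs_of_nonpos (by linarith : (0 : ℝ) - t ≤ 0), abs_of_nonpos (by linarith : r - t ≤ 0)]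
    nlinarith
  · rw [abs_of_nonpos (by linarith : (0 : ℝ) - t ≤ 0), abs_of_nonneg (by linarith : 0 ≤ r - t)]
    nlinarith
  · rw [abs_of_nonneg (by linarith : (0 : ℝ) ≤ 1 - t), abs_of_nonpos (by linarith : r - t ≤ 0)]
    nlinarith
  · rw [abs_of_nonneg (by linarith : (0 : ℝ) ≤ 1 - t), abs_of_nonneg (by linarith : 0 ≤ r - t)]
    nlinarith

/-- If `a = 1` and `r ≤ t`, the bracket is `2 r (1 - t) ≥ r/2`, so the defect is at least `4/3 * ((1
- r)² + r) = 4/3 * (1 - r + r²) ≥ 1`, since `1 - r + r² ≥ 3/4`. The other case is symmetric under `r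
↦ 1 - r`, `t ↦ 1 - t`. The coefficients `4/3` and `8/3` are tuned to this computation. -/
theorem one_le_levelDefect {t a r : ℝ} (ht : t ∈ Icc (1 / 4 : ℝ) (3 / 4)) (hr : r ∈ Icc (0 : ℝ) 1)
    (h : a = 1 ∧ r ≤ t ∨ a = 0 ∧ t < r) : 1 ≤ levelDefect t a r := by
  obtain ⟨h1, h2⟩ := ht
  obtain ⟨h3, h4⟩ := hr
  unfold levelDefect
  rcases h with ⟨rfl, h⟩ | ⟨rfl, h⟩
  · rw [abs_of_nonneg (by linarith : (0 : ℝ) ≤ 1 - t), abs_of_nonpos (by linarith : r - t ≤ 0)]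
    nlinarith [mul_nonneg h3 (sub_nonneg.2 h2), sq_nonneg (r - 1 / 2)]
  · rw [abs_of_nonpos (by linarith : (0 : ℝ) - t ≤ 0), abs_of_nonneg (by linarith : 0 ≤ r - t)]
    nlinarith [mul_nonneg (sub_nonneg.2 h4) (sub_nonneg.2 h1), sq_nonneg (r - 1 / 2)]

/-- The indicator of the symmetric difference lies below the defect, and the integral of the defect
is at most `4/3 + 8/3 * 2 = 20/3` times `D z^s/s`. -/
theorem IsSolution.symmDiff_superlevel_le (hs : 0 < s) {E : Set (Space N)}
    (hE : NullMeasurableSet E volume) (h : IsSolution s (E.indicator 1) U X)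
    (hUc : ContinuousOn U (upper N)) {t : ℝ} (ht : t ∈ Icc (1 / 4 : ℝ) (3 / 4)) {z : ℝ}
    (hz : 0 < z) :
    (gauss N).real (symmDiff E (superlevel U t z)) ≤ 20 / 3 * (dirichlet s X * (z ^ s / s)) := by
  set u : Space N → ℝ := E.indicator 1 with hudef
  have hu : ∀ x, u x = 0 ∨ u x = 1 := fun x => by
    by_cases hx : x ∈ E <;> simp [hudef, hx]
  have hu' : ∀ x, u x ∈ Icc (0 : ℝ) 1 := fun x => by rcases hu x with h | h <;> simp [h]
  have hum : AEStronglyMeasurable u volume :=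
    (aemeasurable_const (b := (1 : ℝ))).indicator₀ hE |>.aestronglyMeasurable
  have hU : ∀ p ∈ upper N, U p ∈ Icc (0 : ℝ) 1 := fun p hp => h.mem_Icc hs hUc hu' hp
  have hcabs : Continuous (fun r : ℝ => |r - t|) := by fun_prop
  have hcl : Continuous (fun r : ℝ => r) := continuous_id
  have i1 := integrable_comp_boundary hum hu' hcabs
  have i2 := integrable_comp_slice hUc hU hcabs hz
  have i3 := integrable_comp_boundary hum hu' hcl
  have i4 := integrable_comp_slice hUc hU hcl hz
  have j1 : Integrable (fun x => (U (x, z) - u x) ^ 2) (gauss N) := by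
    refine Integrable.of_bound (((continuousOn_slice hUc hz).aestronglyMeasurable.sub
      (hum.mono_ac (gauss_absolutelyContinuous N))).pow 2) 1 (Eventually.of_forall fun x => ?_)
    have h1 := hu' x
    have h2 := hU (x, z) hz
    rw [Real.norm_of_nonneg (sq_nonneg _), sq_le_one_iff_abs_le_one, abs_le]
    constructor <;> linarith [h1.1, h1.2, h2.1, h2.2]
  have j2 : Integrable (fun x => |u x - t| - |U (x, z) - t| + (1 - 2 * t) * (U (x, z) - u x))
      (gauss N) := (i1.sub i2).add ((i4.sub i3).const_mul _)
  have j3 : Integrable (fun x => levelDefect t (u x) (U (x, z))) (gauss N) :=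
    (j1.const_mul _).add (j2.const_mul _)
  have hsl : MeasurableSet (superlevel U t z) :=
    (isOpen_lt continuous_const (continuousOn_slice hUc hz)).measurableSet
  have hSm : NullMeasurableSet (symmDiff E (superlevel U t z)) (gauss N) :=
    (hE.mono_ac (gauss_absolutelyContinuous N)).symmDiff hsl.nullMeasurableSet
  calc (gauss N).real (symmDiff E (superlevel U t z))
      = ∫ x, (symmDiff E (superlevel U t z)).indicator 1 x ∂gauss N := by
        rw [integral_indicator₀ hSm]; simp
    _ ≤ ∫ x, levelDefect t (u x) (U (x, z)) ∂gauss N := by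
        refine integral_mono ((integrable_const (1 : ℝ)).indicator₀ hSm) j3 fun x => ?_
        by_cases hx : x ∈ symmDiff E (superlevel U t z)
        · rw [indicator_of_mem hx]
          refine one_le_levelDefect ht (hU (x, z) hz) ?_
          rcases hx with ⟨h1, h2⟩ | ⟨h1, h2⟩
          · exact Or.inl ⟨by simp [hudef, h1], not_lt.1 h2⟩
          · exact Or.inr ⟨by simp [hudef, h2], h1⟩
        · rw [indicator_of_notMem hx]
          exact levelDefect_nonneg ht (hu x) (hU (x, z) hz)
    _ = 4 / 3 * (∫ x, (U (x, z) - u x) ^ 2 ∂gauss N) + 8 / 3 *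
        ∫ x, (|u x - t| - |U (x, z) - t| + (1 - 2 * t) * (U (x, z) - u x)) ∂gauss N := by
        simp only [levelDefect]
        rw [integral_add (j1.const_mul _) (j2.const_mul _), integral_const_mul, integral_const_mul]
    _ ≤ _ := by
        have h1 := h.integral_sq_sub_le hs hum hu' hUc hU hz
        have h2 := h.integral_abs_sub_le hs hum hu hUc hU t hz
        linarith

end Superlevel
end FracGauss
end

noncomputable section
namespace FracGauss

/-! ### Stability of the asymmetry -/

section Asymmetry

theorem continuous_cdf (μ : Measure ℝ) [IsProbabilityMeasure μ] (h : ∀ x, μ {x} = 0) :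
    Continuous (cdf μ) := by
  refine continuous_iff_continuousAt.2 fun x => ?_
  rw [(monotone_cdf μ).continuousAt_iff_leftLim_eq_rightLim, (cdf μ).rightLim_eq]
  have h1 := (cdf μ).measure_singleton x
  rw [measure_cdf, h, eq_comm, ENNReal.ofReal_eq_zero] at h1
  exact le_antisymm ((monotone_cdf μ).leftLim_le le_rfl) (by linarith)

theorem exists_measure_Iio_eq (μ : Measure ℝ) [IsProbabilityMeasure μ] (h : ∀ x, μ {x} = 0)
    {c : ℝ} (h0 : 0 < c) (h1 : c < 1) : ∃ r, μ.real (Iio r) = c := by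
  obtain ⟨r, hr⟩ := mem_range_of_exists_le_of_exists_ge (continuous_cdf μ h)
    ((tendsto_cdf_atBot μ).eventually_le_const h0).exists
    ((tendsto_cdf_atTop μ).eventually_const_le h1).exists
  refine ⟨r, ?_⟩
  have : μ (Iio r) = μ (Iic r) := by
    rw [← Iio_union_right, measure_union (by simp) (measurableSet_singleton r), h, add_zero]
  rw [← hr, cdf_eq_real, measureReal_def, measureReal_def, this]

variable {N : ℕ}

theorem measurableSet_halfspace (ω : Space N) (r : ℝ) : MeasurableSet (halfspace ω r) :=
  (isOpen_lt (by fun_prop) continuous_const).measurableSet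

theorem halfspace_mono (ω : Space N) {r r' : ℝ} (h : r ≤ r') : halfspace ω r ⊆ halfspace ω r' :=
  fun _ hx => lt_of_lt_of_le hx h

/-- The projection of the Gaussian measure to a unit direction is a one-dimensional Gaussian of
variance one. It has no atoms, so its distribution function is continuous and takes every value in
`(0, 1)`. -/
theorem exists_halfspace {ω : Space N} (hω : ‖ω‖ = 1) {c : ℝ} (h0 : 0 < c) (h1 : c < 1) :
    ∃ r, (gauss N).real (halfspace ω r) = c := by
  set L : StrongDual ℝ (Space N) := innerSL ℝ ω with hL
  have hmap := IsGaussian.map_eq_gaussianReal (μ := gauss N) L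
  have hv : Var[L; gauss N] = 1 := by
    rw [variance_dual_stdGaussian, hL, innerSL_apply_norm, hω]; norm_num
  rw [hv] at hmap
  have hLm : Measurable L := L.continuous.measurable
  have : IsProbabilityMeasure ((gauss N).map L) := Measure.isProbabilityMeasure_map hLm.aemeasurable
  have hna : ∀ x, ((gauss N).map L) {x} = 0 := fun x => by
    rw [hmap]
    have : NullSingletonClass (gaussianReal ((gauss N)[L]) (Real.toNNReal 1)) :=
      nullSingletonClass_gaussianReal (by simp)
    exact measure_singleton x
  obtain ⟨r, hr⟩ := exists_measure_Iio_eq _ hna h0 h1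
  refine ⟨r, ?_⟩
  rw [← hr, map_measureReal_apply hLm measurableSet_Iio]
  congr 1
  ext x
  simp [halfspace, hL, real_inner_comm]

theorem abs_measureReal_sub_le_symmDiff (E F : Set (Space N)) :
    |(gauss N).real E - (gauss N).real F| ≤ (gauss N).real (symmDiff E F) := by
  have h : ∀ A B : Set (Space N), (gauss N).real A ≤ (gauss N).real B +
      (gauss N).real (symmDiff A B) := fun A B =>
    (measureReal_mono (fun x hx => by
      by_cases hB : x ∈ B
      exacts [Or.inl hB, Or.inr (Or.inl ⟨hx, hB⟩)])).trans (measureReal_union_le _ _)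
  have h1 := h E F
  have h2 := h F E
  rw [symmDiff_comm] at h2
  exact abs_le.2 ⟨by linarith, by linarith⟩

theorem measureReal_symmDiff_triangle (A B C : Set (Space N)) :
    (gauss N).real (symmDiff A C) ≤
      (gauss N).real (symmDiff A B) + (gauss N).real (symmDiff B C) :=
  (measureReal_mono (symmDiff_triangle A B C)).trans (measureReal_union_le _ _)

/-- Parallel halfspaces are nested. -/
theorem measureReal_symmDiff_halfspace (ω : Space N) (r r' : ℝ) :
    (gauss N).real (symmDiff (halfspace ω r) (halfspace ω r')) =
      |(gauss N).real (halfspace ω r) - (gauss N).real (halfspace ω r')| := by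
  have h : ∀ a b : ℝ, a ≤ b → (gauss N).real (symmDiff (halfspace ω a) (halfspace ω b)) =
      |(gauss N).real (halfspace ω a) - (gauss N).real (halfspace ω b)| := fun a b hab => by
    have hs := halfspace_mono ω hab
    rw [symmDiff_of_le hs, measureReal_sdiff hs (measurableSet_halfspace ω a),
      abs_sub_comm, abs_of_nonneg (sub_nonneg.2 (measureReal_mono hs))]
  rcases le_total r r' with h1 | h1
  · exact h _ _ h1
  · rw [symmDiff_comm, abs_sub_comm]; exact h _ _ h1

theorem asymmetry_nonneg (E : Set (Space N)) : 0 ≤ asymmetry E :=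
  Real.sInf_nonneg fun a ⟨_, _, _, _, ha⟩ => by rw [ha]; positivity

theorem asymmetry_mul_le {E : Set (Space N)} (hE : 0 < (gauss N).real E) {ω : Space N} {r : ℝ}
    (hω : ‖ω‖ = 1) (hr : (gauss N).real (halfspace ω r) = (gauss N).real E) :
    asymmetry E * (gauss N).real E ≤ (gauss N).real (symmDiff E (halfspace ω r)) := by
  rw [← le_div_iff₀ hE]
  refine csInf_le ⟨0, fun a ⟨_, _, _, _, ha⟩ => by rw [ha]; positivity⟩ ⟨ω, r, hω, ?_, rfl⟩
  exact (measureReal_eq_measureReal_iff (measure_ne_top _ _) (measure_ne_top _ _)).1 hr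

theorem exists_unit_vector (hN : 1 ≤ N) : ∃ ω : Space N, ‖ω‖ = 1 :=
  ⟨EuclideanSpace.single ⟨0, hN⟩ 1, by simp⟩

/-- The asymmetry depends continuously on the set. -/
theorem asymmetry_mul_le_add (hN : 1 ≤ N) {E F : Set (Space N)} (hE0 : 0 < (gauss N).real E)
    (hE1 : (gauss N).real E < 1) (hF0 : 0 < (gauss N).real F) (hF1 : (gauss N).real F < 1) :
    asymmetry E * (gauss N).real E ≤ asymmetry F * (gauss N).real F +
      (gauss N).real (symmDiff E F) + |(gauss N).real F - (gauss N).real E| := by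
  rw [add_assoc, ← sub_le_iff_le_add, ← div_le_iff₀ hF0]
  obtain ⟨ω, hω⟩ := exists_unit_vector hN
  obtain ⟨r, hr⟩ := exists_halfspace hω hF0 hF1
  -- A competitor must be exhibited, since a real infimum over the empty set would be `0` by
  -- default; this is where a unit vector is needed.
  refine le_csInf ⟨_, ω, r, hω,
    (measureReal_eq_measureReal_iff (measure_ne_top _ _) (measure_ne_top _ _)).1 hr, rfl⟩ ?_
  rintro a ⟨ω, r, hω, hr, rfl⟩
  rw [div_le_div_iff_of_pos_right hF0]
  -- Given a competitor for `F`, the parallel halfspace with the mass of `E` is a competitor for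
  -- `E`. Passing between the two halfspaces costs exactly the difference of the masses.
  obtain ⟨r', hr'⟩ := exists_halfspace hω hE0 hE1
  have h1 := asymmetry_mul_le hE0 hω hr'
  have h2 := measureReal_symmDiff_triangle E F (halfspace ω r')
  have h3 := measureReal_symmDiff_triangle F (halfspace ω r) (halfspace ω r')
  have h4 := measureReal_symmDiff_halfspace ω r r'
  rw [hr', measureReal_def (gauss N) (halfspace ω r), hr, ← measureReal_def] at h4
  linarith

/-- Two sets of equal measure differ by at most the sum of their measures, and also by at most the
sum of the measures of their complements. The two bounds keep the perturbed set away from measure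
`0` and `1` respectively. -/
theorem asymmetry_mul_le_two_mul (hN : 1 ≤ N) {E : Set (Space N)}
    (hE : NullMeasurableSet E (gauss N)) (hE0 : 0 < (gauss N).real E)
    (hE1 : (gauss N).real E < 1) :
    asymmetry E * (gauss N).real E ≤ 2 * (gauss N).real E ∧
      asymmetry E * (gauss N).real E ≤ 2 * (1 - (gauss N).real E) := by
  obtain ⟨ω, hω⟩ := exists_unit_vector hN
  obtain ⟨r, hr⟩ := exists_halfspace hω hE0 hE1
  have h := asymmetry_mul_le hE0 hω hr
  constructor
  · refine h.trans ((measureReal_mono symmDiff_le_sup).trans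
      ((measureReal_union_le _ _).trans ?_))
    rw [hr]; linarith
  · have hsub : symmDiff E (halfspace ω r) ⊆ Eᶜ ∪ (halfspace ω r)ᶜ := by
      rintro x (⟨_, hx⟩ | ⟨_, hx⟩)
      exacts [Or.inr hx, Or.inl hx]
    refine h.trans ((measureReal_mono hsub).trans ((measureReal_union_le _ _).trans ?_))
    rw [probReal_compl_eq_one_sub₀ hE, probReal_compl_eq_one_sub (measurableSet_halfspace ω r), hr]
    linarith

/-- Stability costs twice the symmetric difference, which leaves `1 - 10/27 = 17/27` of the
asymmetry. Normalization by `γ(F) ≤ (1 + 10/27) γ(E) = 37/27 * γ(E)` gives the ratio `17/37`, larger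
than `5/13`. For the volume, `5/27 ≤ 6/27 = 2/9`. -/
theorem le_asymmetry_of_symmDiff_le (hN : 1 ≤ N) {E F : Set (Space N)}
    (hE : NullMeasurableSet E (gauss N)) (hE0 : 0 < (gauss N).real E)
    (hE1 : (gauss N).real E < 1)
    (h : (gauss N).real (symmDiff E F) ≤ 5 / 27 * (asymmetry E * (gauss N).real E)) :
    |(gauss N).real F - (gauss N).real E| ≤ 2 / 9 * (gauss N).real E * asymmetry E ∧
      5 / 13 * asymmetry E ≤ asymmetry F := by
  obtain ⟨h1, h2⟩ := asymmetry_mul_le_two_mul hN hE hE0 hE1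
  have hd := abs_measureReal_sub_le_symmDiff E F
  rw [abs_sub_comm] at hd
  have hA := asymmetry_nonneg E
  have hAF := asymmetry_nonneg F
  obtain ⟨h3, h4⟩ := abs_le.1 (hd.trans h)
  have h5 := asymmetry_mul_le_add hN hE0 hE1 (F := F) (by linarith) (by linarith)
  refine ⟨hd.trans (h.trans ?_), ?_⟩
  · have := mul_nonneg hA hE0.le
    linarith
  · have h6 : (gauss N).real F ≤ 37 / 27 * (gauss N).real E := by linarith
    have h7 := mul_le_mul_of_nonneg_left h6 hAF
    have h8 : 17 / 27 * asymmetry E * (gauss N).real E ≤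
        37 / 27 * asymmetry F * (gauss N).real E := by linarith
    have h9 := le_of_mul_le_mul_right h8 hE0
    linarith

end Asymmetry

/-! ### The constants and the threshold -/

section Constants

/-- With `σ = s/2`, the functional equation gives `Γ(1-σ) = σ |Γ(-σ)|` and `Γ(1+σ) = σ Γ(σ)`, so all
Gamma factors cancel and `1/(2σ)` remains. This is the constant `1/s` produced by integrating
`w^(s-1)`. -/
theorem constBeta_eq {s : ℝ} (hs0 : 0 < s) (hs1 : s < 1) : constBeta s = 1 / s := by
  have hσ : 0 < s / 2 := by linarith
  have h1 : Real.Gamma (1 - s / 2) = -(s / 2) * Real.Gamma (-(s / 2)) := by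
    have := Real.Gamma_add_one (s := -(s / 2)) (by linarith)
    rw [← this]; congr 1; ring
  have h2 : Real.Gamma (1 + s / 2) = s / 2 * Real.Gamma (s / 2) := by
    rw [add_comm]; exact Real.Gamma_add_one hσ.ne'
  have h3 : 0 < Real.Gamma (1 - s / 2) := Real.Gamma_pos_of_pos (by linarith)
  have h4 : 0 < Real.Gamma (s / 2) := Real.Gamma_pos_of_pos hσ
  have h5 : Real.Gamma (-(s / 2)) < 0 := by nlinarith
  have h6 : (0 : ℝ) < 4 ^ (s / 2) := by positivity
  rw [constBeta, constK, h1, h2, abs_of_neg h5]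
  have h7 := h5.ne
  field_simp

theorem asymmetry_mul_of_le_zZero {N : ℕ} {s : ℝ} (hs0 : 0 < s) (hs1 : s < 1) {E : Set (Space N)}
    {z : ℝ} (hz : 0 < z) (hz0 : z ≤ zZero s E) :
    2 * (fracPerimeter s E).toReal * (z ^ s / s) ≤ asymmetry E * (gauss N).real E / 36 := by
  have hA := asymmetry_nonneg E
  set P := (fracPerimeter s E).toReal with hP
  have hP0 : 0 ≤ P := ENNReal.toReal_nonneg
  rw [zZero, constBeta_eq hs0 hs1, ← hP] at hz0
  set x := asymmetry E * (gauss N).real E / (72 * (1 / s) * P) with hx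
  have hx0 : 0 ≤ x := by positivity
  have h1 : z ^ s ≤ x := by
    calc z ^ s ≤ (x ^ (1 / s)) ^ s := Real.rpow_le_rpow hz.le hz0 hs0.le
      _ = x := by rw [← Real.rpow_mul hx0, one_div_mul_cancel hs0.ne', Real.rpow_one]
  -- If the perimeter vanishes, the threshold involves a division by zero and carries no
  -- information; the left side is then zero anyway.
  rcases hP0.eq_or_lt with h0 | h0
  · rw [← h0, mul_zero, zero_mul]
    positivity
  · rw [hx, le_div_iff₀ (by positivity)] at h1
    calc 2 * P * (z ^ s / s) = z ^ s * (72 * (1 / s) * P) / 36 := by ring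
      _ ≤ _ := by gcongr

end Constants
end FracGauss
end

theorem mainTheorem5 (N : ℕ) (hN : 1 ≤ N) (s : ℝ) (hs0 : 0 < s) (hs1 : s < 1)
    (E : Set (FracGauss.Space N)) (hE : NullMeasurableSet E volume)
    (hE0 : 0 < FracGauss.gauss N E) (hE1 : FracGauss.gauss N E < 1)
    (hP : FracGauss.fracPerimeter s E < ∞)
    (U : FracGauss.Space N × ℝ → ℝ) (hU : FracGauss.IsExtension (s / 2) (E.indicator 1) U)
    (t : ℝ) (ht : t ∈ Icc (1 / 4 : ℝ) (3 / 4))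
    (z : ℝ) (hz : 0 < z) (hz0 : z ≤ FracGauss.zZero s E) :
    |(FracGauss.gauss N).real (FracGauss.superlevel U t z) - (FracGauss.gauss N).real E|
        ≤ 2 / 9 * (FracGauss.gauss N).real E * FracGauss.asymmetry E ∧
      FracGauss.asymmetry (FracGauss.superlevel U t z) ≥ 5 / 13 * FracGauss.asymmetry E := by
  obtain ⟨X, hX⟩ := hU.exists_isSolution
  have hum : AEStronglyMeasurable (E.indicator (1 : FracGauss.Space N → ℝ)) volume :=
    ((aemeasurable_const (b := (1 : ℝ))).indicator₀ hE).aestronglyMeasurable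
  have hD : FracGauss.dirichlet s X ≤ 2 * (FracGauss.fracPerimeter s E).toReal := by
    have h1 := hX.dirichlet_le_seminormSq hs0 hum
    have h2 : FracGauss.seminormSq (s / 2) (E.indicator 1) = 2 * FracGauss.fracPerimeter s E := by
      rw [FracGauss.fracPerimeter, ENNReal.mul_div_cancel (by norm_num) (by norm_num)]
    rw [h2] at h1
    have h3 := ENNReal.toReal_mono (ENNReal.mul_ne_top (by norm_num) hP.ne) h1
    rwa [ENNReal.toReal_ofReal (FracGauss.dirichlet_nonneg s X), ENNReal.toReal_mul,
      ENNReal.toReal_ofNat] at h3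
  have hsym := hX.symmDiff_superlevel_le hs0 hE hU.continuousOn ht hz
  have hle := FracGauss.asymmetry_mul_of_le_zZero hs0 hs1 hz hz0
  have hDz : FracGauss.dirichlet s X * (z ^ s / s) ≤
      2 * (FracGauss.fracPerimeter s E).toReal * (z ^ s / s) := by gcongr
  have h0 : 0 < (FracGauss.gauss N).real E := ENNReal.toReal_pos hE0.ne' hE1.ne_top
  have h1 : (FracGauss.gauss N).real E < 1 := by
    have := (ENNReal.toReal_lt_toReal hE1.ne_top ENNReal.one_ne_top).2 hE1
    simpa [measureReal_def] using this
  -- The bounds combine to `20/3 * 1/36 = 5/27`.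
  exact FracGauss.le_asymmetry_of_symmDiff_le hN
    (hE.mono_ac (FracGauss.gauss_absolutelyContinuous N)) h0 h1 (by linarith)
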